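/- A \emph{run} of a finite sequence of distinct real numbers is a maximal nonempty contiguous subsequence that is increasing or decreasing. For $k\ge 3$, a \emph{$k$-rollercoaster} is a finite sequence in which every run has at least $k$ elements (the empty sequence is one). Consider comparison-based random access machine programs: finite programs, built from assignments, conditionals and while-loops, on variables and arrays of machine words, with unit-cost operations (addition, truncated subtraction and multiplication of words, comparison of words, indexed reading and writing of array cells); the input is $n$, $k$ and a sequence $S[1:n]$, whose entries are accessible only through unit-cost comparisons "$S[i]<S[j]$?" for computed positions $i,j$. \textbf{Theorem.} There are one such program and absolute constants $c, C$ such that for every $k\ge 3$, every $n\ge 0$ and every sequence $S[1:n]$ of distinct real numbers, the program, using only machine words less than $(n+k+2)^{c}$ (that is, words of $O(\log(n+k))$ bits), halts after at most $C\max(n,1)\,k^2$ steps and outputs the length of a longest (not necessarily contiguous) subsequence of $S$ that is a $k$-rollercoaster. Thus this length is computed in $O(nk^2)$ time by a comparison-based algorithm. In particular, for every fixed $k\ge3$ (e.g. for ordinary rollercoasters, $k=3$), there is a constant $D$, depending only on $k$, such that the program halts after at most $D\max(n,1)$ steps for all $n$ and $S$, i.e. in linear time. -/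

import Mathlib

namespace Rollercoaster

/-! ### Runs and `k`-rollercoasters -/

/-- The contiguous block `a p, …, a q` of the finite sequence `a` is increasing or decreasing.
A block of a single element is both. -/
def IsMonotoneBlock {m : ℕ} (a : Fin m → ℝ) (p q : Fin m) : Prop :=
  p ≤ q ∧ (StrictMonoOn a (Set.Icc p q) ∨ StrictAntiOn a (Set.Icc p q))

/-- A run: a (nonempty) contiguous block that is increasing or decreasing, maximal under inclusion. -/
def IsRun {m : ℕ} (a : Fin m → ℝ) (p q : Fin m) : Prop :=
  IsMonotoneBlock a p q ∧
    ∀ p' q' : Fin m, p' ≤ p → q ≤ q' → IsMonotoneBlock a p' q' → p' = p ∧ q' = q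

/-- A `k`-rollercoaster: every run has length (number of elements) at least `k`.
The empty sequence has no run, hence is a `k`-rollercoaster. -/
def IsRollercoaster (k : ℕ) {m : ℕ} (a : Fin m → ℝ) : Prop :=
  ∀ p q : Fin m, IsRun a p q → k ≤ ((q : ℕ) - (p : ℕ)) + 1

/-- `r` is the length of a longest (not necessarily contiguous) subsequence of `S` that is a
`k`-rollercoaster. -/
def IsLongestLength (k : ℕ) {n : ℕ} (S : Fin n → ℝ) (r : ℕ) : Prop :=
  IsGreatest {m : ℕ | ∃ e : Fin m → Fin n, StrictMono e ∧ IsRollercoaster k (S ∘ e)} r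

/-! ### Comparison-based random access machine programs

Programs manipulate machine words (natural numbers less than a word bound `W`), which are held in
variables and in arrays.  The names of the variables and arrays are numerals in the program text,
so that a program uses only finitely many of them; array indices are computed at run time.
The input keys `S 0, …, S (n - 1)` cannot be read, copied or altered: the only access to them is
the test `key i j`, which decides whether `S i < S j`. -/

/-- Integer expressions. -/
inductive Expr : Type
  | const (c : ℕ)
  | var (x : ℕ)
  | get (a : ℕ) (i : Expr)
  | add (e f : Expr)
  | sub (e f : Expr)
  | mul (e f : Expr)

/-- Tests: integer comparison, comparison of two input keys, and Boolean combinations. -/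
inductive Test : Type
  | lt (e f : Expr)
  | key (e f : Expr)
  | not (b : Test)
  | and (b d : Test)

/-- Programs. -/
inductive Cmd : Type
  | skip
  | assign (x : ℕ) (e : Expr)
  | put (a : ℕ) (i e : Expr)
  | seq (P Q : Cmd)
  | ite (b : Test) (P Q : Cmd)
  | loop (b : Test) (P : Cmd)

/-- Memory contents: the value of each variable and of each array cell. -/
structure State : Type where
  var : ℕ → ℕ
  arr : ℕ → ℕ → ℕ

/-- The value of an expression; subtraction is truncated at `0`. -/
def Expr.eval (σ : State) : Expr → ℕ
  | .const c => c
  | .var x => σ.var x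
  | .get a i => σ.arr a (i.eval σ)
  | .add e f => e.eval σ + f.eval σ
  | .sub e f => e.eval σ - f.eval σ
  | .mul e f => e.eval σ * f.eval σ

/-- All values (in particular all array indices) that occur when an expression is evaluated are
machine words, that is, less than `W`. -/
def Expr.Fits (W : ℕ) (σ : State) : Expr → Prop
  | .const c => c < W
  | .var x => σ.var x < W
  | .get a i => i.Fits W σ ∧ σ.arr a (i.eval σ) < W
  | .add e f => e.Fits W σ ∧ f.Fits W σ ∧ e.eval σ + f.eval σ < W
  | .sub e f => e.Fits W σ ∧ f.Fits W σ
  | .mul e f => e.Fits W σ ∧ f.Fits W σ ∧ e.eval σ * f.eval σ < W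

/-- The time to evaluate an expression: one unit for every operation, constant, and variable or
array access. -/
def Expr.cost : Expr → ℕ
  | .const _ => 1
  | .var _ => 1
  | .get _ i => i.cost + 1
  | .add e f => e.cost + f.cost + 1
  | .sub e f => e.cost + f.cost + 1
  | .mul e f => e.cost + f.cost + 1

/-- The truth value of a test. -/
def Test.Holds {n : ℕ} (S : Fin n → ℝ) (σ : State) : Test → Prop
  | .lt e f => e.eval σ < f.eval σ
  | .key e f => ∃ (i : e.eval σ < n) (j : f.eval σ < n), S ⟨e.eval σ, i⟩ < S ⟨f.eval σ, j⟩
  | .not b => ¬ b.Holds S σ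
  | .and b d => b.Holds S σ ∧ d.Holds S σ

/-- A test can be evaluated without a fault: all values are machine words, and input keys are
compared only at positions less than `n`.  In a conjunction the second test is evaluated only if
the first one holds. -/
def Test.Safe {n : ℕ} (S : Fin n → ℝ) (W : ℕ) (σ : State) : Test → Prop
  | .lt e f => e.Fits W σ ∧ f.Fits W σ
  | .key e f => (e.Fits W σ ∧ e.eval σ < n) ∧ (f.Fits W σ ∧ f.eval σ < n)
  | .not b => b.Safe S W σ
  | .and b d => b.Safe S W σ ∧ (b.Holds S σ → d.Safe S W σ)

/-- The time charged for a test. -/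
def Test.cost : Test → ℕ
  | .lt e f => e.cost + f.cost + 1
  | .key e f => e.cost + f.cost + 1
  | .not b => b.cost + 1
  | .and b d => b.cost + d.cost + 1

/-- Write a value to a variable. -/
def State.setVar (σ : State) (x v : ℕ) : State :=
  { σ with var := Function.update σ.var x v }

/-- Write a value to an array cell. -/
def State.setArr (σ : State) (a i v : ℕ) : State :=
  { σ with arr := Function.update σ.arr a (Function.update (σ.arr a) i v) }

/-- `Exec S W P σ τ t`: on a machine with word bound `W` and input keys `S`, the program `P` started
in the memory state `σ` halts without a fault in the state `τ` after exactly `t` units of time. -/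
inductive Exec {n : ℕ} (S : Fin n → ℝ) (W : ℕ) : Cmd → State → State → ℕ → Prop
  | skip (σ : State) : Exec S W .skip σ σ 1
  | assign (x : ℕ) (e : Expr) (σ : State) (he : e.Fits W σ) :
      Exec S W (.assign x e) σ (σ.setVar x (e.eval σ)) (e.cost + 1)
  | put (a : ℕ) (i e : Expr) (σ : State) (hi : i.Fits W σ) (he : e.Fits W σ) :
      Exec S W (.put a i e) σ (σ.setArr a (i.eval σ) (e.eval σ)) (i.cost + e.cost + 1)
  | seq {P Q : Cmd} {σ τ υ : State} {s t : ℕ} (hP : Exec S W P σ τ s) (hQ : Exec S W Q τ υ t) :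
      Exec S W (.seq P Q) σ υ (s + t)
  | ite_true {b : Test} {P Q : Cmd} {σ τ : State} {t : ℕ} (hs : b.Safe S W σ)
      (hb : b.Holds S σ) (hP : Exec S W P σ τ t) : Exec S W (.ite b P Q) σ τ (b.cost + t)
  | ite_false {b : Test} {P Q : Cmd} {σ τ : State} {t : ℕ} (hs : b.Safe S W σ)
      (hb : ¬ b.Holds S σ) (hQ : Exec S W Q σ τ t) : Exec S W (.ite b P Q) σ τ (b.cost + t)
  | loop_true {b : Test} {P : Cmd} {σ τ υ : State} {s t : ℕ} (hs : b.Safe S W σ)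
      (hb : b.Holds S σ) (hP : Exec S W P σ τ s) (hL : Exec S W (.loop b P) τ υ t) :
      Exec S W (.loop b P) σ υ (b.cost + s + t)
  | loop_false {b : Test} {P : Cmd} {σ : State} (hs : b.Safe S W σ) (hb : ¬ b.Holds S σ) :
      Exec S W (.loop b P) σ σ b.cost

/-- The initial memory: variable `0` holds `n`, variable `1` holds `k`, everything else is `0`. -/
def initState (n k : ℕ) : State where
  var := fun x => if x = 0 then n else if x = 1 then k else 0
  arr := fun _ _ => 0

/-- On the input `n`, `k`, `S[1:n]`, the program `P`, run on a machine whose words are the numbers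
less than `(n + k + 2) ^ c` (words of `O(log (n + k))` bits), halts without a fault within
`T` units of time, and then variable `0` holds the length of a longest `k`-rollercoaster in `S`. -/
def ComputesWithin (P : Cmd) (c k : ℕ) {n : ℕ} (S : Fin n → ℝ) (T : ℕ) : Prop :=
  ∃ (τ : State) (t : ℕ), Exec S ((n + k + 2) ^ c) P (initState n k) τ t ∧
    IsLongestLength k S (τ.var 0) ∧ t ≤ T

end Rollercoaster

/-!
With the keys negated for one direction, both kinds of runs increase. A dynamic programme over the
positions describes a subsequence by its length, its last position, the direction of its last run
and the number of elements of that run, saturated at `k`; it is *full* if the number is `k`. For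
each direction `d` it keeps the largest length `L d` of a full subsequence, for each length `v` the
lowest endpoint `F d v` of a full subsequence of length at least `v`, and a patience row, a list of
labelled positions with increasing keys: if `j` of them have label at least `w` and key below `z`,
then a subsequence of length at least `w + j - 1` ends below `z` with at least `min j k` elements
in its last run. As in patience sorting, a new position takes the place of its successor in the
row, and the displaced labels are pushed upwards.

A full subsequence can be continued by a run in the opposite direction. So a subsequence that is
too short compared with `L` cannot be of use any more, and the rows may be cut off after `3 * k`
items; a row is then processed in time `O(k ^ 2)`. The only step that is not bounded in `k` is the
scan of `F d` for the longest full subsequence that the new position extends. Every item carries a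
finger, the result of such a scan, at which the scan for a position placed just below the item
starts. The distances from the fingers and labels to `L` form a potential that pays for the scans;
one iteration increases it by `O(k)` and by `O(k)` for each unit by which `L` grows. As
`L d ≤ n`, the total time is `O(n k ^ 2)`.
-/

namespace Rollercoaster

/-! ### Subsequences with a partial last run -/

/-- The key of position `i` in direction `d`: increasing (`true`) or decreasing (`false`), so that
both kinds of runs become increasing.  Its value at positions outside `S` is never used. -/
noncomputable def key {n : ℕ} (S : Fin n → ℝ) (d : Bool) (i : ℕ) : ℝ :=
  if h : i < n then (if d then S ⟨i, h⟩ else -S ⟨i, h⟩) else 0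

/-- `Reach n k T d j x v`: some subsequence of length `v` ends at position `x` with a partial last
run in direction `d` having at least `j` elements, and all its other runs are complete, that is,
have at least `k` elements.  The count `j` saturates at `k`.  In `turnAt` the two runs share the
element at `x`; in `turnAfter` the new run starts with a fresh element, and the pair `y, x` belongs
to one of the two runs, whichever direction it goes. -/
inductive Reach (n k : ℕ) (T : Bool → ℕ → ℝ) : Bool → ℕ → ℕ → ℕ → Prop
  | start (d : Bool) {x : ℕ} (hx : x < n) : Reach n k T d 1 x 1
  | turnAt {d : Bool} {x v : ℕ} (h : Reach n k T (!d) k x v) : Reach n k T d 1 x v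
  | turnAfter {d : Bool} {y x v : ℕ} (hyx : y < x) (hx : x < n) (h : Reach n k T (!d) k y v) :
      Reach n k T d 1 x (v + 1)
  | step {d : Bool} {j y x v : ℕ} (hyx : y < x) (hx : x < n) (hT : T d y < T d x)
      (h : Reach n k T d j y v) : Reach n k T d (min (j + 1) k) x (v + 1)

section Reach

variable {n k : ℕ} {T : Bool → ℕ → ℝ} {d : Bool} {j x v : ℕ}

theorem Reach.lt (h : Reach n k T d j x v) : x < n := by
  induction h <;> assumption

theorem Reach.pos (h : Reach n k T d j x v) : 1 ≤ v := by
  induction h <;> omega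

theorem Reach.le (h : Reach n k T d j x v) : v ≤ x + 1 := by
  induction h <;> omega

end Reach

/-- The elements at places `p, …, q` of the sequence `e` of positions increase in direction `d`. -/
def Climbs (T : Bool → ℕ → ℝ) (e : ℕ → ℕ) (d : Bool) (p q : ℕ) : Prop :=
  ∀ l, p ≤ l → l < q → T d (e l) < T d (e (l + 1))

/-- The places `i, i + 1` lie in a monotone block of at least `k` of the first `m` elements.
A sequence is a rollercoaster when this holds for all its pairs of neighbours. -/
def Covered (k : ℕ) (T : Bool → ℕ → ℝ) (e : ℕ → ℕ) (m i : ℕ) : Prop :=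
  ∃ p q d, p ≤ i ∧ i + 1 ≤ q ∧ q < m ∧ k ≤ q + 1 - p ∧ Climbs T e d p q

section Climbs

variable {k m m' i p q p' q' x y : ℕ} {T : Bool → ℕ → ℝ} {e e' : ℕ → ℕ} {c d : Bool}

theorem eq_of_lt_of_lt (hneg : ∀ d x, T (!d) x = -T d x) (hc : T c x < T c y)
    (hd : T d x < T d y) : c = d := by
  by_contra hne
  rw [Bool.eq_not.2 hne, hneg, hneg] at hc
  linarith

theorem Climbs.of_le (hqp : q ≤ p) : Climbs T e d p q :=
  fun l hl hq => by omega

theorem climbs_succ_self_iff : Climbs T e d p (p + 1) ↔ T d (e p) < T d (e (p + 1)) :=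
  ⟨fun h => h p le_rfl p.lt_succ_self, fun h l hl hq => (by omega : l = p) ▸ h⟩

theorem Climbs.union (h : Climbs T e d p q) (h' : Climbs T e d p' q') (hpq : p' ≤ q)
    (hqp : p ≤ q') : Climbs T e d (min p p') (max q q') := by
  intro l hl hq
  by_cases hin : p ≤ l ∧ l < q
  · exact h l hin.1 hin.2
  · exact h' l (by omega) (by omega)

theorem Climbs.snoc (h : Climbs T e d p q) (hT : T d (e q) < T d (e (q + 1))) :
    Climbs T e d p (q + 1) := by
  intro l hl hq
  rcases Nat.lt_succ_iff_lt_or_eq.1 hq with hlq | rfl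
  exacts [h l hl hlq, hT]

theorem Climbs.congr (h : Climbs T e d p q) (he : ∀ l, l ≤ q → e' l = e l) :
    Climbs T e' d p q := by
  intro l hl hq
  rw [he l hq.le, he (l + 1) hq]
  exact h l hl hq

theorem Covered.congr (h : Covered k T e m i) (hm : m ≤ m') (he : ∀ l, l < m → e' l = e l) :
    Covered k T e' m' i := by
  obtain ⟨p, q, d, hpi, hiq, hqm, hk, hc⟩ := h
  exact ⟨p, q, d, hpi, hiq, hqm.trans_le hm, hk, hc.congr fun l hl => he l (hl.trans_lt hqm)⟩

theorem climbs_iff_strictMonoOn :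
    Climbs T e d p q ↔ StrictMonoOn (fun i => T d (e i)) (Set.Icc p q) :=
  ⟨fun h => strictMonoOn_of_lt_add_one Set.ordConnected_Icc fun l _ hl hl' => h l hl.1 hl'.2,
    fun h l hl hq => h ⟨hl, hq.le⟩ ⟨hl.trans l.le_succ, hq⟩ l.lt_succ_self⟩

end Climbs

/-- `e 0 < ⋯ < e (v - 1)` are positions below `n`, and the last of them is `x`. -/
structure Chain (n : ℕ) (e : ℕ → ℕ) (x v : ℕ) : Prop where
  pos : 1 ≤ v
  mono : ∀ i, i + 1 < v → e i < e (i + 1)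
  last : e (v - 1) = x
  last_lt : x < n

section Chain

variable {n x y v : ℕ} {e : ℕ → ℕ}

theorem Chain.singleton (hx : x < n) : Chain n (fun _ => x) x 1 :=
  ⟨le_rfl, fun i hi => by omega, rfl, hx⟩

theorem update_of_lt {l : ℕ} (hl : l < v) : Function.update e v x l = e l :=
  Function.update_of_ne hl.ne _ _

theorem Chain.snoc (h : Chain n e y v) (hyx : y < x) (hx : x < n) :
    Chain n (Function.update e v x) x (v + 1) := by
  refine ⟨by omega, fun i hi => ?_, Function.update_self .., hx⟩
  rcases Nat.lt_succ_iff_lt_or_eq.1 hi with hiv | rfl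
  · rw [update_of_lt (by omega), update_of_lt hiv]
    exact h.mono i hiv
  · rw [Function.update_self, update_of_lt i.lt_succ_self]
    exact h.last.trans_lt hyx

theorem Chain.strictMonoOn (h : Chain n e x v) : StrictMonoOn e (Set.Iio v) :=
  strictMonoOn_of_lt_add_one Set.ordConnected_Iio fun i _ _ hi => h.mono i hi

theorem Chain.lt (h : Chain n e x v) {i : ℕ} (hi : i < v) : e i < n := by
  have hle : e i ≤ e (v - 1) :=
    h.strictMonoOn.monotoneOn hi (Set.mem_Iio.2 (Nat.sub_lt h.pos one_pos)) (by omega)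
  exact (hle.trans_eq h.last).trans_lt h.last_lt

end Chain

/-- `e` is a subsequence witnessing `Reach n k T d j x v`: its last `r ≥ j` elements climb in
direction `d`, and all earlier pairs of neighbours are covered. -/
structure Witness (n k : ℕ) (T : Bool → ℕ → ℝ) (e : ℕ → ℕ) (d : Bool) (j x v : ℕ) : Prop
    extends Chain n e x v where
  tail : ∃ r, j ≤ r ∧ 1 ≤ r ∧ r ≤ v ∧ Climbs T e d (v - r) (v - 1) ∧
    ∀ i, i + 1 + r ≤ v → Covered k T e v i

section Witness

variable {n k : ℕ} {T : Bool → ℕ → ℝ} {e : ℕ → ℕ} {d : Bool} {j x y v : ℕ}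

theorem Witness.le (h : Witness n k T e d j x v) : j ≤ v := by
  obtain ⟨r, hjr, -, hrv, -⟩ := h.tail
  exact hjr.trans hrv

theorem Witness.covered (h : Witness n k T e d k x v) {i : ℕ} (hi : i + 1 < v) :
    Covered k T e v i := by
  obtain ⟨r, hkr, hr, hrv, hclimb, hcov⟩ := h.tail
  by_cases hir : i + 1 + r ≤ v
  · exact hcov i hir
  · exact ⟨v - r, v - 1, d, by omega, by omega, by omega, by omega, hclimb⟩

theorem Witness.start (hx : x < n) : Witness n k T (fun _ => x) d 1 x 1 :=
  ⟨.singleton hx, 1, le_rfl, le_rfl, le_rfl, .of_le le_rfl, fun i hi => by omega⟩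

theorem Witness.turnAt (h : Witness n k T e (!d) k x v) : Witness n k T e d 1 x v :=
  ⟨h.toChain, 1, le_rfl, le_rfl, h.pos, .of_le le_rfl, fun _ hi => h.covered (by omega)⟩

theorem Chain.climbs_update {c : Bool} {p : ℕ} (h : Chain n e y v)
    (hc : Climbs T e c p (v - 1)) (hT : T c y < T c x) :
    Climbs T (Function.update e v x) c p v := by
  have hv := Nat.sub_add_cancel h.pos
  have := (hc.congr (e' := Function.update e v x) fun l hl =>
    update_of_lt (by omega)).snoc (by
      rwa [hv, Function.update_self, update_of_lt (by omega), h.last])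
  rwa [hv] at this

theorem Witness.step (h : Witness n k T e d j y v) (hyx : y < x) (hx : x < n)
    (hT : T d y < T d x) : Witness n k T (Function.update e v x) d (min (j + 1) k) x (v + 1) := by
  obtain ⟨r, hjr, hr, hrv, hclimb, hcov⟩ := h.tail
  refine ⟨h.toChain.snoc hyx hx, r + 1, by omega, by omega, by omega, ?_, fun i hi =>
    (hcov i (by omega)).congr (by omega) fun l hl => update_of_lt hl⟩
  simpa using h.toChain.climbs_update hclimb hT

theorem Witness.turnAfter (hneg : ∀ d x, T (!d) x = -T d x) (hne : T d y ≠ T d x)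
    (h : Witness n k T e (!d) k y v) (hyx : y < x) (hx : x < n) :
    Witness n k T (Function.update e v x) d 1 x (v + 1) := by
  have hcov : ∀ i, i + 1 < v → Covered k T (Function.update e v x) (v + 1) i := fun i hi =>
    (h.covered hi).congr (by omega) fun l hl => update_of_lt hl
  refine ⟨h.toChain.snoc hyx hx, ?_⟩
  rcases hne.lt_or_gt with hlt | hgt
  · refine ⟨2, by omega, by omega, by have := h.pos; omega, ?_, fun i hi => hcov i (by omega)⟩
    exact h.toChain.climbs_update (.of_le (by omega)) hlt
  · refine ⟨1, le_rfl, le_rfl, by omega, .of_le le_rfl, fun i hi => ?_⟩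
    rcases Nat.lt_or_ge (i + 1) v with hiv | hiv
    · exact hcov i hiv
    · obtain ⟨r, hkr, hr, hrv, hclimb, -⟩ := h.tail
      exact ⟨v - r, v, !d, by omega, by omega, by omega, by omega,
        h.toChain.climbs_update hclimb (by rw [hneg, hneg]; exact neg_lt_neg hgt)⟩

theorem Reach.exists_witness (hneg : ∀ d x, T (!d) x = -T d x)
    (hne : ∀ d x y, x < y → y < n → T d x ≠ T d y) (h : Reach n k T d j x v) :
    ∃ e, Witness n k T e d j x v := by
  induction h with
  | start d hx => exact ⟨_, .start hx⟩
  | turnAt _ ih => exact ih.imp fun _ he => he.turnAt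
  | turnAfter hyx hx _ ih =>
    obtain ⟨e, he⟩ := ih
    exact ⟨_, he.turnAfter hneg (hne _ _ _ hyx hx) hyx hx⟩
  | step hyx hx hT _ ih =>
    obtain ⟨e, he⟩ := ih
    exact ⟨_, he.step hyx hx hT⟩

end Witness

section key

variable {n : ℕ} {S : Fin n → ℝ} {x y : ℕ}

theorem key_not (d : Bool) (x : ℕ) : key S (!d) x = -key S d x := by
  unfold key
  cases d <;> split <;> simp

theorem key_ne (hS : Function.Injective S) (d : Bool) (hxy : x < y) (hy : y < n) :
    key S d x ≠ key S d y := by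
  have hSxy : S ⟨x, hxy.trans hy⟩ ≠ S ⟨y, hy⟩ := hS.ne (Fin.ne_of_lt hxy)
  unfold key
  cases d <;> simpa [hxy.trans hy, hy] using hSxy

theorem exists_key_lt (hS : Function.Injective S) (hxy : x < y) (hy : y < n) :
    ∃ d, key S d x < key S d y := by
  rcases (key_ne hS true hxy hy).lt_or_gt with h | h
  · exact ⟨true, h⟩
  · exact ⟨!true, by rw [key_not, key_not]; exact neg_lt_neg h⟩

end key

section Rollercoaster

variable {n k m : ℕ} {S : Fin n → ℝ} {e : Fin m → Fin n} {f : ℕ → ℕ} {d : Bool} {p q : Fin m}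

theorem strictMonoOn_Icc_iff_climbs (hf : ∀ i : Fin m, f i = e i) :
    StrictMonoOn (fun i => key S d (e i)) (Set.Icc p q) ↔ Climbs (key S) f d p q := by
  rw [climbs_iff_strictMonoOn]
  constructor
  · intro h i hi j hj hij
    have hjm : j < m := hj.2.trans_lt q.isLt
    have := @h ⟨i, hij.trans hjm⟩ hi ⟨j, hjm⟩ hj hij
    simpa only [← hf] using this
  · intro h i hi j hj hij
    simpa only [hf] using h (a := i) hi (b := j) hj hij

theorem isMonotoneBlock_iff (hf : ∀ i : Fin m, f i = e i) :
    IsMonotoneBlock (S ∘ e) p q ↔ (p : ℕ) ≤ q ∧ ∃ d, Climbs (key S) f d p q := by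
  have hanti : StrictAntiOn (S ∘ e) (Set.Icc p q) ↔
      StrictMonoOn (fun i => key S false (e i)) (Set.Icc p q) := by
    simp [key, StrictAntiOn, StrictMonoOn]
  have hmono : StrictMonoOn (S ∘ e) (Set.Icc p q) ↔
      StrictMonoOn (fun i => key S true (e i)) (Set.Icc p q) := by
    simp [key, StrictMonoOn]
  rw [IsMonotoneBlock, hanti, hmono, Fin.le_def, Bool.exists_bool, or_comm,
    strictMonoOn_Icc_iff_climbs hf, strictMonoOn_Icc_iff_climbs hf]

theorem IsRun.le_and_le (hf : ∀ i : Fin m, f i = e i) (h : IsRun (S ∘ e) p q) {p' q' : ℕ}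
    (hp : p' ≤ p) (hq : (q : ℕ) ≤ q') (hm : q' < m) (hc : Climbs (key S) f d p' q') :
    (p : ℕ) ≤ p' ∧ q' ≤ q := by
  have hpq : (p : ℕ) ≤ q := h.1.1
  have hpq' : p' ≤ q' := hp.trans (hpq.trans hq)
  obtain ⟨hpp, hqq⟩ := h.2 ⟨p', hpq'.trans_lt hm⟩ ⟨q', hm⟩ hp hq
    ((isMonotoneBlock_iff hf).2 ⟨hpq', d, hc⟩)
  exact ⟨(Fin.ext_iff.1 hpp).ge, (Fin.ext_iff.1 hqq).le⟩

/-- A run of one element could be extended by either neighbour. -/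
theorem IsRun.lt (hf : ∀ i : Fin m, f i = e i) (hm : 2 ≤ m)
    (hdir : ∀ i, i + 1 < m → ∃ d, key S d (f i) < key S d (f (i + 1)))
    (h : IsRun (S ∘ e) p q) : (p : ℕ) < q := by
  by_contra! hqp
  rcases Nat.lt_or_ge (p + 1) m with hp | hp
  · obtain ⟨d, hd⟩ := hdir p hp
    have := h.le_and_le hf le_rfl (by omega) hp (climbs_succ_self_iff.2 hd)
    omega
  · obtain ⟨i, hi⟩ : ∃ i, (p : ℕ) = i + 1 := ⟨p - 1, by omega⟩
    obtain ⟨d, hd⟩ := hdir i (by omega)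
    have := h.le_and_le hf (by omega) (by omega) (by omega) (climbs_succ_self_iff.2 hd)
    omega

theorem isRollercoaster_of_covered (hf : ∀ i : Fin m, f i = e i) (hk : 2 ≤ k)
    (hkm : k ≤ m) (hcov : ∀ i, i + 1 < m → Covered k (key S) f m i) :
    IsRollercoaster k (S ∘ e) := by
  intro p q hrun
  have hpq : (p : ℕ) < q := hrun.lt hf (hk.trans hkm) fun i hi => by
    obtain ⟨p, q, d, hpi, hiq, -, -, hc⟩ := hcov i hi
    exact ⟨d, hc i hpi hiq⟩
  obtain ⟨-, d, hd⟩ := (isMonotoneBlock_iff hf).1 hrun.1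
  obtain ⟨p', q', d', hp', hq', hqm, hk', hd'⟩ := hcov p (by omega)
  obtain rfl : d' = d := eq_of_lt_of_lt key_not (hd' p hp' hq') (hd p le_rfl hpq)
  have := hrun.le_and_le hf (min_le_left _ _) (le_max_left _ _) (max_lt q.isLt hqm)
    (hd.union hd' (by omega) (by omega))
  omega

theorem Reach.isRollercoaster (hS : Function.Injective S) (hk : 2 ≤ k) {x v : ℕ}
    (h : Reach n k (key S) d k x v) :
    ∃ e : Fin v → Fin n, StrictMono e ∧ IsRollercoaster k (S ∘ e) := by
  obtain ⟨f, hf⟩ := h.exists_witness key_not fun d x y hxy hy => key_ne hS d hxy hy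
  exact ⟨fun i => ⟨f i, hf.lt i.isLt⟩, fun i j hij => hf.strictMonoOn i.isLt j.isLt hij,
    isRollercoaster_of_covered (fun _ => rfl) hk hf.le fun i hi => hf.covered hi⟩

end Rollercoaster

/-- The pair of neighbours ending at place `p`, if there is one, goes against direction `d`, so that
a block climbing in direction `d` cannot be extended to the left of `p`. -/
def TurnsAt (T : Bool → ℕ → ℝ) (f : ℕ → ℕ) (d : Bool) (p : ℕ) : Prop :=
  ∀ l, l + 1 = p → T (!d) (f l) < T (!d) (f (l + 1))

section TurnsAt

variable {n k m : ℕ} {T : Bool → ℕ → ℝ} {S : Fin n → ℝ} {e : Fin m → Fin n} {f : ℕ → ℕ} {d : Bool}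

theorem isRun_of_climbs {p q : Fin m} (hf : ∀ i : Fin m, f i = e i) (hpq : (p : ℕ) < q)
    (hc : Climbs (key S) f d p q) (hleft : TurnsAt (key S) f d p)
    (hright : (q : ℕ) + 1 < m → key S (!d) (f q) < key S (!d) (f (q + 1))) :
    IsRun (S ∘ e) p q := by
  refine ⟨(isMonotoneBlock_iff hf).2 ⟨hpq.le, d, hc⟩, fun p' q' hp hq hb => ?_⟩
  obtain ⟨-, d', hc'⟩ := (isMonotoneBlock_iff hf).1 hb
  rw [Fin.le_def] at hp hq
  obtain rfl : d' = d := eq_of_lt_of_lt key_not (hc' p hp (by omega)) (hc p le_rfl hpq)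
  have hpp : (p : ℕ) ≤ p' := by
    by_contra! hlt
    obtain ⟨l, hl⟩ : ∃ l, l + 1 = (p : ℕ) := ⟨p - 1, by omega⟩
    simpa using eq_of_lt_of_lt key_not (hleft l hl) (hc' l (by omega) (by omega))
  have hqq : (q' : ℕ) ≤ q := by
    by_contra! hlt
    simpa using eq_of_lt_of_lt key_not (hright (by omega)) (hc' q (by omega) hlt)
  exact ⟨Fin.ext (by omega), Fin.ext (by omega)⟩

theorem exists_reach_prefix (hn : ∀ i, i < m → f i < n)
    (hmono : ∀ i, i + 1 < m → f i < f (i + 1))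
    (hdir : ∀ i, i + 1 < m → ∃ d, T d (f i) < T d (f (i + 1)))
    (hrun : ∀ d p q, p < q → q + 1 < m → Climbs T f d p q → TurnsAt T f d p →
      T (!d) (f q) < T (!d) (f (q + 1)) → k ≤ q - p + 1) (i : ℕ) (hi : i + 1 < m) :
    ∃ d p, p < i + 1 ∧ Climbs T f d p (i + 1) ∧ TurnsAt T f d p ∧
      Reach n k T d (min (i + 1 - p + 1) k) (f (i + 1)) (i + 2) := by
  induction i with
  | zero =>
    obtain ⟨d, hd⟩ := hdir 0 hi
    exact ⟨d, 0, one_pos, climbs_succ_self_iff.2 hd, fun l hl => by omega,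
      .step (hmono 0 hi) (hn _ hi) hd (.start d (hn 0 (by omega)))⟩
  | succ i ih =>
    obtain ⟨d, p, hp, hc, hleft, hR⟩ := ih (by omega)
    obtain ⟨c, hcd⟩ := hdir (i + 1) hi
    by_cases hcase : c = d
    · subst hcase
      refine ⟨c, p, by omega, hc.snoc hcd, hleft, ?_⟩
      convert Reach.step (hmono (i + 1) hi) (hn _ hi) hcd hR using 1
      omega
    · obtain rfl : c = !d := Bool.eq_not.2 hcase
      have hlen := hrun d p (i + 1) hp hi hc hleft hcd
      rw [min_eq_right (by omega), ← Bool.not_not d] at hR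
      refine ⟨!d, i + 1, by omega, climbs_succ_self_iff.2 hcd, fun l hl => ?_, ?_⟩
      · obtain rfl : l = i := by omega
        simpa only [Bool.not_not] using hc l (by omega) (by omega)
      · convert Reach.step (hmono (i + 1) hi) (hn _ hi) hcd hR.turnAt using 1
        omega

theorem IsRollercoaster.le_length (hr : IsRollercoaster k (S ∘ e)) (hm : m = 1) : k ≤ 1 := by
  subst hm
  simpa using hr 0 0 ⟨⟨le_rfl, Or.inl (Set.Subsingleton.strictMonoOn _ (by simp))⟩,
    fun p' q' _ _ _ => ⟨Subsingleton.elim _ _, Subsingleton.elim _ _⟩⟩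

theorem IsRollercoaster.exists_reach (hS : Function.Injective S) (hk : 2 ≤ k) (he : StrictMono e)
    (hr : IsRollercoaster k (S ∘ e)) (hm : 1 ≤ m) : ∃ d x, Reach n k (key S) d k x m := by
  let f : ℕ → ℕ := fun i => if h : i < m then e ⟨i, h⟩ else 0
  have hf : ∀ i : Fin m, f i = e i := fun i => by simp [f]
  have hn : ∀ i, i < m → f i < n := fun i hi => (hf ⟨i, hi⟩).trans_lt (e ⟨i, hi⟩).isLt
  have hmono : ∀ i, i + 1 < m → f i < f (i + 1) := fun i hi => by
    have := he (a := ⟨i, by omega⟩) (b := ⟨i + 1, hi⟩) (Fin.mk_lt_mk.2 i.lt_succ_self)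
    rwa [Fin.lt_def, ← hf, ← hf] at this
  have hrun : ∀ d p q, p < q → q < m → Climbs (key S) f d p q → TurnsAt (key S) f d p →
      (q + 1 < m → key S (!d) (f q) < key S (!d) (f (q + 1))) → k ≤ q - p + 1 :=
    fun d p q hpq hq hc hleft hright => hr ⟨p, hpq.trans hq⟩ ⟨q, hq⟩
      (isRun_of_climbs hf hpq hc hleft hright)
  obtain rfl | ⟨i, rfl⟩ : m = 1 ∨ ∃ i, m = i + 2 := by
    rcases hm.eq_or_lt with h | h
    exacts [Or.inl h.symm, Or.inr ⟨m - 2, by omega⟩]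
  · exact absurd (hr.le_length rfl) (by omega)
  · obtain ⟨d, p, hp, hc, hleft, hR⟩ := exists_reach_prefix (k := k) hn hmono
      (fun i hi => exists_key_lt hS (hmono i hi) (hn _ hi))
      (fun d p q hpq hq hc hleft hright => hrun d p q hpq (by omega) hc hleft fun _ => hright)
      i (by omega)
    have hlen := hrun d p (i + 1) hp (by omega) hc hleft fun h => by omega
    rw [min_eq_right (by omega)] at hR
    exact ⟨d, _, hR⟩

end TurnsAt

theorem isLongestLength_of_reach {n k r : ℕ} {S : Fin n → ℝ} (hS : Function.Injective S)
    (hk : 2 ≤ k) (hr : r = 0 ∨ ∃ d x v, r ≤ v ∧ Reach n k (key S) d k x v)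
    (hmax : ∀ d x v, Reach n k (key S) d k x v → v ≤ r) : IsLongestLength k S r := by
  constructor
  · rcases hr with rfl | ⟨d, x, v, hv, h⟩
    · exact ⟨fun i => i.elim0, fun i => i.elim0, fun p => p.elim0⟩
    · obtain rfl : r = v := le_antisymm hv (hmax _ _ _ h)
      exact h.isRollercoaster hS hk
  · rintro m ⟨e, he, hm⟩
    rcases Nat.eq_zero_or_pos m with rfl | hpos
    · exact Nat.zero_le _
    · obtain ⟨d, x, h⟩ := hm.exists_reach hS hk he hpos
      exact hmax _ _ _ h

/-! ### Patience rows -/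

/-- An element of a patience row: a position, its label, and its finger.  The labels encode the
lengths of the partial sequences in the sense of `count`; the finger is a value of the opposite
direction at which a later scan may start. -/
structure Item : Type where
  pos : ℕ
  label : ℕ
  finger : ℕ

/-- The keys of a row increase. -/
abbrev Ascending (T : ℕ → ℝ) (R : List Item) : Prop :=
  R.Pairwise fun a b => T a.pos < T b.pos

/-- The number of items of a row with label at least `w` and key less than `z`.  If it is `j ≥ 1`,
then a sequence of value at least `w + j - 1` ends below `z` with a partial run of `j` elements. -/
noncomputable def count (T : ℕ → ℝ) (R : List Item) (w : ℕ) (z : ℝ) : ℕ :=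
  open Classical in R.countP fun a => decide (T a.pos < z ∧ w ≤ a.label)

/-- Push a displaced label through a row: every item keeps the smaller of its own label and the
passing one, and passes on the larger. -/
def cascade : ℕ → List Item → List Item
  | _, [] => []
  | r, a :: R => ⟨a.pos, min a.label r, a.finger⟩ :: cascade (max r a.label) R

/-- What remains of the upper part of a row after its first element has been replaced. -/
def displace : List Item → List Item
  | [] => []
  | a :: R => cascade a.label R

section count

variable {T : ℕ → ℝ} {w : ℕ} {z s : ℝ}

@[simp] theorem count_nil : count T [] w z = 0 := rfl

theorem count_cons (a : Item) (R : List Item) : open Classical in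
    count T (a :: R) w z = count T R w z + if T a.pos < z ∧ w ≤ a.label then 1 else 0 := by
  classical
  simp [count, List.countP_cons]

theorem count_append (R Q : List Item) :
    count T (R ++ Q) w z = count T R w z + count T Q w z := by
  simp [count, List.countP_append]

theorem one_le_count {R : List Item} :
    1 ≤ count T R w z ↔ ∃ a ∈ R, T a.pos < z ∧ w ≤ a.label := by
  unfold count
  rw [Nat.succ_le_iff, List.countP_pos_iff]
  simp

theorem count_eq_zero {R : List Item} (h : ∀ a ∈ R, z ≤ T a.pos) : count T R w z = 0 := by
  by_contra h0
  obtain ⟨a, ha, h1, -⟩ := one_le_count.1 (Nat.one_le_iff_ne_zero.2 h0)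
  exact absurd (h a ha) (not_le.2 h1)

theorem count_eq_length {R : List Item} (h : ∀ a ∈ R, T a.pos < z ∧ w ≤ a.label) :
    count T R w z = R.length := by
  unfold count
  rw [List.countP_eq_length]
  simpa using h

theorem count_congr {R : List Item} {w' : ℕ} {z' : ℝ}
    (h : ∀ a ∈ R, (T a.pos < z ∧ w ≤ a.label) ↔ (T a.pos < z' ∧ w' ≤ a.label)) :
    count T R w z = count T R w' z' := by
  unfold count
  exact List.countP_congr fun a ha => by simpa using h a ha

theorem count_filter {R : List Item} {c : ℕ} (h : c ≤ w) :
    count T (R.filter fun a => decide (c ≤ a.label)) w z = count T R w z := by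
  unfold count
  rw [List.countP_filter]
  refine List.countP_congr fun a _ => ?_
  simp only [Bool.decide_and, Bool.and_eq_true, decide_eq_true_eq]
  exact ⟨fun h => h.1, fun h' => ⟨h', h.trans h'.2⟩⟩

theorem count_mono_sublist {R Q : List Item} (h : R.Sublist Q) :
    count T R w z ≤ count T Q w z := h.countP_le

theorem count_eq_zero_of_le {a : Item} {R : List Item} (hR : ∀ b ∈ R, T a.pos < T b.pos)
    (ha : z ≤ T a.pos) : count T R w z = 0 :=
  count_eq_zero fun b hb => ha.trans (hR b hb).le

theorem count_cascade {R : List Item} (hR : Ascending T R) (r : ℕ) :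
    count T (cascade r R) w z = if w ≤ r then count T R w z else count T R w z - 1 := by
  induction R generalizing r with
  | nil => simp [cascade]
  | cons a R ih =>
    rw [Ascending, List.pairwise_cons] at hR
    rw [cascade, count_cons, ih hR.2, count_cons]
    by_cases hwr : w ≤ r
    · simp [hwr]
    · by_cases hwa : w ≤ a.label
      · by_cases haz : T a.pos < z
        · simp [hwr, hwa, haz]
        · simp [hwr, hwa, haz, count_eq_zero_of_le hR.1 (not_lt.1 haz)]
      · simp [hwr, hwa]

theorem count_displace {R : List Item} (hR : Ascending T R) :
    count T (displace R) w z = count T R w z - 1 := by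
  cases R with
  | nil => rfl
  | cons a R =>
    rw [Ascending, List.pairwise_cons] at hR
    rw [displace, count_cascade hR.2, count_cons]
    by_cases hwa : w ≤ a.label
    · by_cases haz : T a.pos < z
      · simp [hwa, haz]
      · simp [hwa, haz, count_eq_zero_of_le hR.1 (not_lt.1 haz)]
    · simp [hwa]

end count

section cascade

theorem mem_cascade {b : Item} {R : List Item} {r : ℕ} (h : b ∈ cascade r R) :
    ∃ a ∈ R, b.pos = a.pos ∧ b.finger = a.finger ∧ (b.label = r ∨ ∃ c ∈ R, b.label = c.label) := by
  induction R generalizing r with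
  | nil => simp [cascade] at h
  | cons a R ih =>
    rw [cascade, List.mem_cons] at h
    rcases h with rfl | h
    · refine ⟨a, by simp, rfl, rfl, ?_⟩
      rcases le_total a.label r with h | h
      · exact Or.inr ⟨a, by simp, by simp [h]⟩
      · exact Or.inl (by simp [h])
    · obtain ⟨c, hc, hpos, hfinger, hlabel⟩ := ih h
      refine ⟨c, by simp [hc], hpos, hfinger, ?_⟩
      rcases hlabel with hlabel | ⟨e, he, hlabel⟩
      · rcases le_total a.label r with h | h
        · exact Or.inl (by rw [hlabel, max_eq_left h])
        · exact Or.inr ⟨a, by simp, by rw [hlabel, max_eq_right h]⟩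
      · exact Or.inr ⟨e, by simp [he], hlabel⟩

theorem mem_displace {b : Item} {R : List Item} (h : b ∈ displace R) :
    ∃ a ∈ R, b.pos = a.pos ∧ b.finger = a.finger ∧ ∃ c ∈ R, b.label = c.label := by
  cases R with
  | nil => simp [displace] at h
  | cons a R =>
    obtain ⟨c, hc, hpos, hfinger, hlabel⟩ := mem_cascade h
    refine ⟨c, by simp [hc], hpos, hfinger, ?_⟩
    rcases hlabel with hlabel | ⟨e, he, hlabel⟩
    · exact ⟨a, by simp, hlabel⟩
    · exact ⟨e, by simp [he], hlabel⟩

@[simp] theorem length_cascade (r : ℕ) (R : List Item) : (cascade r R).length = R.length := by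
  induction R generalizing r with
  | nil => rfl
  | cons a R ih => simp [cascade, ih]

@[simp] theorem length_displace (R : List Item) : (displace R).length = R.length - 1 := by
  cases R <;> simp [displace]

theorem map_pos_cascade (r : ℕ) (R : List Item) :
    (cascade r R).map Item.pos = R.map Item.pos := by
  induction R generalizing r with
  | nil => rfl
  | cons a R ih => simp [cascade, ih]

theorem map_pos_displace (R : List Item) :
    (displace R).map Item.pos = (R.map Item.pos).tail := by
  cases R <;> simp [displace, map_pos_cascade]

theorem ascending_iff_map_pos {T : ℕ → ℝ} {R : List Item} :
    Ascending T R ↔ (R.map Item.pos).Pairwise fun a b => T a < T b := by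
  rw [Ascending, List.pairwise_map]

theorem Ascending.displace {T : ℕ → ℝ} {R : List Item} (hR : Ascending T R) :
    Ascending T (displace R) := by
  rw [ascending_iff_map_pos, map_pos_displace]
  exact (ascending_iff_map_pos.1 hR).tail

end cascade

section insertion

variable {T : ℕ → ℝ} {w : ℕ} {z : ℝ} {A B : List Item} {x : Item}

theorem count_insertion (hB : Ascending T B) : open Classical in
    count T (A ++ x :: displace B) w z =
      count T A w z + (count T B w z - 1) + if T x.pos < z ∧ w ≤ x.label then 1 else 0 := by
  rw [count_append, count_cons, count_displace hB, add_assoc]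

theorem count_le_count_insertion (hB : Ascending T B)
    (hxB : ∀ b ∈ B, T x.pos < T b.pos) (hlab : ∀ b ∈ B, b.label ≤ x.label) :
    count T (A ++ B) w z ≤ count T (A ++ x :: displace B) w z := by
  rw [count_insertion hB, count_append]
  rcases Nat.eq_zero_or_pos (count T B w z) with h | h
  · omega
  · obtain ⟨a, ha, h1, h2⟩ := one_le_count.1 h
    rw [if_pos ⟨(hxB a ha).trans h1, h2.trans (hlab a ha)⟩]
    omega

theorem count_lt_count_insertion (hB : Ascending T B)
    (hAx : ∀ a ∈ A, T a.pos < T x.pos) (hxB : ∀ b ∈ B, T x.pos < T b.pos)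
    (hz : T x.pos < z) (hw : w ≤ x.label) :
    count T (A ++ B) w (T x.pos) + 1 ≤ count T (A ++ x :: displace B) w z := by
  rw [count_insertion hB, count_append, count_eq_zero fun b hb => (hxB b hb).le,
    if_pos ⟨hz, hw⟩, count_congr (w' := w) (z' := z) fun a ha =>
      and_congr_left fun _ => iff_of_true (hAx a ha) ((hAx a ha).trans hz)]
  omega

theorem le_count_insertion {j : ℕ} (hB : Ascending T B)
    (hAx : ∀ a ∈ A, T a.pos < T x.pos)
    (h : j ≤ count T (A ++ x :: displace B) w z) :
    j ≤ count T (A ++ B) w z ∨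
      T x.pos < z ∧ w ≤ x.label ∧ j ≤ count T (A ++ B) w (T x.pos) + 1 := by
  rw [count_insertion hB] at h
  rw [count_append]
  by_cases hc : T x.pos < z ∧ w ≤ x.label
  · rw [if_pos hc] at h
    rcases Nat.eq_zero_or_pos (count T B w z) with h0 | h0
    · right
      refine ⟨hc.1, hc.2, ?_⟩
      rw [count_append, count_congr (R := A) (w' := w) (z' := z) fun a ha =>
        and_congr_left fun _ => iff_of_true (hAx a ha) ((hAx a ha).trans hc.1)]
      omega
    · left; omega
  · rw [if_neg hc] at h
    left; omega

end insertion

theorem exists_bound_of_count_take_lt {T : ℕ → ℝ} {Q : List Item} {m w : ℕ} {z : ℝ}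
    (hQ : Ascending T Q) (h : count T (Q.take m) w z < count T Q w z) :
    (Q.take m).length = m ∧ ∃ y < z, ∀ a ∈ Q.take m, T a.pos < y := by
  have hsplit := count_append (T := T) (w := w) (z := z) (Q.take m) (Q.drop m)
  rw [List.take_append_drop] at hsplit
  obtain ⟨b, hb, hbz, -⟩ := one_le_count.1 (show 1 ≤ count T (Q.drop m) w z by omega)
  rw [← List.take_append_drop m Q, Ascending, List.pairwise_append] at hQ
  have hlen := List.length_pos_of_mem hb
  rw [List.length_drop] at hlen
  exact ⟨by rw [List.length_take]; omega, _, hbz, fun a ha => hQ.2.2 a ha b hb⟩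

/-! ### The data of the algorithm -/

/-- The data kept by the algorithm, for each direction: the largest value of a full sequence, that
is, of a sequence whose last run is complete; the best endpoint for each value; and the truncated
patience row. -/
structure Data : Type where
  L : Bool → ℕ
  F : Bool → ℕ → ℕ
  R : Bool → List Item

/-- Values up to `base` are irrelevant for the further computation. -/
def Data.base (D : Data) (k : ℕ) (d : Bool) : ℕ := min (D.L (!d)) (D.L d - k)

/-- The algorithm knows a sequence of value at least `v` that ends below `z`, at level `j` or at a
level from which no improvement over `L` is possible. -/
inductive Data.Knows (D : Data) (k : ℕ) (T : Bool → ℕ → ℝ) (d : Bool) (j v : ℕ) (z : ℝ) : Prop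
  | small (hv : v ≤ D.base k d)
  | row {w i : ℕ} (hw : 1 ≤ w) (hi : 1 ≤ i) (hik : i < k) (hv : v + 1 ≤ w + i)
      (hc : i ≤ count (T d) (D.R d) w z) (hj : j ≤ i ∨ v + k ≤ D.L d + i)
  | full {u : ℕ} (hvu : v ≤ u) (hu : D.base k d < u) (huL : u ≤ D.L d) (hz : T d (D.F d u) < z)

/-- The data describe the first `t` positions, and the rows have at most `m` items. -/
structure Inv (n k : ℕ) (T : Bool → ℕ → ℝ) (m t : ℕ) (D : Data) : Prop where
  complete : ∀ d x v, x < t → Reach n k T d k x v → v ≤ D.L d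
  full : ∀ d v, 1 ≤ v → v ≤ D.L d →
    D.F d v < t ∧ ∃ v', v ≤ v' ∧ Reach n k T d k (D.F d v) v'
  mono : ∀ d v v', D.base k d < v → v ≤ v' → v' ≤ D.L d → T d (D.F d v) ≤ T d (D.F d v')
  sorted : ∀ d, Ascending (T d) (D.R d)
  item : ∀ d, ∀ a ∈ D.R d, a.pos < t ∧ 1 ≤ a.label ∧ a.label ≤ D.L (!d) + 1
  finger : ∀ d, ∀ a ∈ D.R d, a.finger ≤ D.base k (!d) ∨
    a.finger ≤ D.L (!d) ∧ T (!d) (D.F (!d) a.finger) ≤ T (!d) a.pos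
  length : ∀ d, (D.R d).length ≤ m
  row : ∀ d w z j, 1 ≤ w → 1 ≤ j → j ≤ count (T d) (D.R d) w z →
    ∃ x v, x < t ∧ T d x < z ∧ w + j ≤ v + 1 ∧ Reach n k T d (min j k) x v
  knows : ∀ d x j v z, x < t → Reach n k T d j x v → T d x < z → D.Knows k T d j v z

theorem inv_zero (n k m : ℕ) (T : Bool → ℕ → ℝ) (F : Bool → ℕ → ℕ) :
    Inv n k T m 0 ⟨fun _ => 0, F, fun _ => []⟩ where
  complete := by simp
  full d v hv hvL := by simp at hvL; omega
  mono d v v' hb _ hvL := by simp only [Data.base] at hb hvL; omega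
  sorted := by simp
  item := by simp
  finger := by simp
  length := by simp
  row d w z j _ hj hc := by rw [count_nil] at hc; omega
  knows := by simp

/-- Items with a label below `threshold` are irrelevant. -/
def Data.threshold (D : Data) (k : ℕ) (d : Bool) : ℕ := D.base k d + 1 - k

/-- The items of a row that may influence the further computation. -/
def Data.relevant (D : Data) (k : ℕ) (d : Bool) : List Item :=
  (D.R d).filter fun a => decide (D.threshold k d ≤ a.label)

/-- Truncation of the rows. -/
def Data.trim (D : Data) (k : ℕ) : Data where
  L := D.L
  F := D.F
  R d := (D.relevant k d).take (3 * k)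

section trim

variable {n k m t : ℕ} {T : Bool → ℕ → ℝ} {D : Data} {d : Bool}

theorem Data.relevant_sublist : (D.relevant k d).Sublist (D.R d) := List.filter_sublist

theorem Data.trim_sublist : ((D.trim k).R d).Sublist (D.R d) :=
  (List.take_sublist _ _).trans Data.relevant_sublist

theorem Inv.label_le (h : Inv n k T m t D) {w : ℕ} {z : ℝ} (hc : 1 ≤ count (T d) (D.R d) w z) :
    w ≤ D.L (!d) + 1 := by
  obtain ⟨a, ha, -, hwa⟩ := one_le_count.1 hc
  exact hwa.trans (h.item d a ha).2.2

theorem Inv.max_one_threshold_le_label (h : Inv n k T m t D) {a : Item}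
    (ha : a ∈ D.relevant k d) : max 1 (D.threshold k d) ≤ a.label :=
  max_le (h.item d a (Data.relevant_sublist.subset ha)).2.1
    (of_decide_eq_true (List.mem_filter.1 ha).2)

theorem Inv.value_le (h : Inv n k T m t D) {w j : ℕ} {z : ℝ} (hw : 1 ≤ w) (hj : 1 ≤ j)
    (hk : k ≤ j) (hc : j ≤ count (T d) (D.R d) w z) : w + j ≤ D.L d + 1 := by
  obtain ⟨x, v, hx, -, hv, hR⟩ := h.row d w z j hw hj hc
  rw [min_eq_right hk] at hR
  have := h.complete d x v hx hR
  omega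

theorem Inv.overflow (h : Inv n k T m t D) (hk : 1 ≤ k) {w : ℕ} {z : ℝ} (hw : 1 ≤ w)
    (hth : D.threshold k d ≤ w) (hc : 3 * k ≤ count (T d) (D.R d) w z) :
    D.L (!d) + k < D.L d ∧ D.base k d = D.L (!d) := by
  have := h.value_le hw (by omega) (by omega) hc
  unfold Data.threshold Data.base at hth
  unfold Data.base
  omega

theorem Inv.exists_full_of_overflow (h : Inv n k T m t D) (hk : 1 ≤ k) {v : ℕ} {y z : ℝ}
    (hyz : y < z) (hc : 3 * k ≤ count (T d) (D.R d) (max 1 (D.threshold k d)) y)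
    (hv : v ≤ D.L (!d) + k) :
    ∃ u, v ≤ u ∧ D.base k d < u ∧ u ≤ D.L d ∧ T d (D.F d u) < z := by
  obtain ⟨-, hbase⟩ := h.overflow hk (le_max_left _ _) (le_max_right _ _) hc
  obtain ⟨x, u, hx, hxy, hu, hR⟩ := h.row d _ _ _ (le_max_left _ _) (by omega) hc
  rw [min_eq_right (by omega)] at hR
  have hth : D.threshold k d = D.base k d + 1 - k := rfl
  rcases h.knows d x k u z hx hR (hxy.trans hyz) with hub | ⟨-, hi, hik, hui, hci, -⟩ |
    ⟨huu, hb, huL, hz⟩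
  · omega
  · have := h.label_le (hi.trans hci)
    omega
  · exact ⟨_, by omega, hb, huL, hz⟩

theorem Inv.knows_trim (h : Inv n k T m t D) {x j v : ℕ} {z : ℝ} (hx : x < t)
    (hR : Reach n k T d j x v) (hz : T d x < z) : (D.trim k).Knows k T d j v z := by
  rcases h.knows d x j v z hx hR hz with hv | ⟨hw, hi, hik, hv, hc, hj⟩ | ⟨hvu, hu, huL, huz⟩
  · exact .small hv
  · rename_i w i
    by_cases hth : D.threshold k d ≤ w
    · rw [← count_filter hth] at hc
      by_cases hcut : i ≤ count (T d) ((D.trim k).R d) w z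
      · exact .row hw hi hik hv hcut hj
      · obtain ⟨hlen, y, hyz, hy⟩ := exists_bound_of_count_take_lt
          ((h.sorted d).sublist Data.relevant_sublist) (lt_of_not_ge fun hle => hcut (hc.trans hle))
        have hfull : count (T d) ((D.trim k).R d) (max 1 (D.threshold k d)) y = 3 * k :=
          (count_eq_length fun a ha => ⟨hy a ha, h.max_one_threshold_le_label
            ((List.take_sublist _ _).subset ha)⟩).trans hlen
        have hw := h.label_le ((hi.trans hc).trans (count_mono_sublist Data.relevant_sublist))
        obtain ⟨u, hvu, hu, huL, huz⟩ := h.exists_full_of_overflow (v := v) (by omega) hyz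
          (hfull.ge.trans (count_mono_sublist Data.trim_sublist)) (by omega)
        exact .full hvu hu huL huz
    · refine .small ?_
      change v ≤ D.base k d
      unfold Data.threshold at hth
      omega
  · exact .full hvu hu huL huz

theorem Inv.trim (h : Inv n k T m t D) : Inv n k T (3 * k) t (D.trim k) where
  complete := h.complete
  full := h.full
  mono := h.mono
  sorted d := (h.sorted d).sublist Data.trim_sublist
  item d a ha := h.item d a (Data.trim_sublist.subset ha)
  finger d a ha := h.finger d a (Data.trim_sublist.subset ha)
  length _ := List.length_take_le ..
  row d w z j hw hj hc := h.row d w z j hw hj (hc.trans (count_mono_sublist Data.trim_sublist))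
  knows _ _ _ _ _ hx hR hz := h.knows_trim hx hR hz

end trim

/-! ### The treatment of one position -/

/-- The value of a new position, if `b` is the base, `w` the best value of a full sequence that the
position extends, and `z` the best label of a sequence of `k - 1` elements that it completes. -/
def bestValue (k b w z : ℕ) : ℕ := max (if b < w then w + 1 else 0) (if 1 ≤ z then z + k - 1 else 0)

section bestValue

variable {k b w z : ℕ}

theorem succ_le_bestValue (h : b < w) : w + 1 ≤ bestValue k b w z := by
  simp [bestValue, h]

theorem add_sub_one_le_bestValue (h : 1 ≤ z) : z + k - 1 ≤ bestValue k b w z := by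
  simp [bestValue, h]

theorem bestValue_cases (h : 1 ≤ bestValue k b w z) :
    b < w ∧ bestValue k b w z = w + 1 ∨ 1 ≤ z ∧ bestValue k b w z = z + k - 1 := by
  unfold bestValue at h ⊢
  split_ifs at h ⊢ <;> omega

theorem bestValue_le : bestValue k b w z ≤ max (w + 1) (z + k - 1) := by
  unfold bestValue
  split_ifs <;> omega

end bestValue

/-- The value of the new position in direction `d`, when `w` and `z` have been computed. -/
abbrev Data.newValue (D : Data) (k : ℕ) (z w : Bool → ℕ) (d : Bool) : ℕ :=
  bestValue k (D.base k d) (w d) (z d)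

/-- The item of the new position `t` in the row of direction `d`.  Its label is the largest value of
a sequence in which a run in direction `d` starts at `t`. -/
def Data.newItem (D : Data) (k t : ℕ) (z w : Bool → ℕ) (d : Bool) : Item :=
  ⟨t, max (D.newValue k z w (!d)) (D.L (!d) + 1), w (!d)⟩

/-- The data after the treatment of position `t`, before the rows are truncated. -/
def Data.insert (D : Data) (k t : ℕ) (A B : Bool → List Item) (z w : Bool → ℕ) : Data where
  L d := max (D.L d) (D.newValue k z w d)
  F d v := if w d < v ∧ v ≤ D.newValue k z w d then t else D.F d v
  R d := A d ++ D.newItem k t z w d :: displace (B d)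

/-- The quantities computed for the new position `t`: the row is split at the key of `t`, `z` is
the best label of a sequence of `k - 1` elements below `t`, and `w` is the result of the scan. -/
structure Probe (k : ℕ) (T : Bool → ℕ → ℝ) (t : ℕ) (D : Data) (A B : Bool → List Item)
    (z w : Bool → ℕ) : Prop where
  split : ∀ d, D.R d = A d ++ B d
  below : ∀ d, ∀ a ∈ A d, T d a.pos < T d t
  above : ∀ d, ∀ a ∈ B d, T d t < T d a.pos
  le_z : ∀ d l, 1 ≤ l → k ≤ count (T d) (D.R d) l (T d t) + 1 → l ≤ z d
  z_spec : ∀ d, 1 ≤ z d → k ≤ count (T d) (D.R d) (z d) (T d t) + 1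
  base_le : ∀ d, D.base k d ≤ w d
  finger_le : ∀ d a, (B (!d)).head? = some a → a.finger ≤ w d
  w_le : ∀ d, w d ≤ D.L d
  scanned : ∀ d, w d = D.base k d ∨ (∃ a, (B (!d)).head? = some a ∧ w d = a.finger) ∨
    T d (D.F d (w d)) < T d t
  maximal : ∀ d, w d < D.L d → T d t ≤ T d (D.F d (w d + 1))

section Probe

variable {n k m t : ℕ} {T : Bool → ℕ → ℝ} {D : Data} {A B : Bool → List Item} {z w : Bool → ℕ}
  {d : Bool}

theorem Probe.mem_of_mem_left (hp : Probe k T t D A B z w) {a : Item} (ha : a ∈ A d) :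
    a ∈ D.R d := by
  rw [hp.split]
  exact List.mem_append_left _ ha

theorem Probe.mem_of_mem_right (hp : Probe k T t D A B z w) {a : Item} (ha : a ∈ B d) :
    a ∈ D.R d := by
  rw [hp.split]
  exact List.mem_append_right _ ha

theorem Probe.ascending_left (h : Inv n k T m t D) (hp : Probe k T t D A B z w) :
    Ascending (T d) (A d) :=
  (h.sorted d).sublist (by rw [hp.split]; exact List.sublist_append_left _ _)

theorem Probe.ascending_right (h : Inv n k T m t D) (hp : Probe k T t D A B z w) :
    Ascending (T d) (B d) :=
  (h.sorted d).sublist (by rw [hp.split]; exact List.sublist_append_right _ _)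

theorem Probe.lt_of_base_lt (hneg : ∀ d x, T (!d) x = -T d x) (h : Inv n k T m t D)
    (hp : Probe k T t D A B z w) (hb : D.base k d < w d) : T d (D.F d (w d)) < T d t := by
  rcases hp.scanned d with hwb | ⟨a, ha, hwa⟩ | hlt
  · omega
  · have haB : a ∈ B (!d) := List.mem_of_mem_head? ha
    have hta := hp.above _ a haB
    have hfinger := h.finger _ a (hp.mem_of_mem_right haB)
    rw [Bool.not_not, ← hwa] at hfinger
    rw [hneg, hneg] at hta
    rcases hfinger with hle | ⟨-, hle⟩
    · omega
    · linarith
  · exact hlt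

theorem Probe.lt_of_le (hneg : ∀ d x, T (!d) x = -T d x) (h : Inv n k T m t D)
    (hp : Probe k T t D A B z w) {v : ℕ} (hb : D.base k d < v) (hv : v ≤ w d) :
    T d (D.F d v) < T d t :=
  (h.mono d v (w d) hb hv (hp.w_le d)).trans_lt (hp.lt_of_base_lt hneg h (hb.trans_le hv))

theorem Probe.le_of_lt (h : Inv n k T m t D) (hp : Probe k T t D A B z w) {v : ℕ}
    (hv : w d < v) (hL : v ≤ D.L d) : T d t ≤ T d (D.F d v) :=
  (hp.maximal d (hv.trans_le hL)).trans (h.mono d _ _ (Nat.lt_succ_of_le (hp.base_le d)) hv hL)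

theorem Probe.le_w (h : Inv n k T m t D) (hp : Probe k T t D A B z w) {v : ℕ}
    (hL : v ≤ D.L d) (hlt : T d (D.F d v) < T d t) : v ≤ w d :=
  le_of_not_gt fun hv => hlt.not_ge (hp.le_of_lt h hv hL)

theorem Probe.reach_newValue (hk : 2 ≤ k) (ht : t < n) (hneg : ∀ d x, T (!d) x = -T d x)
    (h : Inv n k T m t D) (hp : Probe k T t D A B z w) (hU : 1 ≤ D.newValue k z w d) :
    ∃ v, D.newValue k z w d ≤ v ∧ Reach n k T d k t v := by
  rcases bestValue_cases hU with ⟨hb, heq⟩ | ⟨hz, heq⟩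
  · obtain ⟨hF, v, hv, hR⟩ := h.full d (w d) (by omega) (hp.w_le d)
    have hstep := Reach.step hF ht (hp.lt_of_base_lt hneg h hb) hR
    rw [min_eq_right (by omega)] at hstep
    exact ⟨v + 1, heq.trans_le (by omega), hstep⟩
  · have hc := hp.z_spec d hz
    obtain ⟨x, v, hx, hlt, hv, hR⟩ := h.row d (z d) (T d t) (k - 1) hz (by omega) (by omega)
    have hstep := Reach.step hx ht hlt hR
    rw [show min (min (k - 1) k + 1) k = k by omega] at hstep
    exact ⟨v + 1, heq.trans_le (by omega), hstep⟩

theorem Probe.value_le (hk : 1 ≤ k) (h : Inv n k T m t D) (hp : Probe k T t D A B z w) {j y v : ℕ}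
    (hy : y < t) (hT : T d y < T d t) (hR : Reach n k T d j y v) (hj : k ≤ j + 1) :
    v + 1 ≤ (D.insert k t A B z w).L d := by
  change v + 1 ≤ max (D.L d) (D.newValue k z w d)
  have hv := hR.pos
  rcases h.knows d y j v _ hy hR hT with hvb | ⟨hu, -, hik, huv, hc, hj'⟩ | ⟨hvu, hb, huL, hz⟩
  · unfold Data.base at hvb
    omega
  · rename_i u i
    by_cases hcase : k ≤ i + 1
    · have hz := hp.le_z d u hu (by omega)
      exact le_max_of_le_right ((by omega : v + 1 ≤ z d + k - 1).trans
        (add_sub_one_le_bestValue (hu.trans hz)))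
    · omega
  · have hle := hp.le_w h huL hz
    exact le_max_of_le_right ((by omega : v + 1 ≤ w d + 1).trans
      (succ_le_bestValue (hb.trans_le hle)))

theorem Probe.complete (hk : 2 ≤ k) (h : Inv n k T m t D) (hp : Probe k T t D A B z w)
    {x v : ℕ} (hx : x < t + 1) (hR : Reach n k T d k x v) : v ≤ (D.insert k t A B z w).L d := by
  rcases Nat.lt_succ_iff_lt_or_eq.1 hx with hxt | rfl
  · exact (h.complete d x v hxt hR).trans (le_max_left _ _)
  · obtain ⟨j, hj, hR⟩ : ∃ j, k ≤ j ∧ Reach n k T d j x v := ⟨k, le_rfl, hR⟩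
    cases hR with
    | start | turnAt | turnAfter => omega
    | step hyx _ hT hy => exact hp.value_le (by omega) h hyx hT hy (le_min_iff.1 hj).1

theorem Probe.le_label_of_reach (hk : 2 ≤ k) (h : Inv n k T m t D) (hp : Probe k T t D A B z w)
    {x v : ℕ} (hx : x < t + 1) (hR : Reach n k T (!d) k x v) :
    v ≤ (D.newItem k t z w d).label :=
  (hp.complete hk h hx hR).trans (max_le (le_max_of_le_right (Nat.le_succ _))
    (le_max_left _ _))

theorem Probe.reach_label (hk : 2 ≤ k) (ht : t < n) (hneg : ∀ d x, T (!d) x = -T d x)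
    (h : Inv n k T m t D) (hp : Probe k T t D A B z w) (d : Bool) :
    ∃ v, (D.newItem k t z w d).label ≤ v ∧ Reach n k T d 1 t v := by
  change ∃ v, max (D.newValue k z w (!d)) (D.L (!d) + 1) ≤ v ∧ _
  rcases le_or_gt (D.newValue k z w (!d)) (D.L (!d) + 1) with hle | hlt
  · rw [max_eq_right hle]
    rcases Nat.eq_zero_or_pos (D.L (!d)) with hzero | hpos
    · exact ⟨1, by omega, .start d ht⟩
    · obtain ⟨hF, v, hv, hR⟩ := h.full (!d) _ hpos le_rfl
      exact ⟨v + 1, by omega, .turnAfter hF ht hR⟩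
  · rw [max_eq_left hlt.le]
    obtain ⟨v, hv, hR⟩ := hp.reach_newValue hk ht hneg h (d := !d) (by omega)
    exact ⟨v, hv, .turnAt hR⟩

theorem Data.le_insert_L : D.L d ≤ (D.insert k t A B z w).L d := le_max_left _ _

theorem Data.newValue_le_insert_L : D.newValue k z w d ≤ (D.insert k t A B z w).L d :=
  le_max_right _ _

theorem Data.base_le_base_insert : D.base k d ≤ (D.insert k t A B z w).base k d :=
  min_le_min Data.le_insert_L (Nat.sub_le_sub_right Data.le_insert_L k)

theorem Probe.insert_F_le (h : Inv n k T m t D) (hp : Probe k T t D A B z w) {v : ℕ}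
    (hL : v ≤ D.L d) : T d ((D.insert k t A B z w).F d v) ≤ T d (D.F d v) := by
  simp only [Data.insert]
  split_ifs with hv
  · exact hp.le_of_lt h hv.1 hL
  · exact le_rfl

theorem Probe.insert_F_lt (hneg : ∀ d x, T (!d) x = -T d x) (h : Inv n k T m t D)
    (hp : Probe k T t D A B z w) {v : ℕ} (hb : (D.insert k t A B z w).base k d < v)
    (hv : v ≤ w d) : T d ((D.insert k t A B z w).F d v) < T d t := by
  simp only [Data.insert, hv.not_gt, false_and, if_false]
  exact hp.lt_of_le hneg h (Data.base_le_base_insert.trans_lt hb) hv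

theorem Probe.insert_F_le_key (hneg : ∀ d x, T (!d) x = -T d x) (h : Inv n k T m t D)
    (hp : Probe k T t D A B z w) {v : ℕ} (hb : (D.insert k t A B z w).base k d < v)
    (hv : v ≤ D.newValue k z w d) : T d ((D.insert k t A B z w).F d v) ≤ T d t := by
  rcases Nat.lt_or_ge (w d) v with hwv | hvw
  · simp [Data.insert, hwv, hv]
  · exact (hp.insert_F_lt hneg h hb hvw).le

theorem Probe.insert_full (hk : 2 ≤ k) (ht : t < n) (hneg : ∀ d x, T (!d) x = -T d x)
    (h : Inv n k T m t D) (hp : Probe k T t D A B z w) {v : ℕ} (hv : 1 ≤ v)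
    (hvL : v ≤ (D.insert k t A B z w).L d) :
    (D.insert k t A B z w).F d v < t + 1 ∧
      ∃ v', v ≤ v' ∧ Reach n k T d k ((D.insert k t A B z w).F d v) v' := by
  have hw := hp.w_le d
  simp only [Data.insert] at hvL ⊢
  split_ifs with hnew
  · obtain ⟨v', hv', hR⟩ := hp.reach_newValue hk ht hneg h (hv.trans hnew.2)
    exact ⟨t.lt_succ_self, v', hnew.2.trans hv', hR⟩
  · obtain ⟨hF, hR⟩ := h.full d v hv (by omega)
    exact ⟨hF.trans t.lt_succ_self, hR⟩

theorem Probe.insert_mono (hneg : ∀ d x, T (!d) x = -T d x) (h : Inv n k T m t D)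
    (hp : Probe k T t D A B z w) {v v' : ℕ} (hb : (D.insert k t A B z w).base k d < v)
    (hvv : v ≤ v') (hvL : v' ≤ (D.insert k t A B z w).L d) :
    T d ((D.insert k t A B z w).F d v) ≤ T d ((D.insert k t A B z w).F d v') := by
  have hw := hp.w_le d
  have hvL' : v' ≤ max (D.L d) (D.newValue k z w d) := hvL
  by_cases hnew' : w d < v' ∧ v' ≤ D.newValue k z w d
  · rw [show (D.insert k t A B z w).F d v' = t from if_pos hnew']
    exact hp.insert_F_le_key hneg h hb (hvv.trans hnew'.2)
  · rw [show (D.insert k t A B z w).F d v' = D.F d v' from if_neg hnew']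
    have hv'L : v' ≤ D.L d := by omega
    exact (hp.insert_F_le h (hvv.trans hv'L)).trans
      (h.mono d v v' (Data.base_le_base_insert.trans_lt hb) hvv hv'L)

theorem Probe.insert_ascending (h : Inv n k T m t D) (hp : Probe k T t D A B z w) :
    Ascending (T d) ((D.insert k t A B z w).R d) := by
  have hdisplace : ∀ b ∈ displace (B d), T d t < T d b.pos := fun b hb => by
    obtain ⟨a, ha, hpos, -⟩ := mem_displace hb
    rw [hpos]
    exact hp.above d a ha
  refine List.pairwise_append.2 ⟨hp.ascending_left h, List.pairwise_cons.2
    ⟨hdisplace, (hp.ascending_right h).displace⟩, fun a ha b hb => ?_⟩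
  rcases List.mem_cons.1 hb with rfl | hb
  · exact hp.below d a ha
  · exact (hp.below d a ha).trans (hdisplace b hb)

theorem Probe.insert_item (h : Inv n k T m t D) (hp : Probe k T t D A B z w) {a : Item}
    (ha : a ∈ (D.insert k t A B z w).R d) :
    a.pos < t + 1 ∧ 1 ≤ a.label ∧ a.label ≤ (D.insert k t A B z w).L (!d) + 1 := by
  have hL : D.L (!d) ≤ (D.insert k t A B z w).L (!d) := Data.le_insert_L
  rcases List.mem_append.1 ha with ha | ha
  · have := h.item d a (hp.mem_of_mem_left ha)
    omega
  rcases List.mem_cons.1 ha with rfl | ha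
  · have hU : D.newValue k z w (!d) ≤ _ := Data.newValue_le_insert_L (t := t) (A := A) (B := B)
    simp only [Data.newItem]
    omega
  · obtain ⟨b, hb, hpos, -, c, hc, hlabel⟩ := mem_displace ha
    have hbt := (h.item d b (hp.mem_of_mem_right hb)).1
    have hcL := (h.item d c (hp.mem_of_mem_right hc)).2
    omega

theorem Probe.insert_finger (hneg : ∀ d x, T (!d) x = -T d x) (h : Inv n k T m t D)
    (hp : Probe k T t D A B z w) {a : Item} (ha : a ∈ (D.insert k t A B z w).R d) :
    a.finger ≤ (D.insert k t A B z w).base k (!d) ∨ a.finger ≤ (D.insert k t A B z w).L (!d) ∧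
      T (!d) ((D.insert k t A B z w).F (!d) a.finger) ≤ T (!d) a.pos := by
  have hold : ∀ a ∈ D.R d, a.finger ≤ (D.insert k t A B z w).base k (!d) ∨
      a.finger ≤ (D.insert k t A B z w).L (!d) ∧
        T (!d) ((D.insert k t A B z w).F (!d) a.finger) ≤ T (!d) a.pos := fun a ha =>
    (h.finger d a ha).imp (·.trans Data.base_le_base_insert) fun ⟨hL, hF⟩ =>
      ⟨hL.trans Data.le_insert_L, (hp.insert_F_le h hL).trans hF⟩
  rcases List.mem_append.1 ha with ha | ha
  · exact hold a (hp.mem_of_mem_left ha)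
  rcases List.mem_cons.1 ha with rfl | ha
  · rcases le_or_gt (w (!d)) ((D.insert k t A B z w).base k (!d)) with hle | hlt
    · exact Or.inl hle
    · exact Or.inr ⟨(hp.w_le _).trans Data.le_insert_L, (hp.insert_F_lt hneg h hlt le_rfl).le⟩
  · obtain ⟨b, hb, hpos, hfinger, -⟩ := mem_displace ha
    rw [hpos, hfinger]
    exact hold b (hp.mem_of_mem_right hb)

theorem Probe.insert_length (h : Inv n k T m t D) (hp : Probe k T t D A B z w) :
    ((D.insert k t A B z w).R d).length ≤ m + 1 := by
  have hlen := h.length d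
  rw [hp.split, List.length_append] at hlen
  simp only [Data.insert, List.length_append, List.length_cons, length_displace]
  omega

theorem Probe.insert_row (hk : 2 ≤ k) (ht : t < n) (hneg : ∀ d x, T (!d) x = -T d x)
    (h : Inv n k T m t D) (hp : Probe k T t D A B z w) {u j : ℕ} {y : ℝ} (hu : 1 ≤ u) (hj : 1 ≤ j)
    (hc : j ≤ count (T d) ((D.insert k t A B z w).R d) u y) :
    ∃ x v, x < t + 1 ∧ T d x < y ∧ u + j ≤ v + 1 ∧ Reach n k T d (min j k) x v := by
  have hsplit := le_count_insertion (x := D.newItem k t z w d) (hp.ascending_right h)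
    (hp.below d) hc
  rw [← hp.split] at hsplit
  rcases hsplit with hold | ⟨hty, hlabel, hbelow⟩
  · obtain ⟨x, v, hx, hxy, hv, hR⟩ := h.row d u y j hu hj hold
    exact ⟨x, v, hx.trans t.lt_succ_self, hxy, hv, hR⟩
  rcases hj.eq_or_lt with rfl | hj1
  · obtain ⟨v, hv, hR⟩ := hp.reach_label hk ht hneg h d
    rw [← min_eq_left (by omega : 1 ≤ k)] at hR
    exact ⟨t, v, t.lt_succ_self, hty, Nat.succ_le_succ (hlabel.trans hv), hR⟩
  · change j ≤ count (T d) (D.R d) u (T d t) + 1 at hbelow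
    obtain ⟨x, v, hx, hxt, hv, hR⟩ := h.row d u (T d t) (j - 1) hu (by omega) (by omega)
    have hstep := Reach.step hx ht hxt hR
    rw [show min (min (j - 1) k + 1) k = min j k by omega] at hstep
    exact ⟨t, v + 1, t.lt_succ_self, hty, by omega, hstep⟩

theorem Probe.label_le_newItem (h : Inv n k T m t D) {a : Item} (ha : a ∈ D.R d) :
    a.label ≤ (D.newItem k t z w d).label :=
  (h.item d a ha).2.2.trans (le_max_right _ _)

theorem Probe.count_le_count_insert (h : Inv n k T m t D) (hp : Probe k T t D A B z w) {u : ℕ}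
    {y : ℝ} : count (T d) (D.R d) u y ≤ count (T d) ((D.insert k t A B z w).R d) u y := by
  rw [hp.split]
  exact count_le_count_insertion (hp.ascending_right h) (hp.above d) fun b hb =>
    Probe.label_le_newItem h (hp.mem_of_mem_right hb)

theorem Probe.count_lt_count_insert (h : Inv n k T m t D) (hp : Probe k T t D A B z w) {u : ℕ}
    {y : ℝ} (hy : T d t < y) (hu : u ≤ (D.newItem k t z w d).label) :
    count (T d) (D.R d) u (T d t) < count (T d) ((D.insert k t A B z w).R d) u y := by
  rw [hp.split]
  exact count_lt_count_insertion (x := D.newItem k t z w d) (hp.ascending_right h) (hp.below d)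
    (hp.above d) hy hu

theorem Probe.knows_insert_old (h : Inv n k T m t D) (hp : Probe k T t D A B z w) {j v : ℕ} {y : ℝ}
    (hD : D.Knows k T d j v y) : (D.insert k t A B z w).Knows k T d j v y := by
  have hL : D.L d ≤ (D.insert k t A B z w).L d := Data.le_insert_L
  rcases hD with hv | ⟨hw, hi, hik, hv, hc, hj⟩ | ⟨hvu, -, huL, huy⟩
  · exact .small (hv.trans Data.base_le_base_insert)
  · exact .row hw hi hik hv (hc.trans (hp.count_le_count_insert h)) (by omega)
  · rename_i u
    rcases le_or_gt u ((D.insert k t A B z w).base k d) with hle | hlt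
    · exact .small (hvu.trans hle)
    · exact .full hvu hlt (huL.trans hL) ((hp.insert_F_le h huL).trans_lt huy)

theorem Probe.knows_insert_start (hk : 2 ≤ k) (h : Inv n k T m t D) (hp : Probe k T t D A B z w)
    {j v : ℕ} {y : ℝ} (hy : T d t < y) (hv : v ≤ (D.newItem k t z w d).label)
    (hj : j ≤ 1 ∨ v + k ≤ D.L d + 1) : (D.insert k t A B z w).Knows k T d j v y :=
  .row (i := 1) (Nat.le_add_left 1 _ |>.trans (le_max_right _ _)) le_rfl hk (Nat.succ_le_succ hv)
    (Nat.one_le_of_lt (hp.count_lt_count_insert h hy le_rfl))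
    (hj.imp_right (·.trans (Nat.succ_le_succ Data.le_insert_L)))

theorem Probe.knows_insert_newValue (hneg : ∀ d x, T (!d) x = -T d x) (h : Inv n k T m t D)
    (hp : Probe k T t D A B z w) {j v : ℕ} {y : ℝ} (hy : T d t < y)
    (hv : v ≤ D.newValue k z w d) : (D.insert k t A B z w).Knows k T d j v y := by
  rcases le_or_gt v ((D.insert k t A B z w).base k d) with hle | hlt
  · exact .small hle
  · exact .full le_rfl hlt (hv.trans Data.newValue_le_insert_L)
      ((hp.insert_F_le_key hneg h hlt hv).trans_lt hy)

theorem Probe.knows_insert_step (hk : 2 ≤ k) (hneg : ∀ d x, T (!d) x = -T d x)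
    (h : Inv n k T m t D) (hp : Probe k T t D A B z w) {j v : ℕ} {y : ℝ} (hy : T d t < y)
    (hv : 1 ≤ v) (hD : D.Knows k T d j v (T d t)) :
    (D.insert k t A B z w).Knows k T d (min (j + 1) k) (v + 1) y := by
  have hL : D.L d ≤ (D.insert k t A B z w).L d := Data.le_insert_L
  rcases hD with hvb | ⟨hu, hi, hik, huv, hc, hj⟩ | ⟨hvu, hb, huL, huz⟩
  · have hvL : v ≤ min (D.L (!d)) (D.L d - k) := hvb
    exact hp.knows_insert_start hk h hy ((by omega : v + 1 ≤ D.L (!d) + 1).trans (le_max_right _ _))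
      (by omega)
  · rename_i u i
    have hlabel : u ≤ (D.newItem k t z w d).label :=
      (h.label_le (hi.trans hc)).trans (le_max_right _ _)
    rcases Nat.lt_or_ge (i + 1) k with hcase | hcase
    · exact .row hu (by omega) hcase (by omega)
        (Nat.succ_le_of_lt (hc.trans_lt (hp.count_lt_count_insert h hy hlabel))) (by omega)
    · have hle := hp.le_z d u hu (by omega)
      exact hp.knows_insert_newValue hneg h hy ((by omega : v + 1 ≤ z d + k - 1).trans
        (add_sub_one_le_bestValue (hu.trans hle)))
  · have hle := hp.le_w h huL huz
    exact hp.knows_insert_newValue hneg h hy ((by omega : v + 1 ≤ w d + 1).trans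
      (succ_le_bestValue (hb.trans_le hle)))

theorem Probe.knows_insert (hk : 2 ≤ k) (hneg : ∀ d x, T (!d) x = -T d x)
    (h : Inv n k T m t D) (hp : Probe k T t D A B z w) {x j v : ℕ} {y : ℝ} (hx : x < t + 1)
    (hR : Reach n k T d j x v) (hy : T d x < y) : (D.insert k t A B z w).Knows k T d j v y := by
  rcases Nat.lt_succ_iff_lt_or_eq.1 hx with hxt | rfl
  · exact hp.knows_insert_old h (h.knows d x j v y hxt hR hy)
  cases hR with
  | start => exact hp.knows_insert_start hk h hy (le_max_of_le_right (by omega)) (Or.inl le_rfl)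
  | turnAt hR =>
    exact hp.knows_insert_start hk h hy (hp.le_label_of_reach hk h hx hR) (Or.inl le_rfl)
  | turnAfter hyx _ hR =>
    exact hp.knows_insert_start hk h hy (le_max_of_le_right
      (Nat.succ_le_succ (h.complete _ _ _ hyx hR))) (Or.inl le_rfl)
  | step hyx _ hT hR => exact hp.knows_insert_step hk hneg h hy hR.pos (h.knows d _ _ _ _ hyx hR hT)

theorem Probe.insert (hk : 2 ≤ k) (ht : t < n) (hneg : ∀ d x, T (!d) x = -T d x)
    (h : Inv n k T m t D) (hp : Probe k T t D A B z w) :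
    Inv n k T (m + 1) (t + 1) (D.insert k t A B z w) where
  complete _ _ _ hx hR := hp.complete hk h hx hR
  full _ _ hv hvL := hp.insert_full hk ht hneg h hv hvL
  mono _ _ _ hb hvv hvL := hp.insert_mono hneg h hb hvv hvL
  sorted _ := hp.insert_ascending h
  item _ _ ha := hp.insert_item h ha
  finger _ _ ha := hp.insert_finger hneg h ha
  length _ := hp.insert_length h
  row _ _ _ _ hu hj hc := hp.insert_row hk ht hneg h hu hj hc
  knows _ _ _ _ _ hx hR hy := hp.knows_insert hk hneg h hx hR hy

end Probe

/-! ### The potential -/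

/-- The part of the potential that is due to the items of a row, when the full sequences of the
opposite direction have value `a` and those of the same direction have value `b`. -/
def weight (a b : ℕ) (R : List Item) : ℕ :=
  (R.map fun x => (a - max x.finger b) + (a + 1 - x.label)).sum

/-- The potential of a row with `m` free places. -/
def potential (a b m : ℕ) (R : List Item) : ℕ := weight a b R + m * (a - b)

section weight

variable {a b a' b' m : ℕ} {R Q : List Item}

@[simp] theorem weight_nil : weight a b [] = 0 := rfl

theorem weight_cons (x : Item) (R : List Item) :
    weight a b (x :: R) = (a - max x.finger b) + (a + 1 - x.label) + weight a b R := by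
  simp [weight]

theorem weight_append (R Q : List Item) : weight a b (R ++ Q) = weight a b R + weight a b Q := by
  simp [weight]

theorem weight_le_of_sublist (h : R.Sublist Q) : weight a b R ≤ weight a b Q :=
  (h.map _).sum_le_sum fun _ _ => Nat.zero_le _

theorem weight_le_of_le (ha : a ≤ a') (hb : b ≤ b') (R : List Item) :
    weight a' b' R ≤ weight a b R + 2 * R.length * (a' - a) := by
  induction R with
  | nil => simp
  | cons x R ih =>
    rw [weight_cons, weight_cons, List.length_cons,
      show 2 * (R.length + 1) * (a' - a) = 2 * R.length * (a' - a) + 2 * (a' - a) by ring]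
    omega

theorem potential_le_of_le (ha : a ≤ a') (hb : b ≤ b') (R : List Item) :
    potential a' b' m R ≤ potential a b m R + 2 * (R.length + m) * (a' - a) := by
  have hweight := weight_le_of_le ha hb R
  have hfree : m * (a' - b') ≤ m * (a - b) + m * (a' - a) := by
    rw [← mul_add]
    exact Nat.mul_le_mul_left m (by omega)
  have hsplit : 2 * (R.length + m) * (a' - a) = 2 * R.length * (a' - a) + 2 * (m * (a' - a)) := by
    ring
  unfold potential
  omega

theorem weight_cascade_le (r : ℕ) (R : List Item) :
    weight a b (cascade r R) ≤ weight a b R + (a + 1 - r) := by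
  induction R generalizing r with
  | nil => simp [cascade]
  | cons x R ih =>
    rw [cascade, weight_cons, weight_cons]
    have := ih (max r x.label)
    dsimp only
    omega

/-- The label of `x` is already beyond `a`, so only its finger contributes to the weight, and the
finger has advanced past that of the replaced item. -/
theorem potential_insertion_le {m' : ℕ} {A B : List Item} {x : Item}
    (hm : m' + (1 + (B.length - 1)) = m + B.length) (hfinger : x.finger ≤ a) (hlabel : a ≤ x.label)
    (hB : ∀ y, B.head? = some y → y.finger ≤ x.finger) :
    potential a b m' (A ++ x :: displace B) +
        (x.finger - max ((B.head?.map Item.finger).getD 0) b) ≤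
      potential a b m (A ++ B) + 1 := by
  unfold potential
  rw [weight_append, weight_append, weight_cons]
  cases B with
  | nil =>
    obtain rfl : m = m' + 1 := by simpa using hm.symm
    simp only [displace, weight_nil, List.head?_nil, Option.map_none,
      Option.getD_none, add_mul, one_mul]
    omega
  | cons y B =>
    have hcascade := weight_cascade_le (a := a) (b := b) y.label B
    have hyx := hB y rfl
    rw [displace, weight_cons]
    obtain rfl : m' = m := by
      rw [List.length_cons] at hm
      omega
    simp only [List.head?_cons, Option.map_some, Option.getD_some]
    omega

theorem weight_filter_add_le {c : ℕ} (hc : c ≤ b + 1) (R : List Item) :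
    weight a b (R.filter fun x => decide (c ≤ x.label)) +
      (R.length - (R.filter fun x => decide (c ≤ x.label)).length) * (a - b) ≤ weight a b R := by
  induction R with
  | nil => simp
  | cons x R ih =>
    by_cases hx : c ≤ x.label
    · rw [List.filter_cons_of_pos (by simpa using hx), weight_cons, weight_cons,
        List.length_cons, List.length_cons, Nat.add_sub_add_right]
      omega
    · rw [List.filter_cons_of_neg (by simpa using hx), weight_cons, List.length_cons,
        Nat.sub_add_comm (List.length_filter_le _ _), add_mul, one_mul]
      omega

theorem potential_filter_le {c : ℕ} (hc : c ≤ b + 1) (R : List Item) :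
    potential a b (m + R.length - (R.filter fun x => decide (c ≤ x.label)).length)
      (R.filter fun x => decide (c ≤ x.label)) ≤ potential a b m R := by
  have hweight := weight_filter_add_le (a := a) hc R
  unfold potential
  rw [Nat.add_sub_assoc (List.length_filter_le _ _), add_mul]
  omega

end weight

/-- The potential that pays for the scan in direction `!d`. -/
def Data.potential (D : Data) (k : ℕ) (d : Bool) : ℕ :=
  Rollercoaster.potential (D.L (!d)) (D.L d) (3 * k + 1 - (D.R d).length) (D.R d)

/-- The value at which the scan in direction `d` starts. -/
def Data.scanStart (D : Data) (k : ℕ) (B : Bool → List Item) (d : Bool) : ℕ :=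
  max (D.base k d) (((B (!d)).head?.map Item.finger).getD 0)

section potential

variable {n k t : ℕ} {T : Bool → ℕ → ℝ} {D : Data} {A B : Bool → List Item} {z w : Bool → ℕ}
  {d : Bool}

theorem exists_key_bound (T : ℕ → ℝ) (R : List Item) : ∃ z, ∀ a ∈ R, T a.pos < z := by
  obtain ⟨z, hz⟩ := (R.map fun a => T a.pos).finite_toSet.bddAbove
  exact ⟨z + 1, fun a ha => (hz (List.mem_map_of_mem ha)).trans_lt (lt_add_one z)⟩

theorem Inv.lt_of_length_relevant {m : ℕ} (hk : 1 ≤ k) (h : Inv n k T m t D)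
    (hlen : 3 * k ≤ (D.relevant k d).length) : D.L (!d) + k < D.L d := by
  obtain ⟨z, hz⟩ := exists_key_bound (T d) (D.relevant k d)
  have hcount := count_eq_length fun a ha => ⟨hz a ha, h.max_one_threshold_le_label ha⟩
  exact (h.overflow hk (le_max_left _ _) (le_max_right _ _)
    ((hcount ▸ hlen).trans (count_mono_sublist Data.relevant_sublist))).1

theorem Data.threshold_le : D.threshold k d ≤ D.L d + 1 := by
  unfold Data.threshold Data.base
  omega

theorem Inv.potential_trim_le (hk : 1 ≤ k) (h : Inv n k T (3 * k + 1) t D) (d : Bool) :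
    (D.trim k).potential k d ≤ D.potential k d := by
  have hfilter := potential_filter_le (a := D.L (!d)) (m := 3 * k + 1 - (D.R d).length)
    (Data.threshold_le (D := D) (k := k) (d := d)) (D.R d)
  rw [Nat.sub_add_cancel (h.length d)] at hfilter
  refine le_trans ?_ hfilter
  change Rollercoaster.potential (D.L (!d)) (D.L d)
    (3 * k + 1 - ((D.relevant k d).take (3 * k)).length) ((D.relevant k d).take (3 * k)) ≤
    Rollercoaster.potential _ _ (3 * k + 1 - (D.relevant k d).length) (D.relevant k d)
  rcases le_total (D.relevant k d).length (3 * k) with hle | hge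
  · rw [List.take_of_length_le hle]
  · have hlt := h.lt_of_length_relevant hk hge
    unfold Rollercoaster.potential
    rw [Nat.sub_eq_zero_of_le (by omega : D.L (!d) ≤ D.L d), mul_zero, mul_zero]
    exact weight_le_of_sublist (List.take_sublist _ _)

theorem Probe.potential_insert_le (h : Inv n k T (3 * k) t D) (hp : Probe k T t D A B z w)
    (d : Bool) :
    (D.insert k t A B z w).potential k d + (w (!d) - D.scanStart k B (!d)) ≤
      D.potential k d + 2 * (3 * k + 1) * ((D.insert k t A B z w).L (!d) - D.L (!d)) +
        ((D.insert k t A B z w).L d - D.L d) + k + 1 := by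
  set D' := D.insert k t A B z w with hD'
  have hL : ∀ c, D.L c ≤ D'.L c := fun _ => Data.le_insert_L
  have hlen := h.length d
  have hlabel : D'.L (!d) ≤ (D.newItem k t z w d).label :=
    max_le ((Nat.le_succ _).trans (le_max_right _ _)) (le_max_left _ _)
  have hw := hp.w_le (!d)
  have hgrow := potential_le_of_le (m := 3 * k + 1 - (D.R d).length) (hL (!d)) (hL d) (D.R d)
  rw [Nat.add_sub_cancel' (hlen.trans (Nat.le_succ _))] at hgrow
  have hR : (D.R d).length = (A d).length + (B d).length := by rw [hp.split, List.length_append]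
  have hR' : (D'.R d).length = (A d).length + (1 + ((B d).length - 1)) := by
    simp only [hD', Data.insert, List.length_append, List.length_cons, length_displace]
    omega
  have hinsert := potential_insertion_le (b := D'.L d) (m := 3 * k + 1 - (D.R d).length)
    (m' := 3 * k + 1 - (D'.R d).length) (A := A d) (B := B d) (x := D.newItem k t z w d)
    (by omega) (hw.trans (hL _)) hlabel
    fun y hy => hp.finger_le (!d) y (by rwa [Bool.not_not])
  rw [← hp.split, ← show D'.R d = A d ++ D.newItem k t z w d :: displace (B d) from rfl] at hinsert
  have hLd := hL d
  unfold Data.potential Data.scanStart Data.base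
  rw [Bool.not_not]
  simp only [Data.newItem] at hinsert
  generalize ((B d).head?.map Item.finger).getD 0 = f at *
  generalize 2 * (3 * k + 1) * (D'.L (!d) - D.L (!d)) = g at *
  omega

end potential

/-! ### Total correctness with time, and the search for a place and a label -/

/-- The total correctness judgement of a Hoare logic with time: the program `P`, started in the
state `σ`, halts without a fault in a state and after a time that satisfy `Q`. -/
def Runs {n : ℕ} (S : Fin n → ℝ) (W : ℕ) (P : Cmd) (σ : State) (Q : State → ℕ → Prop) : Prop :=
  ∃ τ t, Exec S W P σ τ t ∧ Q τ t

attribute [grind =] Expr.eval Expr.Fits Expr.cost Test.Holds Test.Safe Test.cost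

section State

variable {σ : State}

@[simp, grind =] theorem State.setVar_var (x v y : ℕ) :
    (σ.setVar x v).var y = if y = x then v else σ.var y :=
  Function.update_apply ..

@[simp, grind =] theorem State.setVar_arr (x v : ℕ) : (σ.setVar x v).arr = σ.arr := rfl

@[simp, grind =] theorem State.setArr_var (a i v : ℕ) : (σ.setArr a i v).var = σ.var := rfl

@[grind =] theorem State.setArr_var_apply (a i v x : ℕ) : (σ.setArr a i v).var x = σ.var x := rfl

@[simp, grind =] theorem State.setArr_arr (a i v b j : ℕ) :
    (σ.setArr a i v).arr b j = if b = a ∧ j = i then v else σ.arr b j := by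
  by_cases hb : b = a <;> simp [State.setArr, Function.update_apply, hb]

@[simp, grind =] theorem State.setVar_setVar (x v w : ℕ) :
    (σ.setVar x v).setVar x w = σ.setVar x w := by
  simp [State.setVar]

@[simp] theorem State.setVar_self (x : ℕ) : σ.setVar x (σ.var x) = σ := by
  simp [State.setVar]

end State

section Runs

variable {n : ℕ} {S : Fin n → ℝ} {W : ℕ} {σ : State} {Q : State → ℕ → Prop}

theorem Runs.mono {P : Cmd} {Q' : State → ℕ → Prop} (h : Runs S W P σ Q)
    (hQ : ∀ τ t, Q τ t → Q' τ t) : Runs S W P σ Q' := by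
  obtain ⟨τ, t, hexec, hτ⟩ := h
  exact ⟨τ, t, hexec, hQ τ t hτ⟩

theorem runs_skip : Runs S W .skip σ Q ↔ Q σ 1 := by
  constructor
  · rintro ⟨_, _, hexec, hQ⟩
    cases hexec
    exact hQ
  · exact fun h => ⟨σ, 1, .skip σ, h⟩

theorem runs_assign {x : ℕ} {e : Expr} :
    Runs S W (.assign x e) σ Q ↔ e.Fits W σ ∧ Q (σ.setVar x (e.eval σ)) (e.cost + 1) := by
  constructor
  · rintro ⟨_, _, hexec, hQ⟩
    cases hexec with
    | assign _ _ _ he => exact ⟨he, hQ⟩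
  · exact fun h => ⟨_, _, .assign x e σ h.1, h.2⟩

theorem runs_put {a : ℕ} {i e : Expr} :
    Runs S W (.put a i e) σ Q ↔ i.Fits W σ ∧ e.Fits W σ ∧
      Q (σ.setArr a (i.eval σ) (e.eval σ)) (i.cost + e.cost + 1) := by
  constructor
  · rintro ⟨_, _, hexec, hQ⟩
    cases hexec with
    | put _ _ _ _ hi he => exact ⟨hi, he, hQ⟩
  · exact fun h => ⟨_, _, .put a i e σ h.1 h.2.1, h.2.2⟩

theorem runs_seq {P P' : Cmd} :
    Runs S W (.seq P P') σ Q ↔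
      Runs S W P σ fun τ s => Runs S W P' τ fun υ t => Q υ (s + t) := by
  constructor
  · rintro ⟨_, _, hexec, hQ⟩
    cases hexec with
    | seq hP hP' => exact ⟨_, _, hP, _, _, hP', hQ⟩
  · rintro ⟨τ, s, hP, υ, t, hP', hQ⟩
    exact ⟨_, _, .seq hP hP', hQ⟩

theorem runs_ite {b : Test} {P P' : Cmd} :
    Runs S W (.ite b P P') σ Q ↔ b.Safe S W σ ∧
      (b.Holds S σ → Runs S W P σ fun τ t => Q τ (b.cost + t)) ∧
      (¬ b.Holds S σ → Runs S W P' σ fun τ t => Q τ (b.cost + t)) := by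
  constructor
  · rintro ⟨_, _, hexec, hQ⟩
    cases hexec with
    | ite_true hs hb h => exact ⟨hs, fun _ => ⟨_, _, h, hQ⟩, fun h' => absurd hb h'⟩
    | ite_false hs hb h => exact ⟨hs, fun h' => absurd h' hb, fun _ => ⟨_, _, h, hQ⟩⟩
  · rintro ⟨hs, htrue, hfalse⟩
    by_cases hb : b.Holds S σ
    · obtain ⟨τ, t, hexec, hQ⟩ := htrue hb
      exact ⟨_, _, .ite_true hs hb hexec, hQ⟩
    · obtain ⟨τ, t, hexec, hQ⟩ := hfalse hb
      exact ⟨_, _, .ite_false hs hb hexec, hQ⟩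

/-- The rule for while-loops: `I` is the invariant, which refers to the time spent so far, and `μ`
the termination measure. -/
theorem Runs.loop {b : Test} {P : Cmd} (I : State → ℕ → Prop) (μ : State → ℕ) (hinit : I σ 0)
    (hstep : ∀ τ s, I τ s → b.Safe S W τ ∧
      (b.Holds S τ → Runs S W P τ fun υ t => I υ (s + b.cost + t) ∧ μ υ < μ τ) ∧
      (¬ b.Holds S τ → Q τ (s + b.cost))) : Runs S W (.loop b P) σ Q := by
  suffices h : ∀ m τ s, μ τ = m → I τ s → Runs S W (.loop b P) τ fun υ t => Q υ (s + t) by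
    simpa using h _ σ 0 rfl hinit
  intro m
  induction m using Nat.strong_induction_on with
  | _ m ih =>
    rintro τ s rfl hI
    obtain ⟨hs, htrue, hfalse⟩ := hstep τ s hI
    by_cases hb : b.Holds S τ
    · obtain ⟨υ, t, hP, hI', hlt⟩ := htrue hb
      obtain ⟨ω, u, hL, hQ⟩ := ih _ hlt υ _ rfl hI'
      exact ⟨_, _, .loop_true hs hb hP hL, by rwa [add_assoc, add_assoc, ← add_assoc s] at *⟩
    · exact ⟨_, _, .loop_false hs hb, hfalse hb⟩

/-- The rule for loops that count `x` up to the value `N` of `y`, with a body of constant cost. -/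
theorem Runs.count {x y c N : ℕ} {P : Cmd} (I : State → Prop) (hN : σ.var y = N) (hW : N < W)
    (hle : σ.var x ≤ N) (hinit : I σ)
    (hstep : ∀ τ, I τ → τ.var x < N → τ.var y = N → Runs S W P τ fun υ t =>
      t ≤ c ∧ υ.var x = τ.var x + 1 ∧ υ.var y = N ∧ I υ) :
    Runs S W (.loop (.lt (.var x) (.var y)) P) σ fun τ t =>
      t ≤ (c + 3) * (N - σ.var x) + 3 ∧ τ.var x = N ∧ I τ := by
  refine Runs.loop (fun τ s => s ≤ (c + 3) * (τ.var x - σ.var x) ∧ σ.var x ≤ τ.var x ∧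
    τ.var x ≤ N ∧ τ.var y = N ∧ I τ) (fun τ => N - τ.var x)
    ⟨Nat.zero_le _, le_rfl, hle, hN, hinit⟩ ?_
  rintro τ s ⟨hs, hge, hle, hy, hI⟩
  refine ⟨by grind, fun hlt => ?_, fun hlt => ?_⟩
  · replace hlt : τ.var x < N := hy ▸ hlt
    refine (hstep τ hI hlt hy).mono ?_
    rintro υ t ⟨ht, hx, hy', hI'⟩
    rw [hx, Nat.sub_add_comm hge, mul_add]
    exact ⟨⟨by grind, by omega, hlt, hy', hI'⟩, by omega⟩
  · replace hlt : ¬ τ.var x < N := hy ▸ hlt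
    obtain hx : τ.var x = N := by omega
    exact ⟨by grind, hx, hI⟩

/-- Comparison of two keys in direction `d`. -/
def keyLt (d : Bool) (e f : Expr) : Test := if d then .key e f else .key f e

@[grind =] theorem keyLt_cost (d : Bool) (e f : Expr) :
    (keyLt d e f).cost = e.cost + f.cost + 1 := by
  cases d
  · exact congrArg (· + 1) (add_comm _ _)
  · rfl

@[grind =] theorem keyLt_safe (d : Bool) (e f : Expr) :
    (keyLt d e f).Safe S W σ ↔ (e.Fits W σ ∧ e.eval σ < n) ∧ (f.Fits W σ ∧ f.eval σ < n) := by
  cases d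
  · exact and_comm
  · exact Iff.rfl

theorem keyLt_holds (d : Bool) {e f : Expr} (he : e.eval σ < n) (hf : f.eval σ < n) :
    (keyLt d e f).Holds S σ ↔ key S d (e.eval σ) < key S d (f.eval σ) := by
  cases d <;> simp [keyLt, Test.Holds, key, he, hf]

end Runs

/-- The number of a variable or an array; there is one of each kind for every direction. -/
def slot (i : ℕ) (d : Bool) : ℕ := 2 * i + d.toNat

@[simp, grind =] theorem slot_inj {i j : ℕ} {d c : Bool} :
    slot i d = slot j c ↔ i = j ∧ d = c := by
  cases d <;> cases c <;> simp [slot] <;> omega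

/-- Find the place of the key of position `x` in the sorted array `a` with `m` cells. -/
def findPlace (d : Bool) (a m p x : ℕ) : Cmd :=
  .seq (.assign p (.const 0))
    (.loop (.and (.lt (.var p) (.var m)) (keyLt d (.get a (.var p)) (.var x)))
      (.assign p (.add (.var p) (.const 1))))

theorem runs_findPlace {n : ℕ} {S : Fin n → ℝ} {W : ℕ} {σ : State} {d : Bool} {a m p x : ℕ}
    (hpm : p ≠ m) (hpx : p ≠ x) (hm : σ.var m + 2 ≤ W) (hn : n ≤ W)
    (ha : ∀ i < σ.var m, σ.arr a i < n) (hx : σ.var x < n) :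
    Runs S W (findPlace d a m p x) σ fun τ t => t ≤ 12 * σ.var m + 20 ∧
      ∃ i, τ = σ.setVar p i ∧ i ≤ σ.var m ∧
        (∀ j < i, key S d (σ.arr a j) < key S d (σ.var x)) ∧
        (i < σ.var m → ¬ key S d (σ.arr a i) < key S d (σ.var x)) := by
  unfold findPlace
  simp only [runs_seq, runs_assign]
  refine ⟨by grind, ?_⟩
  refine Runs.loop (fun τ s => ∃ i, τ = σ.setVar p i ∧ i ≤ σ.var m ∧ s ≤ 12 * i ∧
    ∀ j < i, key S d (σ.arr a j) < key S d (σ.var x)) (fun τ => σ.var m - τ.var p) ?_ ?_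
  · exact ⟨0, by grind⟩
  · rintro τ s ⟨i, rfl, hi, hs, hlow⟩
    refine ⟨by grind, ?_, ?_⟩
    · rintro hb
      rw [runs_assign]
      refine ⟨by grind, ⟨i + 1, by grind, by grind, by grind, ?_⟩, by grind⟩
      grind [keyLt_holds]
    · intro hb
      refine ⟨by grind, i, rfl, hi, hlow, ?_⟩
      grind [keyLt_holds]


/-- The variable that holds `n`. -/
abbrev xN : ℕ := slot 0 false

/-- The variable that holds `k`. -/
abbrev xK : ℕ := slot 0 true

/-- The current position. -/
abbrev xT : ℕ := slot 1 false

/-- The largest value of a full sequence. -/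
abbrev xL (d : Bool) : ℕ := slot 2 d

/-- The length of the row. -/
abbrev xM (d : Bool) : ℕ := slot 3 d

/-- The place of the current position in the row. -/
abbrev xP (d : Bool) : ℕ := slot 4 d

/-- The best label of a sequence of `k - 1` elements below the current position. -/
abbrev xZ (d : Bool) : ℕ := slot 5 d

/-- The result of the scan. -/
abbrev xW (d : Bool) : ℕ := slot 6 d

/-- The new value of the current position, and then the new value of `xL d`. -/
abbrev xU (d : Bool) : ℕ := slot 7 d

/-- Best endpoints for each value. -/
abbrev aF (d : Bool) : ℕ := slot 0 d

/-- Positions of the items of the row. -/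
abbrev aP (d : Bool) : ℕ := slot 1 d

/-- Labels of the items of the row. -/
abbrev aL (d : Bool) : ℕ := slot 2 d

/-- Fingers of the items of the row. -/
abbrev aG (d : Bool) : ℕ := slot 3 d

/-- Auxiliary variables. -/
abbrev aux (i : ℕ) : ℕ := slot (10 + i) false

/-- `τ` arises from `σ` by changing only variables in `X`, auxiliary variables, and arrays
in `Y`. -/
def Frame (X Y : List ℕ) (σ τ : State) : Prop :=
  (∀ i d, i < 10 → slot i d ∉ X → τ.var (slot i d) = σ.var (slot i d)) ∧
    ∀ i d j, slot i d ∉ Y → τ.arr (slot i d) j = σ.arr (slot i d) j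

section Frame

variable {X Y : List ℕ} {σ τ υ : State}

theorem Frame.refl (X Y : List ℕ) (σ : State) : Frame X Y σ σ := by simp [Frame]

theorem Frame.trans (h : Frame X Y σ τ) (h' : Frame X Y τ υ) : Frame X Y σ υ := by
  grind [Frame]

theorem Frame.mono {X' Y' : List ℕ} (h : Frame X Y σ τ) (hX : X ⊆ X') (hY : Y ⊆ Y') :
    Frame X' Y' σ τ :=
  ⟨fun i d hi hd => h.1 i d hi fun hmem => hd (hX hmem),
    fun i d j hd => h.2 i d j fun hmem => hd (hY hmem)⟩

theorem Frame.setVar (h : Frame X Y σ τ) {i : ℕ} {d : Bool} (v : ℕ) (hX : 10 ≤ i ∨ slot i d ∈ X) :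
    Frame X Y σ (τ.setVar (slot i d) v) := by
  grind [Frame]

theorem Frame.setArr (h : Frame X Y σ τ) {a : ℕ} (i v : ℕ) (hY : a ∈ Y) :
    Frame X Y σ (τ.setArr a i v) := by
  grind [Frame]

end Frame

/-- Count the labels in the first `xP d` cells that are at least the label in the cell `aux 0`. -/
def countLabels (d : Bool) : Cmd :=
  .seq (.assign (aux 1) (.const 0)) <|
  .seq (.assign (aux 2) (.const 0)) <|
  .loop (.lt (.var (aux 1)) (.var (xP d))) <|
    .seq (.ite (.lt (.get (aL d) (.var (aux 1))) (.get (aL d) (.var (aux 0)))) .skip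
      (.assign (aux 2) (.add (.var (aux 2)) (.const 1))))
      (.assign (aux 1) (.add (.var (aux 1)) (.const 1)))

/-- Determine the best label `z` of a sequence of `k - 1` elements below the current position. -/
def selectLabel (d : Bool) : Cmd :=
  .seq (.assign (xZ d) (.const 0)) <|
  .seq (.assign (aux 0) (.const 0)) <|
  .loop (.lt (.var (aux 0)) (.var (xP d))) <|
    .seq (countLabels d) <|
    .seq
      (.ite (.and (.not (.lt (.add (.var (aux 2)) (.const 1)) (.var xK)))
          (.lt (.var (xZ d)) (.get (aL d) (.var (aux 0)))))
        (.assign (xZ d) (.get (aL d) (.var (aux 0)))) .skip) <|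
    .assign (aux 0) (.add (.var (aux 0)) (.const 1))

/-- The number of the first `p` entries of `f` that are at least `l`. -/
def countGe (f : ℕ → ℕ) (p l : ℕ) : ℕ := (List.range p).countP fun j => decide (l ≤ f j)

@[grind =] theorem countGe_zero (f : ℕ → ℕ) (l : ℕ) : countGe f 0 l = 0 := rfl

theorem countGe_succ (f : ℕ → ℕ) (p l : ℕ) :
    countGe f (p + 1) l = countGe f p l + if l ≤ f p then 1 else 0 := by
  simp [countGe, List.range_succ, List.countP_append, List.countP_cons]

theorem countGe_le (f : ℕ → ℕ) (p l : ℕ) : countGe f p l ≤ p := by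
  simpa [countGe] using List.countP_le_length (p := fun j => decide (l ≤ f j)) (l := List.range p)

section

variable {n : ℕ} {S : Fin n → ℝ} {W : ℕ} {σ : State} {d : Bool}

theorem runs_countLabels (hp : σ.var (xP d) + 2 ≤ W)
    (ha : ∀ i < σ.var (xP d), σ.arr (aL d) i < W) (hi : σ.var (aux 0) < σ.var (xP d)) :
    Runs S W (countLabels d) σ fun τ t =>
      t ≤ 16 * σ.var (xP d) + 7 ∧ τ.arr = σ.arr ∧
        (∀ x, x ≠ aux 1 → x ≠ aux 2 → τ.var x = σ.var x) ∧
        τ.var (aux 2) = countGe (σ.arr (aL d)) (σ.var (xP d)) (σ.arr (aL d) (σ.var (aux 0))) := by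
  unfold countLabels
  simp only [runs_seq, runs_assign]
  refine ⟨by grind, by grind, ?_⟩
  refine (Runs.count (c := 13) (N := σ.var (xP d)) (fun τ => τ.arr = σ.arr ∧
    (∀ x, x ≠ aux 1 → x ≠ aux 2 → τ.var x = σ.var x) ∧
    τ.var (aux 2) = countGe (σ.arr (aL d)) (τ.var (aux 1)) (σ.arr (aL d) (σ.var (aux 0))))
    (by grind) (by grind) (by grind) (by grind) ?_).mono (by grind)
  rintro τ ⟨harr, hvar, hcount⟩ hlt hp
  have hle := countGe_le (σ.arr (aL d)) (τ.var (aux 1)) (σ.arr (aL d) (σ.var (aux 0)))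
  have hsucc := countGe_succ (σ.arr (aL d)) (τ.var (aux 1)) (σ.arr (aL d) (σ.var (aux 0)))
  simp only [runs_seq, runs_ite, runs_skip, runs_assign]
  exact ⟨by grind, by grind, by grind⟩

theorem runs_selectLabel (hp : σ.var (xP d) + 2 ≤ W)
    (ha : ∀ i < σ.var (xP d), σ.arr (aL d) i < W) (hk : σ.var xK < W) :
    Runs S W (selectLabel d) σ fun τ t => t ≤ 60 * (σ.var (xP d) + 1) ^ 2 ∧
      Frame [xZ d] [] σ τ ∧
        (∀ i < σ.var (xP d), σ.var xK ≤
          countGe (σ.arr (aL d)) (σ.var (xP d)) (σ.arr (aL d) i) + 1 →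
            σ.arr (aL d) i ≤ τ.var (xZ d)) ∧
        (τ.var (xZ d) = 0 ∨ ∃ i < σ.var (xP d), τ.var (xZ d) = σ.arr (aL d) i ∧ σ.var xK ≤
          countGe (σ.arr (aL d)) (σ.var (xP d)) (σ.arr (aL d) i) + 1) := by
  set p := σ.var (xP d)
  set f := σ.arr (aL d)
  unfold selectLabel
  simp only [runs_seq, runs_assign]
  refine ⟨by grind, by grind, ?_⟩
  refine (Runs.count (c := 16 * p + 57) (N := p) (fun τ =>
    τ.arr = σ.arr ∧ (∀ x, x ≠ xZ d → x ≠ aux 0 → x ≠ aux 1 → x ≠ aux 2 → τ.var x = σ.var x) ∧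
    (∀ i < τ.var (aux 0), σ.var xK ≤ countGe f p (f i) + 1 → f i ≤ τ.var (xZ d)) ∧
    (τ.var (xZ d) = 0 ∨ ∃ i < p, τ.var (xZ d) = f i ∧ σ.var xK ≤ countGe f p (f i) + 1))
    (by grind) (by grind) (by grind) (by grind) ?_).mono ?_
  · rintro τ ⟨harr, hvar, hmax, hz⟩ hlt hp
    simp only [runs_seq]
    refine Runs.mono (runs_countLabels (by grind) (by grind) (by grind)) ?_
    rintro υ t ⟨ht, hυarr, hυvar, hcount⟩
    have hle := countGe_le f p (f (τ.var (aux 0)))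
    simp only [runs_ite, runs_skip, runs_assign]
    refine ⟨by grind, fun hmore => ?_, by grind (splits := 20)⟩
    refine ⟨by grind, by grind, by grind, by grind, by grind, by grind, by grind, by grind, ?_⟩
    exact Or.inr ⟨τ.var (aux 0), by grind⟩
  · rintro τ t ⟨ht, hp, harr, hvar, hmax, hz⟩
    refine ⟨?_, by grind [Frame], by grind, hz⟩
    have hbound : t ≤ (16 * p + 60) * p + 3 := by simpa [Expr.eval] using ht
    simp only [Expr.cost]
    nlinarith

end

/-! ### The scan -/

/-- Store in `aux 0` the irrelevance bound that belongs to the values in the variables `x` (same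
direction) and `y` (opposite direction). -/
def baseValue (x y : ℕ) : Cmd :=
  .seq (.assign (aux 0) (.sub (.var x) (.var xK)))
    (.ite (.lt (.var y) (.var (aux 0))) (.assign (aux 0) (.var y)) .skip)

/-- Move the scan pointer from the irrelevance bound to the finger. -/
def scanInit (d : Bool) : Cmd :=
  .seq (.assign (xW d) (.var (aux 0)))
    (.ite (.and (.lt (.var (xP (!d))) (.var (xM (!d))))
        (.lt (.var (xW d)) (.get (aG (!d)) (.var (xP (!d))))))
      (.assign (xW d) (.get (aG (!d)) (.var (xP (!d))))) .skip)

/-- Move the scan pointer upwards. -/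
def scanLoop (d : Bool) : Cmd :=
  .loop (.and (.lt (.var (xW d)) (.var (xL d)))
      (keyLt d (.get (aF d) (.add (.var (xW d)) (.const 1))) (.var xT)))
    (.assign (xW d) (.add (.var (xW d)) (.const 1)))

/-- Compute the new value from the result of the scan. -/
def scanValue (d : Bool) : Cmd :=
  .seq (.assign (xU d) (.const 0)) <|
  .seq (.ite (.lt (.var (aux 0)) (.var (xW d)))
      (.assign (xU d) (.add (.var (xW d)) (.const 1))) .skip)
    (.ite (.and (.lt (.const 0) (.var (xZ d)))
        (.lt (.var (xU d)) (.sub (.add (.var (xZ d)) (.var xK)) (.const 1))))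
      (.assign (xU d) (.sub (.add (.var (xZ d)) (.var xK)) (.const 1))) .skip)

/-- Enter the current position as the best endpoint of the values from `xW d + 1` to `xU d`, and
update the largest value. -/
def fillValues (d : Bool) : Cmd :=
  .seq (.assign (aux 0) (.var (xW d))) <|
  .seq (.loop (.lt (.var (aux 0)) (.var (xU d)))
      (.seq (.assign (aux 0) (.add (.var (aux 0)) (.const 1)))
        (.put (aF d) (.var (aux 0)) (.var xT))))
    (.ite (.lt (.var (xU d)) (.var (xL d))) (.assign (xU d) (.var (xL d))) .skip)

section

variable {n : ℕ} {S : Fin n → ℝ} {W : ℕ} {σ : State} {d : Bool}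

theorem runs_baseValue {x y : ℕ} (hy : y ≠ aux 0) (hxW : σ.var x < W)
    (hyW : σ.var y < W) (hk : σ.var xK < W) :
    Runs S W (baseValue x y) σ fun τ t => t ≤ 12 ∧
      τ = σ.setVar (aux 0) (min (σ.var y) (σ.var x - σ.var xK)) := by
  unfold baseValue
  simp only [runs_seq, runs_assign, runs_ite, runs_skip]
  exact ⟨by grind, by grind, by grind, by grind⟩

theorem runs_scanInit (hb : σ.var (aux 0) < W)
    (hm : σ.var (xM (!d)) < W) (hp : σ.var (xP (!d)) < W)
    (hG : ∀ i < σ.var (xM (!d)), σ.arr (aG (!d)) i < W) :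
    Runs S W (scanInit d) σ fun τ t => t ≤ 20 ∧ τ = σ.setVar (xW d) (max (σ.var (aux 0))
      (if σ.var (xP (!d)) < σ.var (xM (!d)) then σ.arr (aG (!d)) (σ.var (xP (!d))) else 0)) := by
  unfold scanInit
  simp only [runs_seq, runs_assign, runs_ite, runs_skip]
  exact ⟨by grind, by grind, by grind, by grind⟩

theorem runs_scanLoop (hL : σ.var (xL d) + 2 ≤ W) (hw : σ.var (xW d) ≤ σ.var (xL d))
    (hF : ∀ v, 1 ≤ v → v ≤ σ.var (xL d) → σ.arr (aF d) v < n) (hn : n ≤ W)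
    (hT : σ.var xT < n) :
    Runs S W (scanLoop d) σ fun τ t => ∃ w, τ = σ.setVar (xW d) w ∧
      t ≤ 14 * (w - σ.var (xW d)) + 10 ∧ σ.var (xW d) ≤ w ∧ w ≤ σ.var (xL d) ∧
      (w = σ.var (xW d) ∨ key S d (σ.arr (aF d) w) < key S d (σ.var xT)) ∧
      (w < σ.var (xL d) → ¬ key S d (σ.arr (aF d) (w + 1)) < key S d (σ.var xT)) := by
  refine Runs.loop (fun τ s => ∃ w, τ = σ.setVar (xW d) w ∧
      s ≤ 14 * (w - σ.var (xW d)) ∧ σ.var (xW d) ≤ w ∧ w ≤ σ.var (xL d) ∧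
      (w = σ.var (xW d) ∨ key S d (σ.arr (aF d) w) < key S d (σ.var xT)))
    (fun τ => σ.var (xL d) - τ.var (xW d)) ?_ ?_
  · exact ⟨σ.var (xW d), by simp, by simp, le_rfl, hw, Or.inl rfl⟩
  · rintro τ s ⟨w, rfl, hs, hge, hle, hkey⟩
    refine ⟨by grind, fun hb => ?_, fun hb => ⟨w, rfl, by grind, hge, hle, hkey, ?_⟩⟩
    · rw [runs_assign]
      refine ⟨by grind, ⟨w + 1, by grind, by grind, by grind, by grind, ?_⟩, by grind⟩
      grind [keyLt_holds]
    · grind [keyLt_holds]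

theorem runs_scanValue (hb : σ.var (aux 0) < W) (hw : σ.var (xW d) + 2 ≤ W)
    (hz : σ.var (xZ d) + σ.var xK < W) :
    Runs S W (scanValue d) σ fun τ t => t ≤ 40 ∧ τ = σ.setVar (xU d)
      (bestValue (σ.var xK) (σ.var (aux 0)) (σ.var (xW d)) (σ.var (xZ d))) := by
  unfold scanValue bestValue
  simp only [runs_seq, runs_assign, runs_ite, runs_skip]
  exact ⟨by grind, by grind, by grind (splits := 25), by grind (splits := 25)⟩

theorem runs_fillValues (hU : σ.var (xU d) + 2 ≤ W) (hw : σ.var (xW d) < W)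
    (hL : σ.var (xL d) < W) (hT : σ.var xT < W) :
    Runs S W (fillValues d) σ fun τ t =>
      t ≤ 10 * (σ.var (xU d) - σ.var (xW d)) + 20 ∧ Frame [xU d] [aF d] σ τ ∧
      τ.var (xU d) = max (σ.var (xL d)) (σ.var (xU d)) ∧
      ∀ v, τ.arr (aF d) v =
        if σ.var (xW d) < v ∧ v ≤ σ.var (xU d) then σ.var xT else σ.arr (aF d) v := by
  unfold fillValues
  simp only [runs_seq, runs_assign]
  refine ⟨by grind, ?_⟩
  refine Runs.loop (fun τ s => s + 10 * σ.var (xW d) ≤ 10 * τ.var (aux 0) ∧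
    σ.var (xW d) ≤ τ.var (aux 0) ∧ τ.var (aux 0) ≤ max (σ.var (xW d)) (σ.var (xU d)) ∧
    Frame [] [aF d] σ τ ∧
    (∀ v, σ.var (xW d) < v → v ≤ τ.var (aux 0) → τ.arr (aF d) v = σ.var xT) ∧
    ∀ v, v ≤ σ.var (xW d) ∨ τ.var (aux 0) < v → τ.arr (aF d) v = σ.arr (aF d) v)
    (fun τ => σ.var (xU d) - τ.var (aux 0)) ?_ ?_
  · exact ⟨by grind, by grind, by grind, by grind [Frame], by grind, by grind⟩
  · rintro τ s ⟨hs, hge, hle, hframe, hnew, hold⟩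
    have hvar : τ.var (xU d) = σ.var (xU d) ∧ τ.var (xL d) = σ.var (xL d) ∧
        τ.var xT = σ.var xT := by grind [Frame]
    simp only [runs_seq, runs_put, runs_ite, runs_assign, runs_skip, Expr.eval, State.setVar_var,
      State.setArr_var, if_true]
    refine ⟨by grind, fun hb => ?_, fun hb => ?_⟩
    · exact ⟨by grind, by grind, by grind,
        ⟨by grind, by grind, by grind, (hframe.setVar _ (by simp)).setArr _ _ (by simp),
          by grind, by grind⟩, by grind⟩
    · exact ⟨by grind, by grind [Frame], by grind [Frame]⟩

end

/-! ### Rows in memory -/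

/-- The item of a row stored in the cells `i`. -/
@[grind =] def State.item (σ : State) (d : Bool) (i : ℕ) : Item :=
  ⟨σ.arr (aP d) i, σ.arr (aL d) i, σ.arr (aG d) i⟩

/-- The values of `g` at `a, …, b - 1`. -/
def segment (g : ℕ → Item) (a b : ℕ) : List Item := (List.range' a (b - a)).map g

section segment

variable {g h : ℕ → Item} {a b c : ℕ}

theorem segment_of_le (hab : b ≤ a) : segment g a b = [] := by
  simp [segment, Nat.sub_eq_zero_of_le hab]

theorem segment_cons (hab : a < b) : segment g a b = g a :: segment g (a + 1) b := by
  rw [segment, segment, ← Nat.sub_add_cancel (Nat.sub_pos_of_lt hab), List.range'_succ,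
    List.map_cons, Nat.sub_sub]

theorem segment_append (hab : a ≤ b) (hbc : b ≤ c) :
    segment g a b ++ segment g b c = segment g a c := by
  have hrange := List.range'_append_1 (s := a) (m := b - a) (n := c - b)
  rw [Nat.add_sub_cancel' hab, add_comm, Nat.sub_add_sub_cancel hbc hab] at hrange
  rw [segment, segment, segment, ← List.map_append, hrange]

theorem segment_snoc (hab : a ≤ b) : segment g a (b + 1) = segment g a b ++ [g b] := by
  rw [← segment_append hab (Nat.le_succ b), segment_cons (Nat.lt_succ_self b),
    segment_of_le le_rfl]

theorem segment_congr (hgh : ∀ i, a ≤ i → i < b → g i = h i) : segment g a b = segment h a b := by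
  unfold segment
  refine List.map_congr_left fun i hi => ?_
  rw [List.mem_range'_1] at hi
  exact hgh i hi.1 (by omega)

@[simp] theorem length_segment : (segment g a b).length = b - a := by simp [segment]

theorem mem_segment {x : Item} : x ∈ segment g a b ↔ ∃ i, a ≤ i ∧ i < b ∧ g i = x := by
  simp only [segment, List.mem_map, List.mem_range'_1]
  grind

theorem take_segment (m : ℕ) : (segment g 0 b).take m = segment g 0 (min m b) := by
  rcases le_total m b with hm | hm
  · rw [min_eq_left hm, ← segment_append (Nat.zero_le m) hm, List.take_left']
    exact length_segment
  · rw [min_eq_right hm, List.take_of_length_le]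
    simpa using hm

end segment

/-- The row of direction `d` that is stored in memory. -/
def State.row (σ : State) (d : Bool) : List Item := segment (σ.item d) 0 (σ.var (xM d))

section

variable {σ : State} {d : Bool}

@[simp] theorem State.item_setVar (x v : ℕ) : (σ.setVar x v).item d = σ.item d := rfl

theorem State.row_setVar {x : ℕ} (hx : x ≠ xM d) (v : ℕ) : (σ.setVar x v).row d = σ.row d := by
  simp [State.row, hx.symm]

end

/-- Exchange the label in the cell `aux 0` of the row with the one in `aux 1` if the latter is not
larger, and move on to the next cell. -/
def cascadeStep (d : Bool) : Cmd :=
  .seq (.assign (aux 2) (.get (aL d) (.var (aux 0)))) <|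
  .seq (.ite (.lt (.var (aux 2)) (.var (aux 1))) .skip
    (.seq (.put (aL d) (.var (aux 0)) (.var (aux 1))) (.assign (aux 1) (.var (aux 2))))) <|
  .assign (aux 0) (.add (.var (aux 0)) (.const 1))

/-- Push the label in `aux 1` through the cells of the row from `aux 0` on. -/
def cascadeLoop (d : Bool) : Cmd :=
  .loop (.lt (.var (aux 0)) (.var (xM d))) (cascadeStep d)

/-- Copy the item in the cells `aux 0` to the cells `aux 2` and increment `aux 2` if its label is
at least `aux 1`, and move on to the next cells. -/
def filterStep (d : Bool) : Cmd :=
  .seq (.ite (.lt (.get (aL d) (.var (aux 0))) (.var (aux 1))) .skip <|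
    .seq (.put (aP d) (.var (aux 2)) (.get (aP d) (.var (aux 0)))) <|
    .seq (.put (aL d) (.var (aux 2)) (.get (aL d) (.var (aux 0)))) <|
    .seq (.put (aG d) (.var (aux 2)) (.get (aG d) (.var (aux 0)))) <|
    .assign (aux 2) (.add (.var (aux 2)) (.const 1))) <|
  .assign (aux 0) (.add (.var (aux 0)) (.const 1))

/-- Keep the items of the row whose label is at least `aux 1`; their number is left in `aux 2`. -/
def filterLoop (d : Bool) : Cmd :=
  .seq (.assign (aux 0) (.const 0)) <|
  .seq (.assign (aux 2) (.const 0)) <|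
  .loop (.lt (.var (aux 0)) (.var (xM d))) (filterStep d)

section

variable {n : ℕ} {S : Fin n → ℝ} {W : ℕ} {σ : State} {d : Bool}

theorem runs_cascadeStep (hi : σ.var (aux 0) + 2 ≤ W) (hlabel : σ.var (aux 1) < W)
    (ha : (σ.item d (σ.var (aux 0))).label < W) :
    Runs S W (cascadeStep d) σ fun τ t => t ≤ 22 ∧ τ.var (aux 0) = σ.var (aux 0) + 1 ∧
      τ.var (aux 1) = max (σ.var (aux 1)) (σ.item d (σ.var (aux 0))).label ∧
      Frame [] [aL d] σ τ ∧ (∀ j ≠ σ.var (aux 0), τ.item d j = σ.item d j) ∧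
      τ.item d (σ.var (aux 0)) = { σ.item d (σ.var (aux 0)) with
        label := min (σ.item d (σ.var (aux 0))).label (σ.var (aux 1)) } := by
  unfold cascadeStep
  simp only [runs_seq, runs_assign, runs_ite, runs_skip, runs_put, Expr.eval, Expr.Fits, Test.Holds,
    Test.Safe, State.setVar_var, State.setArr_var, if_true]
  refine ⟨by grind, by grind, fun hb => ?_, fun hb => ?_⟩
  · exact ⟨by grind, by grind, by grind, by grind, by grind [Frame], by grind, by grind⟩
  · exact ⟨by grind, by grind, by grind, by grind, by grind, by grind, by grind,
      (((((Frame.refl _ _ _).setVar _ (by simp)).setArr _ _ (by simp)).setVar _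
        (by simp)).setVar _ (by simp)), fun j hj => by simp [State.item, hj],
      by simpa [State.item] using hb⟩

theorem runs_cascadeLoop (hm : σ.var (xM d) + 2 ≤ W) (hlabel : σ.var (aux 1) < W)
    (ha : ∀ i < σ.var (xM d), σ.arr (aL d) i < W) (hi : σ.var (aux 0) ≤ σ.var (xM d)) :
    Runs S W (cascadeLoop d) σ fun τ t => t ≤ 25 * σ.var (xM d) + 3 ∧ Frame [] [aL d] σ τ ∧
      (∀ j < σ.var (aux 0), τ.item d j = σ.item d j) ∧
      segment (τ.item d) (σ.var (aux 0)) (σ.var (xM d)) =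
        cascade (σ.var (aux 1)) (segment (σ.item d) (σ.var (aux 0)) (σ.var (xM d))) := by
  set p := σ.var (aux 0) with hp
  set m := σ.var (xM d)
  refine (Runs.count (c := 22) (N := m) (fun τ => p ≤ τ.var (aux 0) ∧ τ.var (aux 1) < W ∧
    Frame [] [aL d] σ τ ∧ (∀ j < p, τ.item d j = σ.item d j) ∧
    (∀ j, τ.var (aux 0) ≤ j → τ.item d j = σ.item d j) ∧
    segment (τ.item d) p (τ.var (aux 0)) ++
      cascade (τ.var (aux 1)) (segment (τ.item d) (τ.var (aux 0)) m) =
        cascade (σ.var (aux 1)) (segment (σ.item d) p m))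
    rfl (by omega) hi ?_ ?_).mono ?_
  · exact ⟨le_rfl, hlabel, Frame.refl _ _ _, by grind, by grind, by simp [segment_of_le, hp]⟩
  · rintro τ ⟨hge, hr, hframe, hlow, hhigh, hseg⟩ hlt hm
    refine (runs_cascadeStep (d := d) (by omega) hr (by grind)).mono ?_
    rintro υ t ⟨ht, hnext, hmax, hframe', hother, hitem⟩
    refine ⟨ht, hnext, by grind [Frame], by omega, by grind, hframe.trans hframe', by grind,
      by grind, ?_⟩
    rw [segment_cons hlt, cascade] at hseg
    rw [← hseg, hnext, segment_snoc hge, List.append_assoc, hmax, hitem,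
      segment_congr (b := τ.var (aux 0)) fun i _ hi => hother i (by omega),
      segment_congr (b := m) fun i hi _ => hother i (by omega)]
    rfl
  · rintro τ t ⟨ht, hend, -, -, hframe, hlow, -, hseg⟩
    rw [hend, segment_of_le le_rfl, cascade, List.append_nil] at hseg
    exact ⟨by grind, hframe, hlow, hseg⟩

theorem runs_filterStep (hi : σ.var (aux 0) + 2 ≤ W) (hj : σ.var (aux 2) ≤ σ.var (aux 0))
    (hr : σ.var (aux 1) < W) (hx : (σ.item d (σ.var (aux 0))).pos < W ∧
      (σ.item d (σ.var (aux 0))).label < W ∧ (σ.item d (σ.var (aux 0))).finger < W) :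
    Runs S W (filterStep d) σ fun τ t => t ≤ 37 ∧ τ.var (aux 0) = σ.var (aux 0) + 1 ∧
      τ.var (aux 1) = σ.var (aux 1) ∧ τ.var (aux 2) ≤ σ.var (aux 0) + 1 ∧
      Frame [] [aP d, aL d, aG d] σ τ ∧ (∀ j > σ.var (aux 0), τ.item d j = σ.item d j) ∧
      segment (τ.item d) 0 (τ.var (aux 2)) = segment (σ.item d) 0 (σ.var (aux 2)) ++
        if σ.var (aux 1) ≤ (σ.item d (σ.var (aux 0))).label then [σ.item d (σ.var (aux 0))]
          else [] := by
  unfold filterStep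
  simp only [runs_seq, runs_assign, runs_ite, runs_skip, runs_put, Expr.eval, Expr.Fits, Test.Holds,
    Test.Safe, State.setVar_var, State.setArr_var, if_true]
  refine ⟨by grind, fun hb => ?_, fun hb => ?_⟩
  · refine ⟨by grind, by grind, by grind, by grind, by grind, (Frame.refl _ _ _).setVar _ (by simp),
      by grind, ?_⟩
    simp only [slot_inj, Nat.reduceAdd, Nat.reduceEqDiff, false_and, if_false]
    rw [if_neg (by simpa [State.item] using hb), List.append_nil]
    rfl
  · refine ⟨by grind, by grind, by grind, by grind, by grind, by grind, by grind, by grind,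
      by grind, by grind, by grind, by grind, ?_, fun j hj' => ?_, ?_⟩
    · exact (((((Frame.refl _ _ _).setArr _ _ (by simp)).setArr _ _ (by simp)).setArr _ _
        (by simp)).setVar _ (by simp)).setVar _ (by simp)
    · simp [State.item, (hj.trans_lt hj').ne']
    · simp only [slot_inj, Nat.reduceAdd, Nat.reduceEqDiff, false_and, if_false]
      rw [if_pos (by simpa [State.item] using hb), segment_snoc (Nat.zero_le _)]
      congr 1
      · refine segment_congr fun j _ hj => ?_
        simp [State.item, hj.ne]
      · simp [State.item]

theorem runs_filterLoop (hm : σ.var (xM d) + 2 ≤ W) (hr : σ.var (aux 1) < W)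
    (ha : ∀ x ∈ σ.row d, x.pos < W ∧ x.label < W ∧ x.finger < W) :
    Runs S W (filterLoop d) σ fun τ t => t ≤ 40 * σ.var (xM d) + 7 ∧
      Frame [] [aP d, aL d, aG d] σ τ ∧ τ.var (aux 2) ≤ σ.var (xM d) ∧
      segment (τ.item d) 0 (τ.var (aux 2)) =
        (σ.row d).filter fun x => decide (σ.var (aux 1) ≤ x.label) := by
  set m := σ.var (xM d) with hmdef
  set r := σ.var (aux 1)
  replace ha (i : ℕ) (hi : i < m) := ha _ (mem_segment.2 ⟨i, Nat.zero_le i, hi, rfl⟩)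
  unfold filterLoop
  simp only [runs_seq, runs_assign]
  refine ⟨by grind, by grind, ?_⟩
  refine (Runs.count (c := 37) (N := m) (fun τ => τ.var (aux 1) = r ∧
    τ.var (aux 2) ≤ τ.var (aux 0) ∧ Frame [] [aP d, aL d, aG d] σ τ ∧
    (∀ j, τ.var (aux 0) ≤ j → τ.item d j = σ.item d j) ∧
    segment (τ.item d) 0 (τ.var (aux 2)) ++
      (segment (τ.item d) (τ.var (aux 0)) m).filter (fun x => decide (r ≤ x.label)) =
        (σ.row d).filter fun x => decide (r ≤ x.label))
    (by grind) (by omega) (by grind) ?_ ?_).mono ?_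
  · refine ⟨by grind, by grind, ((Frame.refl _ _ _).setVar _ (by simp)).setVar _ (by simp),
      by grind, ?_⟩
    simp [State.row, segment_of_le, Expr.eval, hmdef]
  · rintro τ ⟨hr', hle, hframe, hhigh, hseg⟩ hlt hm
    refine (runs_filterStep (d := d) (by omega) hle (by omega) (by grind)).mono ?_
    rintro υ t ⟨ht, hnext, hconst, hle', hframe', hother, hstep⟩
    refine ⟨ht, hnext, by grind [Frame], by omega, by omega, hframe.trans hframe', by grind, ?_⟩
    rw [segment_cons hlt, List.filter_cons] at hseg
    rw [← hseg, hstep, hnext, List.append_assoc, hr',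
      segment_congr (b := m) fun i hi _ => hother i hi]
    by_cases hc : r ≤ (τ.item d (τ.var (aux 0))).label <;> simp [hc]
  · rintro τ t ⟨ht, hend, -, hle, hframe, -, hseg⟩
    rw [hend, segment_of_le (a := m) le_rfl, List.filter_nil, List.append_nil] at hseg
    exact ⟨by grind, hframe, by omega, hseg⟩

end

/-- The label of the current position. -/
abbrev xA (d : Bool) : ℕ := slot 8 d

/-- The threshold below which labels are irrelevant. -/
abbrev xB (d : Bool) : ℕ := slot 9 d

/-- Compute the label of the current position. -/
def newLabel (d : Bool) : Cmd :=
  .seq (.assign (xA d) (.add (.var (xL (!d))) (.const 1)))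
    (.ite (.lt (.var (xA d)) (.var (xU (!d)))) (.assign (xA d) (.var (xU (!d)))) .skip)

/-- Compute the threshold for the labels. -/
def newThreshold (d : Bool) : Cmd :=
  .seq (baseValue (xU d) (xU (!d)))
    (.assign (xB d) (.sub (.add (.var (aux 0)) (.const 1)) (.var xK)))

/-- Make room for a new item in the row: append a cell, or push the labels from the place of the
current position on through the rest of the row. -/
def shiftRow (d : Bool) : Cmd :=
  .ite (.lt (.var (xP d)) (.var (xM d)))
    (.seq (.assign (aux 1) (.get (aL d) (.var (xP d)))) <|
      .seq (.assign (aux 0) (.add (.var (xP d)) (.const 1))) (cascadeLoop d))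
    (.assign (xM d) (.add (.var (xP d)) (.const 1)))

/-- Store the item of the current position in its place in the row. -/
def storeItem (d : Bool) : Cmd :=
  .seq (.put (aP d) (.var (xP d)) (.var xT)) <|
  .seq (.put (aL d) (.var (xP d)) (.var (xA d)))
    (.put (aG d) (.var (xP d)) (.var (xW (!d))))

/-- Insert the current position into the row. -/
def insertItem (d : Bool) : Cmd := .seq (shiftRow d) (storeItem d)

/-- Remove the irrelevant items of the row, and cut it off after `3 * k` items. -/
def truncateRow (d : Bool) : Cmd :=
  .seq (.assign (aux 1) (.var (xB d))) <|
  .seq (filterLoop d) <|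
  .seq (.assign (xM d) (.add (.var xK) (.add (.var xK) (.var xK))))
    (.ite (.lt (.var (aux 2)) (.var (xM d))) (.assign (xM d) (.var (aux 2))) .skip)

section

variable {n : ℕ} {S : Fin n → ℝ} {W : ℕ} {σ : State} {d : Bool}

theorem runs_newLabel (hL : σ.var (xL (!d)) + 1 < W) (hU : σ.var (xU (!d)) < W) :
    Runs S W (newLabel d) σ fun τ t => t ≤ 12 ∧
      τ = σ.setVar (xA d) (max (σ.var (xU (!d))) (σ.var (xL (!d)) + 1)) := by
  unfold newLabel
  simp only [runs_seq, runs_assign, runs_ite, runs_skip]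
  exact ⟨by grind, by grind, by grind, by grind⟩

theorem runs_newThreshold (hU : ∀ c, σ.var (xU c) + 1 < W) (hk : σ.var xK < W) :
    Runs S W (newThreshold d) σ fun τ t => t ≤ 20 ∧ Frame [xB d] [] σ τ ∧
      τ.var (xB d) = min (σ.var (xU (!d))) (σ.var (xU d) - σ.var xK) + 1 - σ.var xK := by
  have hd := hU d
  have hd' := hU (!d)
  unfold newThreshold
  rw [runs_seq]
  refine (runs_baseValue (by simp) (by omega) (by omega) hk).mono ?_
  rintro τ t ⟨ht, rfl⟩
  rw [runs_assign]
  exact ⟨by grind, by grind, ((Frame.refl _ _ _).setVar _ (by simp)).setVar _ (by simp), by grind⟩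

theorem runs_shiftRow (hm : σ.var (xM d) + 2 ≤ W) (hp : σ.var (xP d) ≤ σ.var (xM d))
    (ha : ∀ i < σ.var (xM d), σ.arr (aL d) i < W) :
    Runs S W (shiftRow d) σ fun τ t => t ≤ 25 * σ.var (xM d) + 20 ∧
      Frame [xM d] [aL d] σ τ ∧ τ.var (xM d) = max (σ.var (xM d)) (σ.var (xP d) + 1) ∧
      (∀ j < σ.var (xP d), τ.item d j = σ.item d j) ∧
      segment (τ.item d) (σ.var (xP d) + 1) (τ.var (xM d)) =
        displace (segment (σ.item d) (σ.var (xP d)) (σ.var (xM d))) := by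
  unfold shiftRow
  simp only [runs_ite, runs_seq, runs_assign]
  refine ⟨by grind, fun hb => ⟨by grind, by grind, ?_⟩, fun hb => ?_⟩
  · replace hb : σ.var (xP d) < σ.var (xM d) := hb
    refine (runs_cascadeLoop (d := d) (by grind) (by grind) (by grind) (by grind)).mono ?_
    rintro τ t ⟨ht, hframe, hlow, hseg⟩
    simp only [State.item_setVar, State.setVar_var, slot_inj, Nat.reduceAdd, Nat.reduceEqDiff,
      false_and, if_false, if_true, Expr.eval] at ht hlow hseg
    have hm' : τ.var (xM d) = σ.var (xM d) := by grind [Frame]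
    refine ⟨by grind, Frame.trans ?_ (hframe.mono (by simp) (by simp)), by omega, by grind, ?_⟩
    · exact ((Frame.refl _ _ _).setVar _ (by simp)).setVar _ (by simp)
    · rw [hm', hseg, segment_cons hb, displace]
      rfl
  · replace hb : σ.var (xP d) = σ.var (xM d) := by grind
    refine ⟨by grind, by grind, (Frame.refl _ _ _).setVar _ (by simp), by grind, by grind, ?_⟩
    simp [Expr.eval, hb, segment_of_le, displace]

theorem runs_storeItem (hp : σ.var (xP d) < W) (hT : σ.var xT < W) (hA : σ.var (xA d) < W)
    (hw : σ.var (xW (!d)) < W) :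
    Runs S W (storeItem d) σ fun τ t => t ≤ 9 ∧ Frame [] [aP d, aL d, aG d] σ τ ∧
      (∀ j ≠ σ.var (xP d), τ.item d j = σ.item d j) ∧
      τ.item d (σ.var (xP d)) = ⟨σ.var xT, σ.var (xA d), σ.var (xW (!d))⟩ := by
  unfold storeItem
  simp only [runs_seq, runs_put]
  refine ⟨by grind, by grind, by grind, by grind, by grind, by grind, by grind,
    (((Frame.refl _ _ _).setArr _ _ (by simp)).setArr _ _ (by simp)).setArr _ _ (by simp),
    fun j hj => ?_, ?_⟩
  · simp [State.item, Expr.eval, hj]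
  · simp [State.item, Expr.eval]

theorem runs_insertItem (hm : σ.var (xM d) + 2 ≤ W) (hp : σ.var (xP d) ≤ σ.var (xM d))
    (ha : ∀ i < σ.var (xM d), σ.arr (aL d) i < W) (hT : σ.var xT < W) (hA : σ.var (xA d) < W)
    (hw : σ.var (xW (!d)) < W) :
    Runs S W (insertItem d) σ fun τ t => t ≤ 25 * σ.var (xM d) + 40 ∧
      Frame [xM d] [aP d, aL d, aG d] σ τ ∧
      τ.var (xM d) = max (σ.var (xM d)) (σ.var (xP d) + 1) ∧
      τ.row d = segment (σ.item d) 0 (σ.var (xP d)) ++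
        ⟨σ.var xT, σ.var (xA d), σ.var (xW (!d))⟩ ::
          displace (segment (σ.item d) (σ.var (xP d)) (σ.var (xM d))) := by
  unfold insertItem
  rw [runs_seq]
  refine (runs_shiftRow (d := d) hm hp ha).mono ?_
  rintro τ s ⟨hs, hframe, hlen, hlow, hseg⟩
  have hvar : τ.var (xP d) = σ.var (xP d) ∧ τ.var xT = σ.var xT ∧ τ.var (xA d) = σ.var (xA d) ∧
      τ.var (xW (!d)) = σ.var (xW (!d)) := by grind [Frame]
  refine (runs_storeItem (d := d) (by omega) (by omega) (by omega) (by omega)).mono ?_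
  rintro υ t ⟨ht, hframe', hother, hitem⟩
  have hlen' : υ.var (xM d) = τ.var (xM d) := by grind [Frame]
  refine ⟨by omega, (hframe.mono (by simp) (by simp)).trans (hframe'.mono (by simp) (by simp)),
    by omega, ?_⟩
  obtain ⟨hP, hT', hA', hW⟩ := hvar
  rw [hP] at hother hitem
  rw [State.row, hlen', ← segment_append (Nat.zero_le (σ.var (xP d))) (by omega),
    segment_cons (a := σ.var (xP d)) (by omega), hitem, hT', hA', hW, ← hseg,
    segment_congr (b := σ.var (xP d)) fun i _ hi => (hother i hi.ne).trans (hlow i hi),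
    segment_congr (b := τ.var (xM d)) fun i hi _ => hother i (by omega)]

theorem runs_truncateRow (hm : σ.var (xM d) + 2 ≤ W) (hB : σ.var (xB d) < W)
    (hk : 3 * σ.var xK < W)
    (ha : ∀ x ∈ σ.row d, x.pos < W ∧ x.label < W ∧ x.finger < W) :
    Runs S W (truncateRow d) σ fun τ t => t ≤ 40 * σ.var (xM d) + 40 ∧
      Frame [xM d] [aP d, aL d, aG d] σ τ ∧
      τ.row d =
        ((σ.row d).filter fun x => decide (σ.var (xB d) ≤ x.label)).take (3 * σ.var xK) := by
  unfold truncateRow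
  simp only [runs_seq, runs_assign, runs_ite, runs_skip]
  refine ⟨by grind, (runs_filterLoop (d := d) (by grind) (by grind) ?_).mono ?_⟩
  · simpa [State.row_setVar] using ha
  rintro τ t ⟨ht, hframe, hle, hseg⟩
  rw [State.row_setVar (by simp)] at hseg
  simp only [State.setVar_var, slot_inj, Nat.reduceAdd, Nat.reduceEqDiff, false_and, if_false,
    if_true, Expr.eval] at ht hle hseg
  have hframe' : Frame [xM d] [aP d, aL d, aG d] σ τ :=
    ((Frame.refl _ _ _).setVar _ (by simp)).trans (hframe.mono (by simp) (by simp))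
  have hk' : τ.var xK = σ.var xK := by grind [Frame]
  refine ⟨by grind, by grind, fun hb => ⟨by grind, by grind,
    (hframe'.setVar _ (by simp)).setVar _ (by simp), ?_⟩, fun hb => ⟨by grind,
    hframe'.setVar _ (by simp), ?_⟩⟩
  · rw [← hseg, take_segment, min_eq_right (by grind), State.row]
    simp [Expr.eval]
  · rw [← hseg, take_segment, min_eq_left (by grind), State.row]
    simp [Expr.eval, show 3 * σ.var xK = τ.var xK + (τ.var xK + τ.var xK) by omega]

end

/-! ### One iteration -/

/-- Run a program for both directions in turn. -/
def both (f : Bool → Cmd) : Cmd := .seq (f true) (f false)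

theorem runs_both {n : ℕ} {S : Fin n → ℝ} {W : ℕ} {σ : State} {f : Bool → Cmd}
    (X Y : Bool → List ℕ) (P : Bool → State → ℕ → Prop)
    (hrun : ∀ d τ, Frame (X (!d)) (Y (!d)) σ τ →
      Runs S W (f d) τ fun υ t => Frame (X d) (Y d) τ υ ∧ P d υ t)
    (hstable : ∀ d τ υ t, Frame (X (!d)) (Y (!d)) τ υ → P d τ t → P d υ t) :
    Runs S W (both f) σ fun τ t => Frame (X true ++ X false) (Y true ++ Y false) σ τ ∧
      ∃ s : Bool → ℕ, t = s true + s false ∧ ∀ d, P d τ (s d) := by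
  unfold both
  rw [runs_seq]
  refine (hrun true σ (Frame.refl _ _ _)).mono ?_
  rintro τ s ⟨hframe, hP⟩
  refine (hrun false τ hframe).mono ?_
  rintro υ t ⟨hframe', hP'⟩
  refine ⟨(hframe.mono (by simp) (by simp)).trans (hframe'.mono (by simp) (by simp)),
    fun d => if d then s else t, by simp, fun d => ?_⟩
  cases d
  · exact hP'
  · exact hstable true τ υ s hframe' hP

/-- The data of the algorithm as they are stored in memory. -/
def State.data (σ : State) : Data where
  L d := σ.var (xL d)
  F d := σ.arr (aF d)
  R d := σ.row d

/-- The state of the memory at the beginning of an iteration, and until the data are changed. -/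
structure Ready {n : ℕ} (S : Fin n → ℝ) (W k : ℕ) (σ : State) : Prop where
  injective : Function.Injective S
  three_le : 3 ≤ k
  var_xK : σ.var xK = k
  lt : σ.var xT < n
  word : 8 * (n + k + 2) ≤ W
  inv : Inv n k (key S) (3 * k) (σ.var xT) σ.data

section Frame

variable {X Y : List ℕ} {σ τ : State} {i : ℕ} {d : Bool}

theorem Frame.arr_eq (h : Frame X Y σ τ) (hY : slot i d ∉ Y) :
    τ.arr (slot i d) = σ.arr (slot i d) :=
  funext fun j => h.2 i d j hY

theorem Frame.row_eq (h : Frame X Y σ τ) (hX : xM d ∉ X) (hP : aP d ∉ Y) (hL : aL d ∉ Y)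
    (hG : aG d ∉ Y) : τ.row d = σ.row d := by
  unfold State.row State.item
  rw [h.1 3 d (by norm_num) hX, h.arr_eq hP, h.arr_eq hL, h.arr_eq hG]

/-- The variables that are computed for the current position before the data are changed. -/
def probeVars : List ℕ :=
  [xP true, xP false, xZ true, xZ false, xW true, xU true, xW false, xU false]

theorem Frame.data_eq (h : Frame probeVars [] σ τ) : τ.data = σ.data := by
  have hL : ∀ d, τ.var (xL d) = σ.var (xL d) := fun d =>
    h.1 2 d (by norm_num) (by simp [probeVars])
  have hF : ∀ d, τ.arr (aF d) = σ.arr (aF d) := fun d => h.arr_eq (by simp)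
  have hR : ∀ d, τ.row d = σ.row d := fun d =>
    h.row_eq (by simp [probeVars]) (by simp) (by simp) (by simp)
  simp only [State.data, hL, hF, hR]

end Frame

theorem Inv.L_le {n k m t : ℕ} {T : Bool → ℕ → ℝ} {D : Data} (h : Inv n k T m t D) (d : Bool) :
    D.L d ≤ n := by
  rcases Nat.eq_zero_or_pos (D.L d) with hzero | hpos
  · omega
  · obtain ⟨-, v, hv, hreach⟩ := h.full d _ hpos le_rfl
    have := hreach.le
    have := hreach.lt
    omega

theorem Data.base_le_L (D : Data) (k : ℕ) (d : Bool) : D.base k d ≤ D.L d := by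
  unfold Data.base
  omega

theorem Inv.finger_le_L {n k m t : ℕ} {T : Bool → ℕ → ℝ} {D : Data} (h : Inv n k T m t D)
    {d : Bool} {a : Item} (ha : a ∈ D.R d) : a.finger ≤ D.L (!d) :=
  (h.finger d a ha).elim (fun hbase => hbase.trans (D.base_le_L k _)) And.left

/-- The finger of the item at the place `xP d`, from which the scan in direction `!d` starts. -/
def State.finger (σ : State) (d : Bool) : ℕ :=
  if σ.var (xP d) < σ.var (xM d) then σ.arr (aG d) (σ.var (xP d)) else 0

section Ready

variable {n : ℕ} {S : Fin n → ℝ} {W k : ℕ} {σ τ : State} {d : Bool}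

theorem Ready.of_frame (h : Ready S W k σ) (hf : Frame probeVars [] σ τ) : Ready S W k τ where
  injective := h.injective
  three_le := h.three_le
  var_xK := (hf.1 0 true (by norm_num) (by simp [probeVars])).trans h.var_xK
  lt := (hf.1 1 false (by norm_num) (by simp [probeVars])).trans_lt h.lt
  word := h.word
  inv := by
    rw [hf.data_eq, show τ.var xT = σ.var xT from hf.1 1 false (by norm_num) (by simp [probeVars])]
    exact h.inv

theorem Ready.item_mem {i : ℕ} (hi : i < σ.var (xM d)) : σ.item d i ∈ σ.data.R d :=
  mem_segment.2 ⟨i, Nat.zero_le i, hi, rfl⟩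

theorem Ready.pos_lt (h : Ready S W k σ) {i : ℕ} (hi : i < σ.var (xM d)) :
    σ.arr (aP d) i < σ.var xT :=
  (h.inv.item d _ (item_mem hi)).1

theorem Ready.label_le (h : Ready S W k σ) {i : ℕ} (hi : i < σ.var (xM d)) :
    σ.arr (aL d) i ≤ σ.var (xL (!d)) + 1 :=
  (h.inv.item d _ (item_mem hi)).2.2

theorem Ready.finger_le (h : Ready S W k σ) {i : ℕ} (hi : i < σ.var (xM d)) :
    σ.arr (aG d) i ≤ σ.var (xL (!d)) :=
  h.inv.finger_le_L (item_mem hi)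

theorem Ready.scanFinger_le (h : Ready S W k σ) : σ.finger (!d) ≤ σ.var (xL d) := by
  unfold State.finger
  split_ifs with hlt
  · simpa using h.finger_le hlt
  · exact Nat.zero_le _

theorem Ready.length_le (h : Ready S W k σ) (d : Bool) : σ.var (xM d) ≤ 3 * k := by
  simpa [State.data, State.row] using h.inv.length d

theorem Ready.L_le (h : Ready S W k σ) (d : Bool) : σ.var (xL d) ≤ n := h.inv.L_le d

/-- The variable `xP d` holds the place of the current position in the row. -/
structure Placed {n : ℕ} (S : Fin n → ℝ) (σ : State) (d : Bool) : Prop where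
  le : σ.var (xP d) ≤ σ.var (xM d)
  below : ∀ j < σ.var (xP d), key S d (σ.arr (aP d) j) < key S d (σ.var xT)
  maximal : σ.var (xP d) < σ.var (xM d) →
    ¬ key S d (σ.arr (aP d) (σ.var (xP d))) < key S d (σ.var xT)

theorem Placed.of_frame {X : List ℕ} (h : Placed S σ d) (hf : Frame X [] σ τ) (hP : xP d ∉ X)
    (hM : xM d ∉ X) (hT : xT ∉ X) : Placed S τ d := by
  have hplace : τ.var (xP d) = σ.var (xP d) := hf.1 4 d (by norm_num) hP
  have hlength : τ.var (xM d) = σ.var (xM d) := hf.1 3 d (by norm_num) hM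
  have htime : τ.var xT = σ.var xT := hf.1 1 false (by norm_num) hT
  obtain ⟨hle, hbelow, hmaximal⟩ := h
  constructor
  all_goals simpa only [hplace, hlength, htime, hf.arr_eq List.not_mem_nil]

theorem Ready.runs_findPlace (h : Ready S W k σ) :
    Runs S W (both fun d => findPlace d (aP d) (xM d) (xP d) xT) σ fun τ t =>
      t ≤ 100 * k ∧ Frame [xP true, xP false] [] σ τ ∧ ∀ d, Placed S τ d := by
  refine (runs_both (fun d => [xP d]) (fun _ => []) (fun d τ t => t ≤ 50 * k ∧ Placed S τ d)
    ?_ ?_).mono ?_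
  · intro d τ hf
    have hτ : Ready S W k τ := h.of_frame (hf.mono (by cases d <;> simp [probeVars]) (by simp))
    have hlength := hτ.length_le d
    have hword := h.word
    have hk := h.three_le
    refine (Rollercoaster.runs_findPlace (by simp) (by simp) (by omega) (by omega)
      (fun i hi => (hτ.pos_lt hi).trans hτ.lt) hτ.lt).mono ?_
    rintro υ t ⟨ht, p, rfl, hle, hbelow, hmaximal⟩
    exact ⟨(Frame.refl _ _ _).setVar _ (by simp), by omega, by grind, by grind, by grind⟩
  · rintro d τ υ t hf ⟨ht, hP⟩
    exact ⟨ht, hP.of_frame hf (by simp) (by simp) (by simp)⟩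
  · rintro τ t ⟨hf, s, rfl, hP⟩
    exact ⟨by grind, hf, fun d => (hP d).2⟩

/-- The variable `xZ d` holds the largest label `l` below the place `xP d` for which there are at
least `k - 1` labels `≥ l`, or `0` if there is no such label. -/
structure Selected (k : ℕ) (σ : State) (d : Bool) : Prop where
  le : ∀ i < σ.var (xP d), k ≤ countGe (σ.arr (aL d)) (σ.var (xP d)) (σ.arr (aL d) i) + 1 →
    σ.arr (aL d) i ≤ σ.var (xZ d)
  eq : σ.var (xZ d) = 0 ∨ ∃ i < σ.var (xP d), σ.var (xZ d) = σ.arr (aL d) i ∧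
    k ≤ countGe (σ.arr (aL d)) (σ.var (xP d)) (σ.arr (aL d) i) + 1

theorem Selected.of_frame {X : List ℕ} (h : Selected k σ d) (hf : Frame X [] σ τ) (hP : xP d ∉ X)
    (hZ : xZ d ∉ X) : Selected k τ d := by
  have hplace : τ.var (xP d) = σ.var (xP d) := hf.1 4 d (by norm_num) hP
  have hlabel : τ.var (xZ d) = σ.var (xZ d) := hf.1 5 d (by norm_num) hZ
  obtain ⟨hle, heq⟩ := h
  constructor
  all_goals simpa only [hplace, hlabel, hf.arr_eq List.not_mem_nil]

theorem Ready.runs_selectLabel (h : Ready S W k σ) (hp : ∀ d, σ.var (xP d) ≤ σ.var (xM d)) :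
    Runs S W (both selectLabel) σ fun τ t =>
      t ≤ 1400 * k ^ 2 ∧ Frame [xZ true, xZ false] [] σ τ ∧ ∀ d, Selected k τ d := by
  refine (runs_both (fun d => [xZ d]) (fun _ => []) (fun d τ t => t ≤ 700 * k ^ 2 ∧ Selected k τ d)
    ?_ ?_).mono ?_
  · intro d τ hf
    have hτ : Ready S W k τ := h.of_frame (hf.mono (by cases d <;> simp [probeVars]) (by simp))
    have hplace : τ.var (xP d) ≤ τ.var (xM d) := by grind [Frame]
    have hlength := hτ.length_le d
    have hL := hτ.L_le (!d)
    have hword := h.word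
    have hk := h.three_le
    have hK := hτ.var_xK
    refine (Rollercoaster.runs_selectLabel (d := d) (by omega) (fun i hi => ?_) (by omega)).mono ?_
    · have := hτ.label_le (hi.trans_le hplace)
      omega
    rintro υ t ⟨ht, hf', hle, heq⟩
    have hplace' : υ.var (xP d) = τ.var (xP d) := by grind [Frame]
    have hsq : (τ.var (xP d) + 1) ^ 2 ≤ (3 * k + 1) ^ 2 := Nat.pow_le_pow_left (by omega) 2
    rw [hK, ← hplace', ← hf'.arr_eq (d := d) (by simp)] at hle heq
    exact ⟨hf', by nlinarith, hle, heq⟩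
  · rintro d τ υ t hf ⟨ht, hP⟩
    exact ⟨ht, hP.of_frame hf (by simp) (by simp)⟩
  · rintro τ t ⟨hf, s, rfl, hP⟩
    exact ⟨by grind, hf, fun d => (hP d).2⟩

/-- The number from which the scan in direction `d` starts. -/
def State.scanStart (σ : State) (k : ℕ) (d : Bool) : ℕ := max (σ.data.base k d) (σ.finger (!d))

/-- The variable `xW d` holds the result of the scan: the last value, from the start of the scan
on, whose best endpoint lies below the current position. -/
structure Scanned {n : ℕ} (S : Fin n → ℝ) (k : ℕ) (σ : State) (d : Bool) : Prop where
  start_le : σ.scanStart k d ≤ σ.var (xW d)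
  le : σ.var (xW d) ≤ σ.var (xL d)
  below : σ.var (xW d) = σ.scanStart k d ∨
    key S d (σ.arr (aF d) (σ.var (xW d))) < key S d (σ.var xT)
  maximal : σ.var (xW d) < σ.var (xL d) →
    ¬ key S d (σ.arr (aF d) (σ.var (xW d) + 1)) < key S d (σ.var xT)
  value : σ.var (xU d) = σ.data.newValue k (fun d => σ.var (xZ d)) (fun d => σ.var (xW d)) d

/-- Store the irrelevance bound in `aux 0`, and set the scan pointer to the start of the scan. -/
def startScan (d : Bool) : Cmd := .seq (baseValue (xL d) (xL (!d))) (scanInit d)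

/-- Find the value of the current position. -/
def scan (d : Bool) : Cmd := .seq (startScan d) (.seq (scanLoop d) (scanValue d))

theorem State.scanStart_of_frame (hf : Frame [xW true, xW false, xU true, xU false] [] σ τ) :
    τ.scanStart k d = σ.scanStart k d := by
  rw [State.scanStart, (hf.mono (by simp [probeVars]) (by simp)).data_eq]
  grind [Frame, State.scanStart, State.finger]

theorem Ready.runs_startScan (h : Ready S W k σ) (hp : σ.var (xP (!d)) ≤ σ.var (xM (!d))) :
    Runs S W (startScan d) σ fun τ t => t ≤ 40 ∧
      τ = (σ.setVar (aux 0) (σ.data.base k d)).setVar (xW d) (σ.scanStart k d) := by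
  have hL := h.L_le d
  have hL' := h.L_le (!d)
  have hlength := h.length_le (!d)
  have hword := h.word
  have hK := h.var_xK
  have hbase : σ.data.base k d ≤ σ.var (xL d) := σ.data.base_le_L k d
  unfold startScan
  rw [runs_seq]
  refine (runs_baseValue (by simp) (by omega) (by omega) (by omega)).mono ?_
  rintro _ tbase ⟨htbase, rfl⟩
  rw [hK, show min (σ.var (xL !d)) (σ.var (xL d) - k) = σ.data.base k d from rfl]
  refine (runs_scanInit (d := d) (by grind) (by grind) (by grind) fun i hi => ?_).mono ?_
  · have := h.finger_le (d := !d) (i := i) (by simpa using hi)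
    grind
  rintro τ tinit ⟨htinit, hτ⟩
  exact ⟨by omega, by simpa [State.scanStart, State.finger] using hτ⟩

theorem Scanned.of_setVar {w : ℕ} (hstart : σ.scanStart k d ≤ w) (hle : w ≤ σ.var (xL d))
    (hbelow : w = σ.scanStart k d ∨ key S d (σ.arr (aF d) w) < key S d (σ.var xT))
    (hmaximal : w < σ.var (xL d) → ¬ key S d (σ.arr (aF d) (w + 1)) < key S d (σ.var xT))
    (hτ : τ = ((σ.setVar (aux 0) (σ.data.base k d)).setVar (xW d) w).setVar (xU d)
      (bestValue k (σ.data.base k d) w (σ.var (xZ d)))) :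
    Frame [xW d, xU d] [] σ τ ∧ τ.var (xW d) = w ∧ τ.scanStart k d = σ.scanStart k d ∧
      Scanned S k τ d := by
  have hframe : Frame [xW d, xU d] [] σ τ := by
    rw [hτ]
    exact (((Frame.refl _ _ _).setVar _ (by simp)).setVar _ (by simp)).setVar _ (by simp)
  have hstart' : τ.scanStart k d = σ.scanStart k d :=
    State.scanStart_of_frame (hframe.mono (by cases d <;> simp) (by simp))
  have hdata : τ.data = σ.data :=
    (hframe.mono (by cases d <;> simp [probeVars]) (by simp)).data_eq
  have hw : τ.var (xW d) = w := by grind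
  refine ⟨hframe, hw, hstart', ?_, ?_, ?_, ?_, ?_⟩
  · rwa [hstart', hw]
  · grind
  · grind
  · grind
  · rw [hdata]
    grind

theorem Ready.runs_scan_direction (h : Ready S W k σ) (hp : σ.var (xP (!d)) ≤ σ.var (xM (!d)))
    (hz : σ.var (xZ d) ≤ σ.var (xL (!d)) + 1) :
    Runs S W (scan d) σ fun τ t => Frame [xW d, xU d] [] σ τ ∧
      t ≤ 14 * (τ.var (xW d) - τ.scanStart k d) + 100 ∧ Scanned S k τ d := by
  have hL := h.L_le d
  have hL' := h.L_le (!d)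
  have hword := h.word
  have hlt := h.lt
  have hK := h.var_xK
  have hbase : σ.data.base k d ≤ σ.var (xL d) := σ.data.base_le_L k d
  have hfinger := h.scanFinger_le (d := d)
  unfold scan
  rw [runs_seq]
  refine (h.runs_startScan hp).mono ?_
  rintro _ tstart ⟨htstart, rfl⟩
  rw [runs_seq]
  refine (runs_scanLoop (d := d) (by grind) (by grind [State.scanStart]) (fun v hv hvL => ?_)
    (by omega) (by grind)).mono ?_
  · exact (h.inv.full d v hv (by simpa [State.data] using hvL)).1.trans hlt
  rintro _ tloop ⟨w, rfl, htloop, hge, hle, hbelow, hmaximal⟩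
  simp only [State.setVar_setVar, State.setVar_var, State.setVar_arr, slot_inj, Nat.reduceAdd,
    Nat.reduceEqDiff, false_and, if_false, if_true] at htloop hge hle hbelow hmaximal ⊢
  refine (runs_scanValue (d := d) (by grind) (by grind) (by grind)).mono ?_
  rintro τ tvalue ⟨htvalue, hτ⟩
  simp only [State.setVar_var, slot_inj, Nat.reduceAdd, Nat.reduceEqDiff, false_and, if_false,
    if_true, hK] at hτ
  obtain ⟨hframe, hw, hstart, hscanned⟩ := Scanned.of_setVar hge hle hbelow hmaximal hτ
  exact ⟨hframe, by omega, hscanned⟩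

theorem Ready.runs_scan (h : Ready S W k σ) (hp : ∀ d, σ.var (xP d) ≤ σ.var (xM d))
    (hz : ∀ d, σ.var (xZ d) ≤ σ.var (xL (!d)) + 1) :
    Runs S W (both scan) σ fun τ t =>
      t ≤ 14 * (τ.var (xW true) - τ.scanStart k true) +
        14 * (τ.var (xW false) - τ.scanStart k false) + 200 ∧
      Frame [xW true, xU true, xW false, xU false] [] σ τ ∧ ∀ d, Scanned S k τ d := by
  refine (runs_both (fun d => [xW d, xU d]) (fun _ => []) (fun d τ t =>
    t ≤ 14 * (τ.var (xW d) - τ.scanStart k d) + 100 ∧ Scanned S k τ d) ?_ ?_).mono ?_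
  · intro d τ hf
    have hτ : Ready S W k τ := h.of_frame (hf.mono (by cases d <;> simp [probeVars]) (by simp))
    exact hτ.runs_scan_direction (by grind [Frame]) (by grind [Frame])
  · rintro d τ υ t hf ⟨ht, hstart, hle, hbelow, hmaximal, hvalue⟩
    have hdata : υ.data = τ.data :=
      (hf.mono (by cases d <;> simp [probeVars]) (by simp)).data_eq
    have hstart' : υ.scanStart k d = τ.scanStart k d :=
      State.scanStart_of_frame (hf.mono (by cases d <;> simp) (by simp))
    refine ⟨by grind [Frame], by grind [Frame], by grind [Frame], by grind [Frame],
      by grind [Frame], ?_⟩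
    rw [hdata]
    grind [Frame]
  · rintro τ t ⟨hf, s, rfl, hP⟩
    exact ⟨by grind, hf, fun d => (hP d).2⟩

end Ready

theorem count_segment {T : ℕ → ℝ} {g : ℕ → Item} {p : ℕ} {s : ℝ}
    (hbelow : ∀ i < p, T (g i).pos < s) (l : ℕ) :
    count T (segment g 0 p) l s = countGe (fun i => (g i).label) p l := by
  induction p with
  | zero => simp [segment, countGe]
  | succ p ih =>
    rw [segment_snoc (Nat.zero_le p), count_append, ih fun i hi => hbelow i (by omega),
      countGe_succ, count_cons, count_nil, zero_add]
    simp [hbelow p (Nat.lt_succ_self p)]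

/-- The items of the row below the place of the current position. -/
def State.lower (σ : State) (d : Bool) : List Item := segment (σ.item d) 0 (σ.var (xP d))

/-- The items of the row from the place of the current position on. -/
def State.upper (σ : State) (d : Bool) : List Item :=
  segment (σ.item d) (σ.var (xP d)) (σ.var (xM d))

section Probe

variable {n : ℕ} {S : Fin n → ℝ} {W k : ℕ} {σ τ : State} {d : Bool}

/-- The labels `≥ l` are counted, so it suffices to compare `xZ d` with the least of them. -/
theorem Selected.le_of_countGe (h : Selected k σ d) (hk : 2 ≤ k) {l : ℕ}
    (hl : k ≤ countGe (σ.arr (aL d)) (σ.var (xP d)) l + 1) : l ≤ σ.var (xZ d) := by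
  set p := σ.var (xP d)
  set f := σ.arr (aL d)
  have hnonempty : ((Finset.range p).filter fun i => l ≤ f i).Nonempty := by
    obtain ⟨i, hi, hil⟩ := List.countP_pos_iff.1 (show 0 < countGe f p l by omega)
    exact ⟨i, by simpa using ⟨List.mem_range.1 hi, of_decide_eq_true hil⟩⟩
  obtain ⟨i, hi, hmin⟩ := Finset.exists_min_image _ f hnonempty
  simp only [Finset.mem_filter, Finset.mem_range] at hi hmin
  have hcount : countGe f p (f i) = countGe f p l := by
    refine List.countP_congr fun j hj => ?_
    simp only [decide_eq_true_eq]
    exact ⟨hi.2.trans, fun hjl => hmin j ⟨List.mem_range.1 hj, hjl⟩⟩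
  exact hi.2.trans (h.le i hi.1 (hl.trans_eq (congrArg (· + 1) hcount.symm)))

theorem Ready.xZ_le (h : Ready S W k σ) (hp : σ.var (xP d) ≤ σ.var (xM d))
    (hz : Selected k σ d) : σ.var (xZ d) ≤ σ.var (xL (!d)) + 1 := by
  rcases hz.eq with hzero | ⟨i, hi, heq, -⟩
  · omega
  · exact heq.trans_le (h.label_le (hi.trans_le hp))

theorem State.finger_eq : ((σ.upper d).head?.map Item.finger).getD 0 = σ.finger d := by
  unfold State.finger State.upper
  split_ifs with hlt
  · rw [segment_cons hlt]
    rfl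
  · rw [segment_of_le (not_lt.1 hlt)]
    rfl

theorem State.scanStart_eq : σ.data.scanStart k σ.upper d = σ.scanStart k d := by
  rw [Data.scanStart, State.finger_eq, State.scanStart]

theorem Placed.lower_append_upper (h : Placed S σ d) : σ.lower d ++ σ.upper d = σ.data.R d :=
  segment_append (Nat.zero_le _) h.le

theorem Ready.lt_of_mem_upper (h : Ready S W k σ) (hp : Placed S σ d) {a : Item}
    (ha : a ∈ σ.upper d) : key S d (σ.var xT) < key S d a.pos := by
  obtain ⟨i, hi, hiM, rfl⟩ := mem_segment.1 ha
  have hlt : σ.var (xP d) < σ.var (xM d) := hi.trans_lt hiM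
  have hne : key S d (σ.var xT) ≠ key S d (σ.arr (aP d) (σ.var (xP d))) :=
    (key_ne h.injective d (h.pos_lt hlt) h.lt).symm
  have hfirst : key S d (σ.var xT) < key S d (σ.item d (σ.var (xP d))).pos :=
    lt_of_le_of_ne (not_lt.1 (hp.maximal hlt)) hne
  have hsorted : Ascending (key S d) (σ.upper d) :=
    (h.inv.sorted d).sublist (hp.lower_append_upper ▸ List.sublist_append_right _ _)
  rw [State.upper, segment_cons hlt] at ha hsorted
  rcases List.mem_cons.1 ha with heq | hmem
  · rwa [heq]
  · exact hfirst.trans ((List.pairwise_cons.1 hsorted).1 _ hmem)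

theorem Ready.count_row (h : Ready S W k σ) (hp : Placed S σ d) (l : ℕ) :
    count (key S d) (σ.data.R d) l (key S d (σ.var xT)) =
      countGe (σ.arr (aL d)) (σ.var (xP d)) l := by
  rw [← hp.lower_append_upper, count_append,
    count_eq_zero (R := σ.upper d) fun a ha => (h.lt_of_mem_upper hp ha).le, add_zero]
  exact count_segment hp.below l

theorem Scanned.cases (h : Scanned S k σ d) :
    σ.var (xW d) = σ.data.base k d ∨
      (∃ a, (σ.upper (!d)).head? = some a ∧ σ.var (xW d) = a.finger) ∨
        key S d (σ.arr (aF d) (σ.var (xW d))) < key S d (σ.var xT) := by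
  have hstart := h.start_le
  rcases h.below with heq | hlt
  · rw [State.scanStart, ← State.finger_eq] at heq hstart
    cases hhead : (σ.upper (!d)).head? with
    | none => simp_all
    | some a =>
      rw [hhead] at heq
      rcases max_choice (σ.data.base k d) a.finger with hmax | hmax
      · exact Or.inl (heq.trans hmax)
      · exact Or.inr (Or.inl ⟨a, rfl, heq.trans hmax⟩)
  · exact Or.inr (Or.inr hlt)

theorem Ready.probe (h : Ready S W k σ) (hp : ∀ d, Placed S σ d) (hz : ∀ d, Selected k σ d)
    (hw : ∀ d, Scanned S k σ d) :
    Probe k (key S) (σ.var xT) σ.data σ.lower σ.upper (fun d => σ.var (xZ d))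
      (fun d => σ.var (xW d)) where
  split d := (hp d).lower_append_upper.symm
  below d a ha := by
    obtain ⟨i, -, hi, rfl⟩ := mem_segment.1 ha
    exact (hp d).below i hi
  above d a ha := h.lt_of_mem_upper (hp d) ha
  le_z d l _ hl := by
    have hk := h.three_le
    rw [h.count_row (hp d)] at hl
    exact (hz d).le_of_countGe (by omega) hl
  z_spec d hd := by
    rcases (hz d).eq with hzero | ⟨i, -, heq, hcount⟩
    · omega
    · rwa [h.count_row (hp d), heq]
  base_le d := (le_max_left _ _).trans (hw d).start_le
  finger_le d a ha := by
    refine le_trans ?_ ((le_max_right _ _).trans (hw d).start_le)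
    rw [← State.finger_eq, ha]
    exact le_rfl
  w_le d := (hw d).le
  scanned d := (hw d).cases
  maximal d hd := not_lt.1 ((hw d).maximal hd)

end Probe

/-- The state of the memory when the quantities of the current position have been computed. -/
structure Probed {n : ℕ} (S : Fin n → ℝ) (W k : ℕ) (σ : State) : Prop extends Ready S W k σ where
  place_le : ∀ d, σ.var (xP d) ≤ σ.var (xM d)
  label_le : ∀ d, σ.var (xZ d) ≤ σ.var (xL (!d)) + 1
  value : ∀ d, σ.var (xU d) =
    σ.data.newValue k (fun d => σ.var (xZ d)) (fun d => σ.var (xW d)) d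
  probe : Probe k (key S) (σ.var xT) σ.data σ.lower σ.upper (fun d => σ.var (xZ d))
    (fun d => σ.var (xW d))

/-- The data after the treatment of the current position, before the rows are truncated. -/
def State.next (σ : State) (k : ℕ) : Data :=
  σ.data.insert k (σ.var xT) σ.lower σ.upper (fun d => σ.var (xZ d)) (fun d => σ.var (xW d))

/-- Compute the label of the current position and the threshold for the labels. -/
def newBounds (d : Bool) : Cmd := .seq (newLabel d) (newThreshold d)

/-- Compute the new values, labels and thresholds. -/
def prepare : Cmd := .seq (both fillValues) (both newBounds)

/-- Update the row. -/
def updateRow (d : Bool) : Cmd := .seq (insertItem d) (truncateRow d)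

/-- Treat the current position, whose quantities have been computed, and move to the next one. -/
def update : Cmd :=
  .seq prepare <| .seq (both updateRow) <|
  .seq (both fun d => .assign (xL d) (.var (xU d))) (.assign xT (.add (.var xT) (.const 1)))

/-- The memory after the computation of the new values, labels and thresholds from `σ`. -/
structure Prepared (k : ℕ) (σ τ : State) : Prop where
  frame : Frame [xU true, xU false, xA true, xA false, xB true, xB false] [aF true, aF false] σ τ
  value : ∀ d, τ.var (xU d) = (σ.next k).L d
  best : ∀ d, τ.arr (aF d) = (σ.next k).F d
  label : ∀ d, τ.var (xA d) = max (σ.var (xU (!d))) (σ.var (xL (!d)) + 1)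
  threshold : ∀ d, τ.var (xB d) = (σ.next k).threshold k d

section update

variable {n : ℕ} {S : Fin n → ℝ} {W k : ℕ} {σ τ : State} {d : Bool}

theorem Probed.inv_next (h : Probed S W k σ) :
    Inv n k (key S) (3 * k + 1) (σ.var xT + 1) (σ.next k) :=
  h.probe.insert (by have := h.three_le; omega) h.lt key_not h.inv

theorem Probed.next_L (h : Probed S W k σ) :
    (σ.next k).L d = max (σ.var (xL d)) (σ.var (xU d)) := by
  rw [h.value]
  rfl

theorem Probed.next_L_le (h : Probed S W k σ) : max (σ.var (xL d)) (σ.var (xU d)) ≤ n :=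
  h.next_L.symm.trans_le (h.inv_next.L_le d)

theorem Probed.value_sub_le (h : Probed S W k σ) :
    σ.var (xU d) - σ.var (xW d) ≤ k + 1 + ((σ.next k).L d - σ.var (xL d)) := by
  have hbest : σ.var (xU d) ≤ max (σ.var (xW d) + 1) (σ.var (xZ d) + k - 1) :=
    (h.value d).trans_le bestValue_le
  have hbase : min (σ.var (xL (!d))) (σ.var (xL d) - k) ≤ σ.var (xW d) := h.probe.base_le d
  have hz := h.label_le d
  have hL := h.next_L (d := d)
  omega

theorem Probed.runs_fillValues (h : Probed S W k σ) :
    Runs S W (both fillValues) σ fun τ t =>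
      t ≤ 10 * ((σ.next k).L true - σ.var (xL true)) +
        10 * ((σ.next k).L false - σ.var (xL false)) + 20 * k + 60 ∧
      Frame [xU true, xU false] [aF true, aF false] σ τ ∧
      ∀ d, τ.var (xU d) = (σ.next k).L d ∧ τ.arr (aF d) = (σ.next k).F d := by
  refine (runs_both (fun d => [xU d]) (fun d => [aF d]) (fun d τ t =>
    t ≤ 10 * ((σ.next k).L d - σ.var (xL d)) + 10 * k + 30 ∧
      τ.var (xU d) = (σ.next k).L d ∧ τ.arr (aF d) = (σ.next k).F d) ?_ ?_).mono ?_
  · intro d τ hf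
    have hsub := h.value_sub_le (d := d)
    have hU : τ.var (xU d) = σ.var (xU d) := by grind [Frame]
    have hw : τ.var (xW d) = σ.var (xW d) := by grind [Frame]
    have hL : τ.var (xL d) = σ.var (xL d) := by grind [Frame]
    have hT : τ.var xT = σ.var xT := hf.1 1 false (by norm_num) (by simp)
    have hword := h.word
    have hnext := h.next_L_le (d := d)
    have hlt := h.lt
    have hwL : σ.var (xW d) ≤ σ.var (xL d) := h.probe.w_le d
    refine (Rollercoaster.runs_fillValues (by omega) (by omega) (by omega) (by omega)).mono ?_
    rintro υ t ⟨ht, hf', hmax, harr⟩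
    refine ⟨hf', by omega, by rw [hmax, hL, hU, h.next_L], funext fun v => ?_⟩
    rw [harr, hw, hU, hT, hf.arr_eq (by simp), h.value]
    rfl
  · rintro d τ υ t hf ⟨ht, hL, hF⟩
    exact ⟨ht, (hf.1 7 d (by norm_num) (by simp)).trans hL, (hf.arr_eq (by simp)).trans hF⟩
  · rintro τ t ⟨hf, s, rfl, hP⟩
    have htrue := (hP true).1
    have hfalse := (hP false).1
    exact ⟨by omega, hf, fun d => (hP d).2⟩

theorem runs_newBounds (hU : ∀ d, σ.var (xU d) + 1 < W) (hL : ∀ d, σ.var (xL d) + 1 < W)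
    (hk : σ.var xK < W) :
    Runs S W (both newBounds) σ fun τ t => t ≤ 64 ∧
      Frame [xA true, xB true, xA false, xB false] [] σ τ ∧
      ∀ d, τ.var (xA d) = max (σ.var (xU (!d))) (σ.var (xL (!d)) + 1) ∧
        τ.var (xB d) = min (σ.var (xU (!d))) (σ.var (xU d) - σ.var xK) + 1 - σ.var xK := by
  refine (runs_both (fun d => [xA d, xB d]) (fun _ => []) (fun d τ t => t ≤ 32 ∧
    τ.var (xA d) = max (σ.var (xU (!d))) (σ.var (xL (!d)) + 1) ∧
    τ.var (xB d) = min (σ.var (xU (!d))) (σ.var (xU d) - σ.var xK) + 1 - σ.var xK) ?_ ?_).mono ?_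
  · intro d τ hf
    have hU' : ∀ c, τ.var (xU c) = σ.var (xU c) := fun c => hf.1 7 c (by norm_num) (by simp)
    have hL' : ∀ c, τ.var (xL c) = σ.var (xL c) := fun c => hf.1 2 c (by norm_num) (by simp)
    have hK : τ.var xK = σ.var xK := hf.1 0 true (by norm_num) (by simp)
    unfold newBounds
    rw [runs_seq]
    refine (runs_newLabel (by grind) (by grind)).mono ?_
    rintro _ s ⟨hs, rfl⟩
    refine (runs_newThreshold (by grind) (by grind)).mono ?_
    rintro υ t ⟨ht, hf', hB⟩
    exact ⟨((Frame.refl _ _ _).setVar _ (by simp)).trans (hf'.mono (by simp) (by simp)),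
      by omega, by grind [Frame], by grind⟩
  · rintro d τ υ t hf ⟨ht, hA, hB⟩
    exact ⟨ht, by grind [Frame], by grind [Frame]⟩
  · rintro τ t ⟨hf, s, rfl, hP⟩
    exact ⟨by grind, hf, fun d => (hP d).2⟩

theorem Probed.runs_prepare (h : Probed S W k σ) :
    Runs S W prepare σ fun τ t =>
      t ≤ 10 * ((σ.next k).L true - σ.var (xL true)) +
        10 * ((σ.next k).L false - σ.var (xL false)) + 20 * k + 124 ∧ Prepared k σ τ := by
  have hword := h.word
  have hK := h.var_xK
  unfold prepare
  rw [runs_seq]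
  refine h.runs_fillValues.mono ?_
  rintro τ s ⟨hs, hf, hfill⟩
  have hL : ∀ d, τ.var (xL d) = σ.var (xL d) := fun d => hf.1 2 d (by norm_num) (by simp)
  have hU : ∀ d, τ.var (xU d) = max (σ.var (xL d)) (σ.var (xU d)) := fun d =>
    (hfill d).1.trans h.next_L
  have hK' : τ.var xK = k := (hf.1 0 true (by norm_num) (by simp)).trans hK
  refine (runs_newBounds (fun d => ?_) (fun d => ?_) (by omega)).mono ?_
  · have := h.next_L_le (d := d)
    have := hU d
    omega
  · have := h.next_L_le (d := d)
    have := hL d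
    omega
  rintro υ t ⟨ht, hf', hbounds⟩
  refine ⟨by omega, (hf.mono (by simp) (by simp)).trans (hf'.mono (by simp) (by simp)),
    fun d => (hf'.1 7 d (by norm_num) (by simp)).trans (hfill d).1,
    fun d => (hf'.arr_eq (by simp)).trans (hfill d).2, fun d => ?_, fun d => ?_⟩
  · have := hU (!d)
    have := hL (!d)
    have := (hbounds d).1
    omega
  · rw [(hbounds d).2, (hfill d).1, (hfill _).1, hK']
    rfl

theorem Probed.label_newItem (h : Probed S W k σ) :
    max (σ.var (xU (!d))) (σ.var (xL (!d)) + 1) =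
      (σ.data.newItem k (σ.var xT) (fun d => σ.var (xZ d)) (fun d => σ.var (xW d)) d).label := by
  rw [h.value]
  rfl

theorem Probed.runs_truncateRow (h : Probed S W k σ) (hrow : τ.row d = (σ.next k).R d)
    (hB : τ.var (xB d) = (σ.next k).threshold k d) (hK : τ.var xK = k) :
    Runs S W (truncateRow d) τ fun υ t => Frame [xM d] [aP d, aL d, aG d] τ υ ∧
      t ≤ 120 * k + 80 ∧ υ.row d = ((σ.next k).trim k).R d := by
  have hword := h.word
  have hlt := h.lt
  have hM : τ.var (xM d) ≤ 3 * k + 1 := by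
    simpa [State.row, ← hrow] using h.inv_next.length d
  have hthreshold := (σ.next k).threshold_le (k := k) (d := d)
  have hL := h.inv_next.L_le
  have := hL d
  refine (Rollercoaster.runs_truncateRow (by omega) (by omega) (by omega) fun x hx => ?_).mono ?_
  · rw [hrow] at hx
    have hbounds := h.inv_next.item d x hx
    have hfinger := h.inv_next.finger_le_L hx
    have := hL (!d)
    omega
  rintro υ t ⟨ht, hframe, htrim⟩
  refine ⟨hframe, by omega, ?_⟩
  rw [htrim, hrow, hB, hK]
  rfl

theorem Probed.runs_updateRow (h : Probed S W k σ)
    (hf : Frame [xU true, xU false, xA true, xA false, xB true, xB false, xM (!d)]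
      [aF true, aF false, aP (!d), aL (!d), aG (!d)] σ τ)
    (hA : τ.var (xA d) = max (σ.var (xU (!d))) (σ.var (xL (!d)) + 1))
    (hB : τ.var (xB d) = (σ.next k).threshold k d) :
    Runs S W (updateRow d) τ fun υ t => Frame [xM d] [aP d, aL d, aG d] τ υ ∧
      t ≤ 195 * k + 120 ∧ υ.row d = ((σ.next k).trim k).R d := by
  have hword := h.word
  have hlt := h.lt
  have hlength := h.length_le d
  have hplace := h.place_le d
  have hnext := h.next_L_le (d := !d)
  have hw : σ.var (xW (!d)) ≤ σ.var (xL (!d)) := h.probe.w_le _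
  have hM' : τ.var (xM d) = σ.var (xM d) := hf.1 3 d (by norm_num) (by cases d <;> simp)
  have hP' : τ.var (xP d) = σ.var (xP d) := hf.1 4 d (by norm_num) (by simp)
  have hT' : τ.var xT = σ.var xT := hf.1 1 false (by norm_num) (by simp)
  have hW' : τ.var (xW (!d)) = σ.var (xW (!d)) := hf.1 6 (!d) (by norm_num) (by simp)
  have hK' : τ.var xK = k := (hf.1 0 true (by norm_num) (by simp)).trans h.var_xK
  have hlabels : τ.arr (aL d) = σ.arr (aL d) := hf.arr_eq (by simp)
  have hitem : τ.item d = σ.item d := by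
    unfold State.item
    rw [hlabels, hf.arr_eq (by simp), hf.arr_eq (by simp)]
  unfold updateRow
  rw [runs_seq]
  refine (runs_insertItem (by omega) (by omega) (fun i hi => ?_) (by omega) (by omega)
    (by omega)).mono ?_
  · have := h.toReady.label_le (hM' ▸ hi)
    rw [hlabels]
    omega
  rintro υ s ⟨hs, hf', -, hrow⟩
  replace hrow : υ.row d = (σ.next k).R d := by
    rw [hrow, hitem, hP', hM', hT', hA, hW', h.label_newItem]
    rfl
  have hB' : υ.var (xB d) = (σ.next k).threshold k d := by grind [Frame]
  have hK : υ.var xK = k := (hf'.1 0 true (by norm_num) (by simp)).trans hK'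
  refine (h.runs_truncateRow hrow hB' hK).mono ?_
  rintro ω t ⟨hf'', ht, htrim⟩
  exact ⟨hf'.trans hf'', by omega, htrim⟩

theorem Prepared.runs_updateRow (hτ : Prepared k σ τ) (h : Probed S W k σ) :
    Runs S W (both updateRow) τ fun υ t => t ≤ 390 * k + 240 ∧
      Frame [xM true, xM false] [aP true, aL true, aG true, aP false, aL false, aG false] τ υ ∧
      ∀ d, υ.row d = ((σ.next k).trim k).R d := by
  refine (runs_both (fun d => [xM d]) (fun d => [aP d, aL d, aG d]) (fun d υ t =>
    t ≤ 195 * k + 120 ∧ υ.row d = ((σ.next k).trim k).R d) ?_ ?_).mono ?_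
  · intro d υ hf
    exact h.runs_updateRow ((hτ.frame.mono (by simp) (by simp)).trans (hf.mono (by simp) (by simp)))
      ((hf.1 8 d (by norm_num) (by simp)).trans (hτ.label d))
      ((hf.1 9 d (by norm_num) (by simp)).trans (hτ.threshold d))
  · rintro d υ ω t hf ⟨ht, hrow⟩
    exact ⟨ht, (hf.row_eq (by simp) (by simp) (by simp) (by simp)).trans hrow⟩
  · rintro υ t ⟨hf, s, rfl, hP⟩
    exact ⟨by grind, hf, fun d => (hP d).2⟩

theorem runs_storeValues (hU : ∀ d, σ.var (xU d) < W) :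
    Runs S W (both fun d => .assign (xL d) (.var (xU d))) σ fun τ t => t = 4 ∧
      Frame [xL true, xL false] [] σ τ ∧ ∀ d, τ.var (xL d) = σ.var (xU d) := by
  unfold both
  simp only [runs_seq, runs_assign]
  refine ⟨by grind, by grind, by grind, ?_, fun d => by cases d <;> grind⟩
  exact ((Frame.refl _ _ _).setVar _ (by simp)).setVar _ (by simp)

theorem Probed.runs_update (h : Probed S W k σ) :
    Runs S W update σ fun τ t =>
      t ≤ 10 * ((σ.next k).L true - σ.var (xL true)) +
        10 * ((σ.next k).L false - σ.var (xL false)) + 500 * k + 500 ∧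
      τ.data = (σ.next k).trim k ∧ τ.var xT = σ.var xT + 1 ∧ τ.var xK = k ∧
      τ.var xN = σ.var xN := by
  unfold update
  rw [runs_seq]
  refine h.runs_prepare.mono ?_
  rintro τ s ⟨hs, hτ⟩
  rw [runs_seq]
  refine (hτ.runs_updateRow h).mono ?_
  rintro υ t ⟨ht, hf, hrow⟩
  have hU : ∀ d, υ.var (xU d) = (σ.next k).L d := fun d =>
    (hf.1 7 d (by norm_num) (by simp)).trans (hτ.value d)
  have hword := h.word
  have hlt := h.lt
  rw [runs_seq]
  refine (runs_storeValues fun d => ?_).mono ?_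
  · have := h.inv_next.L_le d
    have := hU d
    omega
  rintro ω _ ⟨rfl, hf', hL⟩
  have hframe : Frame [xU true, xU false, xA true, xA false, xB true, xB false, xM true, xM false,
      xL true, xL false] [aF true, aF false, aP true, aL true, aG true, aP false, aL false,
      aG false] σ ω :=
    ((hτ.frame.mono (by simp) (by simp)).trans (hf.mono (by simp) (by simp))).trans
      (hf'.mono (by simp) (by simp))
  have hT : ω.var xT = σ.var xT := hframe.1 1 false (by norm_num) (by simp)
  have hK : ω.var xK = k := (hframe.1 0 true (by norm_num) (by simp)).trans h.var_xK
  have hN : ω.var xN = σ.var xN := hframe.1 0 false (by norm_num) (by simp)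
  have hdata : ω.data = (σ.next k).trim k := by
    have hF : ∀ d, ω.arr (aF d) = (σ.next k).F d := fun d =>
      ((hf'.arr_eq (by simp)).trans (hf.arr_eq (by simp))).trans (hτ.best d)
    have hR : ∀ d, ω.row d = ((σ.next k).trim k).R d := fun d =>
      (hf'.row_eq (by simp) (by simp) (by simp) (by simp)).trans (hrow d)
    simp only [State.data, hL, hU, hF, hR]
    rfl
  rw [runs_assign]
  refine ⟨by grind, by grind, ?_, by grind, by grind, by grind⟩
  rw [← hdata]
  simp [State.data, State.row_setVar]

end update

/-- Compute the place, the labels and the values of the current position. -/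
def inspect : Cmd :=
  .seq (both fun d => findPlace d (aP d) (xM d) (xP d) xT) (.seq (both selectLabel) (both scan))

/-- Treat one position. -/
def advance : Cmd := .seq inspect update

/-- Store the larger of the two values. -/
def output : Cmd :=
  .ite (.lt (.var (xL true)) (.var (xL false))) (.assign xN (.var (xL false)))
    (.assign xN (.var (xL true)))

/-- The program that computes the length of a longest `k`-rollercoaster. -/
def longest : Cmd := .seq (.loop (.lt (.var xT) (.var xN)) advance) output

/-- The total potential. -/
def Data.energy (D : Data) (k : ℕ) : ℕ := D.potential k true + D.potential k false

/-- A bound for the time and the potential spent on the positions before the current one. -/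
def State.budget (σ : State) (k : ℕ) : ℕ :=
  3000 * k ^ 2 * σ.var xT + (84 * k + 60) * (σ.data.L true + σ.data.L false)

section longest

variable {n : ℕ} {S : Fin n → ℝ} {W k : ℕ} {σ : State}

theorem Probe.energy_trim_insert_add_le {t : ℕ} {T : Bool → ℕ → ℝ} {D : Data}
    {A B : Bool → List Item} {z w : Bool → ℕ} (hp : Probe k T t D A B z w) (hk : 2 ≤ k) (ht : t < n)
    (hneg : ∀ d x, T (!d) x = -T d x) (h : Inv n k T (3 * k) t D) :
    ((D.insert k t A B z w).trim k).energy k +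
        ((w true - D.scanStart k B true) + (w false - D.scanStart k B false)) ≤
      D.energy k + (6 * k + 3) * (((D.insert k t A B z w).L true - D.L true) +
        ((D.insert k t A B z w).L false - D.L false)) + 2 * k + 2 := by
  have htrim := (hp.insert hk ht hneg h).potential_trim_le (by omega)
  have hinsert := hp.potential_insert_le h
  have htrim₁ := htrim true
  have htrim₂ := htrim false
  have hinsert₁ := hinsert true
  have hinsert₂ := hinsert false
  simp only [Bool.not_true, Bool.not_false] at hinsert₁ hinsert₂
  unfold Data.energy
  linarith

theorem Ready.runs_inspect (h : Ready S W k σ) :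
    Runs S W inspect σ fun τ t =>
      t ≤ 14 * (τ.var (xW true) - τ.scanStart k true) +
        14 * (τ.var (xW false) - τ.scanStart k false) + 1400 * k ^ 2 + 100 * k + 200 ∧
      Frame probeVars [] σ τ ∧ Probed S W k τ := by
  unfold inspect
  rw [runs_seq]
  refine h.runs_findPlace.mono ?_
  rintro τ₁ t₁ ⟨ht₁, hf₁, hplaced⟩
  replace hf₁ : Frame probeVars [] σ τ₁ := hf₁.mono (by simp [probeVars]) (by simp)
  have hplace : ∀ d, τ₁.var (xP d) ≤ τ₁.var (xM d) := fun d => (hplaced d).le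
  rw [runs_seq]
  refine ((h.of_frame hf₁).runs_selectLabel hplace).mono ?_
  rintro τ₂ t₂ ⟨ht₂, hf₂, hselected⟩
  have hready : Ready S W k τ₂ :=
    (h.of_frame hf₁).of_frame (hf₂.mono (by simp [probeVars]) (by simp))
  replace hplaced : ∀ d, Placed S τ₂ d := fun d =>
    (hplaced d).of_frame hf₂ (by simp) (by simp) (by simp)
  refine (hready.runs_scan (fun d => (hplaced d).le)
    fun d => hready.xZ_le (hplaced d).le (hselected d)).mono ?_
  rintro τ₃ t₃ ⟨ht₃, hf₃, hscanned⟩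
  replace hready : Ready S W k τ₃ := hready.of_frame (hf₃.mono (by simp [probeVars]) (by simp))
  replace hplaced : ∀ d, Placed S τ₃ d := fun d =>
    (hplaced d).of_frame hf₃ (by simp) (by simp) (by simp)
  replace hselected : ∀ d, Selected k τ₃ d := fun d =>
    (hselected d).of_frame hf₃ (by simp) (by simp)
  exact ⟨by omega, (hf₁.trans (hf₂.mono (by simp [probeVars]) (by simp))).trans
      (hf₃.mono (by simp [probeVars]) (by simp)),
    { hready with
      place_le := fun d => (hplaced d).le
      label_le := fun d => hready.xZ_le (hplaced d).le (hselected d)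
      value := fun d => (hscanned d).value
      probe := hready.probe hplaced hselected hscanned }⟩

theorem Ready.runs_advance (h : Ready S W k σ) :
    Runs S W advance σ fun τ t => ∃ A B z w, Probe k (key S) (σ.var xT) σ.data A B z w ∧
      τ.data = (σ.data.insert k (σ.var xT) A B z w).trim k ∧
      τ.var xT = σ.var xT + 1 ∧ τ.var xK = k ∧ τ.var xN = σ.var xN ∧
      t ≤ 14 * (w true - σ.data.scanStart k B true) + 14 * (w false - σ.data.scanStart k B false) +
        10 * (τ.data.L true - σ.data.L true) + 10 * (τ.data.L false - σ.data.L false) +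
        2000 * k ^ 2 := by
  unfold advance
  rw [runs_seq]
  refine h.runs_inspect.mono ?_
  rintro τ s ⟨hs, hf, hτ⟩
  refine hτ.runs_update.mono ?_
  rintro υ t ⟨ht, hdata, hT, hK, hN⟩
  have hT' : τ.var xT = σ.var xT := hf.1 1 false (by norm_num) (by simp [probeVars])
  have hN' : τ.var xN = σ.var xN := hf.1 0 false (by norm_num) (by simp [probeVars])
  rw [← hT', ← hN', ← hf.data_eq]
  refine ⟨_, _, _, _, hτ.probe, hdata, hT, hK, hN, ?_⟩
  rw [hdata, State.scanStart_eq, State.scanStart_eq]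
  change t ≤ 10 * (((τ.next k).trim k).L true - τ.data.L true) +
    10 * (((τ.next k).trim k).L false - τ.data.L false) + 500 * k + 500 at ht
  have hk := h.three_le
  have hsq : 3 * k ≤ k ^ 2 := by nlinarith
  omega

theorem Ready.runs_advance_amortized (h : Ready S W k σ) :
    Runs S W advance σ fun τ t => Inv n k (key S) (3 * k) (τ.var xT) τ.data ∧
      τ.var xT = σ.var xT + 1 ∧ τ.var xK = k ∧ τ.var xN = σ.var xN ∧
      t + 4 + 14 * τ.data.energy k + σ.budget k ≤ 14 * σ.data.energy k + τ.budget k := by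
  have hk := h.three_le
  refine h.runs_advance.mono ?_
  rintro τ t ⟨A, B, z, w, hprobe, hdata, hT, hK, hN, ht⟩
  set D := σ.data.insert k (σ.var xT) A B z w with hD
  have hinv : Inv n k (key S) (3 * k + 1) (σ.var xT + 1) D :=
    hprobe.insert (by omega) h.lt key_not h.inv
  refine ⟨by rw [hdata, hT]; exact hinv.trim, hT, hK, hN, ?_⟩
  have henergy := hprobe.energy_trim_insert_add_le (by omega) h.lt key_not h.inv
  have hL : ∀ d, τ.data.L d = D.L d := fun d => by rw [hdata]; rfl
  rw [← hdata, hD.symm] at henergy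
  obtain ⟨a, ha⟩ : ∃ a, D.L true = σ.data.L true + a := Nat.exists_eq_add_of_le Data.le_insert_L
  obtain ⟨b, hb⟩ : ∃ b, D.L false = σ.data.L false + b := Nat.exists_eq_add_of_le Data.le_insert_L
  simp only [hL, ha, hb, Nat.add_sub_cancel_left] at henergy ht
  unfold State.budget
  rw [hT, hL, hL, ha, hb]
  have hsq : 3 * k ≤ k ^ 2 := by nlinarith
  nlinarith

theorem runs_output (hL : ∀ d, σ.var (xL d) < W) :
    Runs S W output σ fun τ t => t ≤ 5 ∧ τ.var xN = max (σ.var (xL true)) (σ.var (xL false)) := by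
  unfold output
  simp only [runs_ite, runs_assign]
  grind

theorem initState_data : (initState n k).data = ⟨fun _ => 0, fun _ _ => 0, fun _ => []⟩ := by
  unfold State.data
  congr 1
  · funext d
    cases d <;> simp [initState, slot]
  · funext d
    cases d <;> simp [State.row, initState, slot, segment]

theorem Inv.isLongestLength {m : ℕ} {D : Data} (h : Inv n k (key S) m n D)
    (hS : Function.Injective S) (hk : 2 ≤ k) :
    IsLongestLength k S (max (D.L true) (D.L false)) := by
  have hmax : ∀ d, D.L d ≤ max (D.L true) (D.L false)
    | true => le_max_left _ _
    | false => le_max_right _ _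
  refine isLongestLength_of_reach hS hk ?_ fun d x v hR =>
    (h.complete d x v hR.lt hR).trans (hmax d)
  obtain ⟨d, hd⟩ : ∃ d, max (D.L true) (D.L false) = D.L d :=
    (max_choice _ _).elim (fun h => ⟨true, h⟩) fun h => ⟨false, h⟩
  rw [hd]
  rcases Nat.eq_zero_or_pos (D.L d) with hzero | hpos
  · exact Or.inl hzero
  · obtain ⟨-, v, hv, hR⟩ := h.full d _ hpos le_rfl
    exact Or.inr ⟨d, _, v, hv, hR⟩

theorem State.budget_le (hk : 3 ≤ k) (hT : σ.var xT ≤ n) (hL : ∀ d, σ.data.L d ≤ n) :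
    σ.budget k ≤ 3300 * (n * k ^ 2) := by
  have htime := Nat.mul_le_mul_left (3000 * k ^ 2) hT
  have hvalue := Nat.mul_le_mul_left (84 * k + 60) (Nat.add_le_add (hL true) (hL false))
  have hsq : 3 * k ≤ k ^ 2 := by nlinarith
  have := Nat.mul_le_mul_left n hsq
  have := Nat.mul_le_mul_left n hk
  unfold State.budget
  nlinarith

theorem runs_loop (hk : 3 ≤ k) (hS : Function.Injective S) (hW : 8 * (n + k + 2) ≤ W) :
    Runs S W (.loop (.lt (.var xT) (.var xN)) advance) (initState n k) fun τ t =>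
      Inv n k (key S) (3 * k) n τ.data ∧ t ≤ 3300 * (n * k ^ 2) + 3 := by
  refine Runs.loop (fun τ s => τ.var xT ≤ n ∧ τ.var xK = k ∧ τ.var xN = n ∧
    Inv n k (key S) (3 * k) (τ.var xT) τ.data ∧ s + 14 * τ.data.energy k ≤ τ.budget k)
    (fun τ => n - τ.var xT) ?_ ?_
  · have hT : (initState n k).var xT = 0 := by simp [initState, slot]
    refine ⟨hT.trans_le (Nat.zero_le n), by simp [initState, slot], by simp [initState, slot], ?_,
      ?_⟩
    · rw [hT, initState_data]
      exact inv_zero n k _ (key S) _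
    · simp [initState_data, Data.energy, Data.potential, potential]
  · rintro τ s ⟨hT, hK, hN, hinv, hs⟩
    refine ⟨by simp only [Test.Safe, Expr.Fits]; omega, fun hlt => ?_, fun hge => ?_⟩
    · replace hlt : τ.var xT < n := by simpa [Test.Holds, Expr.eval, hN] using hlt
      refine (Ready.mk hS hk hK hlt hW hinv).runs_advance_amortized.mono ?_
      rintro υ t ⟨hinv', hT', hK', hN', ht⟩
      refine ⟨⟨by omega, hK', by omega, hinv', ?_⟩, by omega⟩
      simp only [Test.cost, Expr.cost]
      omega
    · have hT' : τ.var xT = n := by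
        simp only [Test.Holds, Expr.eval] at hge
        omega
      have hbudget := State.budget_le hk hT hinv.L_le
      exact ⟨hT' ▸ hinv, by simp only [Test.cost, Expr.cost]; omega⟩

theorem runs_longest (hk : 3 ≤ k) (hS : Function.Injective S) :
    Runs S ((n + k + 2) ^ 3) longest (initState n k) fun τ t =>
      IsLongestLength k S (τ.var 0) ∧ t ≤ 4000 * (max n 1 * k ^ 2) := by
  have hword : 8 * (n + k + 2) ≤ (n + k + 2) ^ 3 := by
    have : 5 ^ 2 ≤ (n + k + 2) ^ 2 := Nat.pow_le_pow_left (by omega) 2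
    rw [pow_succ]
    exact Nat.mul_le_mul_right _ (by omega)
  unfold longest
  rw [runs_seq]
  refine (runs_loop hk hS hword).mono ?_
  rintro τ s ⟨hinv, hs⟩
  refine (runs_output fun d => ?_).mono ?_
  · have hL : τ.var (xL d) ≤ n := hinv.L_le d
    omega
  rintro υ t ⟨ht, hlength⟩
  refine ⟨?_, ?_⟩
  · change IsLongestLength k S (υ.var xN)
    rw [hlength]
    exact hinv.isLongestLength hS (by omega)
  · have hn := Nat.mul_le_mul_right (k ^ 2) (le_max_left n 1)
    have hone := Nat.mul_le_mul_right (k ^ 2) (le_max_right n 1)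
    nlinarith

end longest

end Rollercoaster

theorem mainTheorem1 :
    ∃ (P : Rollercoaster.Cmd) (c C : ℕ),
      (∀ k : ℕ, 3 ≤ k → ∀ (n : ℕ) (S : Fin n → ℝ), Function.Injective S →
        Rollercoaster.ComputesWithin P c k S (C * (max n 1 * k ^ 2))) ∧
      (∀ k : ℕ, 3 ≤ k → ∃ D : ℕ, ∀ (n : ℕ) (S : Fin n → ℝ), Function.Injective S →
        Rollercoaster.ComputesWithin P c k S (D * max n 1)) := by
  refine ⟨Rollercoaster.longest, 3, 4000, fun k hk n S hS => Rollercoaster.runs_longest hk hS,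
    fun k hk => ⟨4000 * k ^ 2, fun n S hS => ?_⟩⟩
  have hcomm : 4000 * k ^ 2 * max n 1 = 4000 * (max n 1 * k ^ 2) := by ring
  rw [hcomm]
  exact Rollercoaster.runs_longest hk hS
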